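/- Let $n\ge 1$ and $\frac1n<\alpha\le 1$. Let $\Sigma$ be a compact connected smooth $n$-manifold, let $0<T^*<\infty$, and let $X:\Sigma\times[0,T^*)\to\mathbb{R}^{n+1}$ be a smooth map such that each $X(\cdot,t)$ is a smooth embedding and $$\frac{\partial X}{\partial t}(x,t)=-K^\alpha(x,t)\,\nu(x,t),\qquad (x,t)\in\Sigma\times[0,T^*),$$ where $\nu$ is the outward unit normal and $K$ the Gauss curvature of $\Sigma_t=X(\Sigma,t)$. Assume that the initial hypersurface $\Sigma_0$ is strictly convex: it bounds a convex body and its second fundamental form with respect to $\nu$ (with the sign $h_{ij}=-\langle \partial_i\partial_j X,\nu\rangle$) is positive definite. Let $V(t)$ be the volume of the convex body enclosed by $\Sigma_t$, and let $T^*$ be the time at which the volume vanishes: $V(t)\to0$ as $t\uparrow T^*$. Put $$\tau(t)=-\log\frac{V(t)}{V(0)},\qquad \tilde X(\cdot,\tau(t))=\frac{X(\cdot,t)}{V(t)^{1/(n+1)}},$$ so that $\tau$ runs over $[0,\infty)$ and the rescaled hypersurfaces $\tilde\Sigma_\tau=\tilde X(\Sigma,\tau)$ enclose volume $1$. Let $\tilde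 S(z,\tau)=\max_{x\in\Sigma}\langle z,\tilde X(x,\tau)\rangle$ be the support function of $\tilde\Sigma_\tau$, let $\tilde w(z,\tau)=\tilde S(z,\tau)+\tilde S(-z,\tau)$ for $z\in\mathbb{S}^n$ be its width function, and let $\tilde w_{\min}(\tau)=\min_{z\in\mathbb{S}^n}\tilde w(z,\tau)$, $\tilde w_{\max}(\tau)=\max_{z\in\mathbb{S}^n}\tilde w(z,\tau)$. Then there exist constants $0<c\le C<\infty$ such that $$c\le\tilde w_{\min}(\tau)\le\tilde w_{\max}(\tau)\le C\qquad\text{for all }\tau\in[0,\infty).$$ -/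

import Mathlib

open Set Filter Topology MeasureTheory
open scoped Manifold ContDiff RealInnerProductSpace

noncomputable section

namespace GaussFlow

section Geometry

-- the standard (one chart) manifold structure on a vector space
attribute [local instance 2000] chartedSpaceSelf

variable {n : ℕ} {M : Type*} [TopologicalSpace M] [ChartedSpace (EuclideanSpace ℝ (Fin n)) M]

/-- The map `X : M → ℝⁿ⁺¹` written in the local coordinates `(x¹, …, xⁿ)` of the chart at `x`. -/
def coordMap (X : M → EuclideanSpace ℝ (Fin (n + 1))) (x : M) :
    EuclideanSpace ℝ (Fin n) → EuclideanSpace ℝ (Fin (n + 1)) :=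
  X ∘ (extChartAt (𝓡 n) x).symm

/-- The coordinate tangent vector field `∂X/∂xⁱ`, as a function of the coordinates `u` of the chart
at `x`. -/
def coordDeriv (X : M → EuclideanSpace ℝ (Fin (n + 1))) (x : M) (i : Fin n)
    (u : EuclideanSpace ℝ (Fin n)) : EuclideanSpace ℝ (Fin (n + 1)) :=
  fderiv ℝ (coordMap X x) u (EuclideanSpace.single i 1)

/-- The second derivative `∂²X/∂xⁱ∂xʲ`, in the chart at `x`, at the point `x`. -/
def coordDeriv₂ (X : M → EuclideanSpace ℝ (Fin (n + 1))) (x : M) (i j : Fin n) :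
    EuclideanSpace ℝ (Fin (n + 1)) :=
  fderiv ℝ (coordDeriv X x j) (extChartAt (𝓡 n) x x) (EuclideanSpace.single i 1)

/-- The induced metric `g_ij = ⟨∂X/∂xⁱ, ∂X/∂xʲ⟩` at `x`. -/
def metric (X : M → EuclideanSpace ℝ (Fin (n + 1))) (x : M) : Matrix (Fin n) (Fin n) ℝ :=
  Matrix.of fun i j =>
    ⟪coordDeriv X x i (extChartAt (𝓡 n) x x), coordDeriv X x j (extChartAt (𝓡 n) x x)⟫

/-- The second fundamental form `h_ij = -⟨∂²X/∂xⁱ∂xʲ, ν⟩` at `x`, with respect to the normal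
field `ν`. -/
def secondFundamentalForm (X ν : M → EuclideanSpace ℝ (Fin (n + 1))) (x : M) :
    Matrix (Fin n) (Fin n) ℝ :=
  Matrix.of fun i j => -⟪coordDeriv₂ X x i j, ν x⟫

/-- The matrix `h^i_j = g^{ik} h_kj` of the Weingarten map at `x`. -/
def weingarten (X ν : M → EuclideanSpace ℝ (Fin (n + 1))) (x : M) : Matrix (Fin n) (Fin n) ℝ :=
  (metric X x)⁻¹ * secondFundamentalForm X ν x

/-- The Gauss curvature `K = det (h^i_j)`, the product of the principal curvatures. -/
def gaussCurvature (X ν : M → EuclideanSpace ℝ (Fin (n + 1))) (x : M) : ℝ :=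
  (weingarten X ν x).det

/-- `ν` is a field of unit vectors normal to the hypersurface `X`. -/
def IsUnitNormal (X ν : M → EuclideanSpace ℝ (Fin (n + 1))) : Prop :=
  ∀ x, ‖ν x‖ = 1 ∧ ∀ i, ⟪coordDeriv X x i (extChartAt (𝓡 n) x x), ν x⟫ = 0

/-- The closed hypersurface `X` with unit normal field `ν` is strictly convex, and `ν` is the
outward normal: the hypersurface lies on the inner side of each of its tangent hyperplanes, and the
second fundamental form is positive definite everywhere. -/
structure IsStrictlyConvex (X ν : M → EuclideanSpace ℝ (Fin (n + 1))) : Prop where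
  supporting : ∀ x y, ⟪X y - X x, ν x⟫ ≤ 0
  posDef : ∀ x, (secondFundamentalForm X ν x).PosDef

/-- `X` is a smooth solution, on the time interval `[0, T)`, of the `α`-Gauss curvature flow
`∂X/∂t = -K^α ν` of closed embedded hypersurfaces, `ν` being the outward unit normal, whose initial
hypersurface is strictly convex. The normal `ν 0` is outward by `initial`; since `ν` is continuous in
space and time and the hypersurfaces stay embedded, `ν t` is then the outward normal at all times.
Convexity is required at time `0` only. -/
structure IsGaussCurvatureFlow (α T : ℝ) (X ν : ℝ → M → EuclideanSpace ℝ (Fin (n + 1))) :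
    Prop where
  smooth : ContMDiffOn (𝓘(ℝ, ℝ).prod (𝓡 n)) (𝓡 (n + 1)) ∞ (Function.uncurry X)
    (Ico 0 T ×ˢ univ)
  embedding : ∀ t ∈ Ico 0 T, Manifold.IsSmoothEmbedding (𝓡 n) (𝓡 (n + 1)) ∞ (X t)
  normal : ∀ t ∈ Ico 0 T, IsUnitNormal (X t) (ν t)
  normal_continuous : ContinuousOn (Function.uncurry ν) (Ico 0 T ×ˢ univ)
  initial : IsStrictlyConvex (X 0) (ν 0)
  evolution : ∀ t ∈ Ico 0 T, ∀ x,
    HasDerivWithinAt (fun s => X s x) (-(gaussCurvature (X t) (ν t) x ^ α) • ν t x) (Ico 0 T) t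

end Geometry

section Rescaling

variable {n : ℕ} {M : Type*}

/-- The volume `V` enclosed by a closed convex hypersurface, i.e. the Lebesgue measure of the convex
body that it bounds. -/
def enclosedVolume (X : M → EuclideanSpace ℝ (Fin (n + 1))) : ℝ :=
  volume.real (convexHull ℝ (range X))

/-- The support function `S(z)` of a closed convex hypersurface: the maximum of `⟨z, X x⟩` over the
hypersurface, which is attained where the outward unit normal is `z`, so that
`S(z) = ⟨z, X(ν⁻¹(z))⟩`. -/
def supportFunction (X : M → EuclideanSpace ℝ (Fin (n + 1)))
    (z : EuclideanSpace ℝ (Fin (n + 1))) : ℝ :=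
  ⨆ x, ⟪z, X x⟫

/-- The width `w(z) = S(z) + S(-z)` in the direction `z`. -/
def width (X : M → EuclideanSpace ℝ (Fin (n + 1))) (z : EuclideanSpace ℝ (Fin (n + 1))) : ℝ :=
  supportFunction X z + supportFunction X (-z)

/-- The minimal width over all directions `z ∈ 𝕊ⁿ`. -/
def widthMin (X : M → EuclideanSpace ℝ (Fin (n + 1))) : ℝ :=
  ⨅ z : Metric.sphere (0 : EuclideanSpace ℝ (Fin (n + 1))) 1, width X z

/-- The maximal width over all directions `z ∈ 𝕊ⁿ`. -/
def widthMax (X : M → EuclideanSpace ℝ (Fin (n + 1))) : ℝ :=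
  ⨆ z : Metric.sphere (0 : EuclideanSpace ℝ (Fin (n + 1))) 1, width X z

/-- The rescaled time `τ(t) = -log (V(t) / V(0))`. -/
def rescaledTime (X : ℝ → M → EuclideanSpace ℝ (Fin (n + 1))) (t : ℝ) : ℝ :=
  -Real.log (enclosedVolume (X t) / enclosedVolume (X 0))

/-- The original time `t(τ) ∈ [0, T)`: the inverse of the bijection `t ↦ τ(t)` from `[0, T)` onto
`[0, ∞)`. -/
def originalTime (T : ℝ) (X : ℝ → M → EuclideanSpace ℝ (Fin (n + 1))) (τ : ℝ) : ℝ :=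
  Function.invFunOn (rescaledTime X) (Ico 0 T) τ

/-- The rescaled hypersurface `X̃(τ) = X(t) / V(t)^(1/(n+1))`, `t = t(τ)`, which encloses volume
`1`. -/
def rescaled (T : ℝ) (X : ℝ → M → EuclideanSpace ℝ (Fin (n + 1))) (τ : ℝ) (x : M) :
    EuclideanSpace ℝ (Fin (n + 1)) :=
  (enclosedVolume (X (originalTime T X τ)) ^ (1 / ((n : ℝ) + 1)))⁻¹ • X (originalTime T X τ) x

end Rescaling

end GaussFlow

end

set_option linter.unusedSectionVars false

noncomputable section

namespace GaussFlow

/-! Parametrize each hypersurface by its outward normal ζ, and for a point p inside the body at a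
late time b put u(t, ζ) = S(t, ζ) - ⟨ζ, p⟩. The flow reads ∂u/∂t = -K^α, and the volume decreases at
a rate of at most A = ∫ K^(α-1) dζ, since the points lost are swept by the hypersurface. The cone
decomposition of the body seen from p gives ∫ u/K ≤ (n+1)V. Chebyshev's inequality with weight u/K
then yields A/((n+1)V) · ∫ u^(1-1/α) ≤ ∫ u^(-1/α) K^α (`entropy_production`). The right side is, up
to the factor 1/α - 1, the time derivative of ∫ u^(1-1/α). Hence for α < 1 and q = 1/α - 1 the scale
invariant quantity V^(q/(n+1)) ∫ u^(-q) does not decrease. At a fixed earlier time a it is bounded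
below independently of p, because u ≤ D there. So it has a lower bound c > 0 uniform in b and p
(`exists_entropy_bound`). For α = 1 the same argument runs with ∫ log u, and a tangent line of the
exponential converts the result into the moment with q = 1/2.

In the opposite direction, a body that is long compared with V^(1/(n+1)) has an interior point p for
which the negative moment is small (`integral_rpow_neg_le`). Such a p is the average of the end
points of a long segment and of edge vectors whose determinant is maximal. Seen from it, u is large
except for normals in a thin strip of the sphere, and there the maximal determinant controls the
integral. Together these bound the diameter by C V^(1/(n+1)) (`exists_diameter_bound`). As the
volume is at most a constant times a width times the n-th power of the diameter, every width is
comparable to V^(1/(n+1)), which is the claim after rescaling.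

All this needs strict convexity at every time, while it is given only initially. It is an open
condition by compactness (`eventually_stronglyConvex`). It is closed because the speed cannot decay
to zero: the flow is compared with its own translate in time through the maximum principle for
support functions (`supportFunction_sub_le`, `exists_le_speed`), so the determinant of the second
fundamental form cannot vanish in the limit. -/

/-- Coordinate space `ℝⁿ`. -/
abbrev Euc (n : ℕ) := EuclideanSpace ℝ (Fin n)

/-! ### Space and time derivatives of maps smooth on a time set times an open set -/

section Calculus

variable {V W : Type*} [NormedAddCommGroup V] [NormedSpace ℝ V]
  [NormedAddCommGroup W] [NormedSpace ℝ W]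

/-- The set `I` may have an end point, so space-time derivatives are taken within `I ×ˢ U`. With the
time frozen only the open set `U` remains, and the derivative there is unrestricted. -/
theorem hasFDerivAt_slice {Z : ℝ × V → W} {I : Set ℝ} {U : Set V} (hU : IsOpen U)
    (hZ : ContDiffOn ℝ ∞ Z (I ×ˢ U)) {q : ℝ × V} (hq : q ∈ I ×ˢ U) :
    HasFDerivAt (fun v => Z (q.1, v))
      ((fderivWithin ℝ Z (I ×ˢ U) q).comp (ContinuousLinearMap.inr ℝ ℝ V)) q.2 := by
  have h1 : HasFDerivWithinAt Z (fderivWithin ℝ Z (I ×ˢ U) q) (I ×ˢ U) q :=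
    ((hZ q hq).differentiableWithinAt (by simp)).hasFDerivWithinAt
  have h2 : HasFDerivWithinAt (fun v : V => (q.1, v)) (ContinuousLinearMap.inr ℝ ℝ V) U q.2 :=
    (hasFDerivAt_prodMk_right q.1 q.2).hasFDerivWithinAt
  have h3 : HasFDerivWithinAt (fun v => Z (q.1, v))
      ((fderivWithin ℝ Z (I ×ˢ U) q).comp (ContinuousLinearMap.inr ℝ ℝ V)) U q.2 :=
    HasFDerivWithinAt.comp q.2 (t := I ×ˢ U) h1 h2 (fun v hv => ⟨hq.1, hv⟩)
  exact h3.hasFDerivAt (hU.mem_nhds hq.2)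

/-- The space derivative is a component of the full derivative within `I ×ˢ U`, so it is again
smooth on the same set and the statement can be iterated. This makes second space derivatives
jointly continuous up to the initial time. -/
theorem contDiffOn_fderiv_slice {Z : ℝ × V → W} {I : Set ℝ} {U : Set V} (hI : UniqueDiffOn ℝ I)
    (hU : IsOpen U) (hZ : ContDiffOn ℝ ∞ Z (I ×ˢ U)) :
    ContDiffOn ℝ ∞ (fun q : ℝ × V => fderiv ℝ (fun v => Z (q.1, v)) q.2) (I ×ˢ U) := by
  have h1 : ContDiffOn ℝ ∞ (fderivWithin ℝ Z (I ×ˢ U)) (I ×ˢ U) :=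
    hZ.fderivWithin (hI.prod hU.uniqueDiffOn) (by simp)
  have h2 : ContDiffOn ℝ ∞ (fun q => (fderivWithin ℝ Z (I ×ˢ U) q).comp
      (ContinuousLinearMap.inr ℝ ℝ V)) (I ×ˢ U) := h1.clm_comp contDiffOn_const
  exact h2.congr fun q hq => (hasFDerivAt_slice hU hZ hq).fderiv

theorem hasDerivWithinAt_slice {Z : ℝ × V → W} {I : Set ℝ} {U : Set V}
    (hZ : ContDiffOn ℝ ∞ Z (I ×ˢ U)) {q : ℝ × V} (hq : q ∈ I ×ˢ U) :
    HasDerivWithinAt (fun s => Z (s, q.2)) (fderivWithin ℝ Z (I ×ˢ U) q (1, 0)) I q.1 := by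
  have h1 : HasFDerivWithinAt Z (fderivWithin ℝ Z (I ×ˢ U) q) (I ×ˢ U) q :=
    ((hZ q hq).differentiableWithinAt (by simp)).hasFDerivWithinAt
  have h2 : HasDerivWithinAt (fun s : ℝ => (s, q.2)) ((1 : ℝ), (0 : V)) I q.1 :=
    (hasDerivWithinAt_id _ _).prodMk (hasDerivWithinAt_const _ _ _)
  exact HasFDerivWithinAt.comp_hasDerivWithinAt (t := I ×ˢ U) q.1 h1 h2 (fun v hv => ⟨hv, hq.2⟩)

end Calculus

/-! ### Hypersurfaces in a chart: smoothness, immersion, normal direction -/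

section Charts

attribute [local instance 2000] chartedSpaceSelf

variable {n : ℕ} {M : Type*} [TopologicalSpace M] [ChartedSpace (EuclideanSpace ℝ (Fin n)) M]

theorem contDiffOn_coordMap [IsManifold (𝓡 n) ∞ M] {X : M → Euc (n + 1)}
    (hX : ContMDiff (𝓡 n) (𝓡 (n + 1)) ∞ X) (x : M) :
    ContDiffOn ℝ ∞ (coordMap X x) (extChartAt (𝓡 n) x).target := by
  rw [← contMDiffOn_iff_contDiffOn]
  exact (hX.contMDiffOn (s := univ)).comp (contMDiffOn_extChartAt_symm x) (fun _ _ => mem_univ _)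

/-- The flow in the coordinates of the chart at `x`. -/
def chartFlow (X : ℝ → M → Euc (n + 1)) (x : M) (q : ℝ × Euc n) : Euc (n + 1) :=
  coordMap (X q.1) x q.2

theorem contDiffOn_chartFlow [IsManifold (𝓡 n) ∞ M] {I : Set ℝ} {X : ℝ → M → Euc (n + 1)}
    (hX : ContMDiffOn (𝓘(ℝ, ℝ).prod (𝓡 n)) (𝓡 (n + 1)) ∞ (Function.uncurry X) (I ×ˢ univ)) (x : M) :
    ContDiffOn ℝ ∞ (chartFlow X x) (I ×ˢ (extChartAt (𝓡 n) x).target) := by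
  rw [← contMDiffOn_iff_contDiffOn, modelWithCornersSelf_prod, ← chartedSpaceSelf_prod]
  have h : ContMDiffOn (𝓘(ℝ, ℝ).prod (𝓡 n)) (𝓘(ℝ, ℝ).prod (𝓡 n)) ∞
      (fun q : ℝ × Euc n => (q.1, (extChartAt (𝓡 n) x).symm q.2))
      (I ×ˢ (extChartAt (𝓡 n) x).target) := by
    refine ContMDiffOn.prodMk contMDiffOn_fst ?_
    exact (contMDiffOn_extChartAt_symm x).comp contMDiffOn_snd (fun q hq => hq.2)
  exact hX.comp h (fun q hq => ⟨hq.1, mem_univ _⟩)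

/-- In suitable charts an immersion is `u ↦ equiv (u, 0)`. Undoing `equiv`, projecting to the first
factor and returning to the chart at `x` gives a differentiable local left inverse `R`, and the
chain rule makes its derivative a left inverse of the derivative of `coordMap`. -/
theorem fderiv_coordMap_injective [IsManifold (𝓡 n) ∞ M] {X : M → Euc (n + 1)}
    (hX : Manifold.IsSmoothEmbedding (𝓡 n) (𝓡 (n + 1)) ∞ X) (x : M) :
    Function.Injective (fderiv ℝ (coordMap X x) (extChartAt (𝓡 n) x x)) := by
  have hi := hX.isImmersion.isImmersionAt x
  set u₀ := extChartAt (𝓡 n) x x with hu₀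
  have hφ : DifferentiableAt ℝ (coordMap X x) u₀ :=
    ((contDiffOn_coordMap hX.contMDiff x).contDiffAt
      ((isOpen_extChartAt_target x).mem_nhds (mem_extChartAt_target x))).differentiableAt (by simp)
  have hxs : (extChartAt (𝓡 n) x).symm u₀ = x := extChartAt_to_inv x
  let R : Euc (n + 1) → Euc n := fun p =>
    extChartAt (𝓡 n) x (hi.domChart.symm (hi.equiv.symm (hi.codChart p)).1)
  have hdomx : (hi.equiv.symm (hi.codChart (X x))).1 = hi.domChart x := by
    have h := hi.writtenInCharts (show hi.domChart x ∈ (hi.domChart.extend (𝓡 n)).target by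
      simpa using hi.domChart.map_source hi.mem_domChart_source)
    simp only [Function.comp_apply, OpenPartialHomeomorph.extend_coe,
      OpenPartialHomeomorph.extend_coe_symm, modelWithCornersSelf_coe,
      modelWithCornersSelf_coe_symm, id] at h
    rw [hi.domChart.left_inv hi.mem_domChart_source] at h
    rw [h]; simp
  have hR : DifferentiableAt ℝ R (coordMap X x u₀) := by
    have hcx : coordMap X x u₀ = X x := congrArg X hxs
    rw [hcx, ← mdifferentiableAt_iff_differentiableAt]
    have h1 : ContMDiffAt (𝓡 (n + 1)) (𝓡 (n + 1)) ∞ hi.codChart (X x) :=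
      contMDiffAt_of_mem_maximalAtlas hi.codChart_mem_maximalAtlas hi.mem_codChart_source
    have h2 : ContMDiffAt (𝓡 n) (𝓡 n) ∞ hi.domChart.symm
        ((hi.equiv.symm (hi.codChart (X x))).1) := by
      rw [hdomx]
      exact contMDiffAt_symm_of_mem_maximalAtlas hi.domChart_mem_maximalAtlas
        (hi.domChart.map_source hi.mem_domChart_source)
    have h3 : ContMDiffAt (𝓡 n) (𝓡 n) ∞ (extChartAt (𝓡 n) x)
        (hi.domChart.symm ((hi.equiv.symm (hi.codChart (X x))).1)) := by
      rw [hdomx, hi.domChart.left_inv hi.mem_domChart_source]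
      exact contMDiffAt_extChartAt
    have h4 : ContMDiff (𝓡 (n + 1)) (𝓡 n) ∞
        (fun p : Euc (n + 1) => (hi.equiv.symm p).1) :=
      ContDiff.contMDiff (contDiff_fst.comp hi.equiv.symm.contDiff)
    exact (ContMDiffAt.comp (X x) h3 (ContMDiffAt.comp (X x) h2
      (ContMDiffAt.comp (X x) h4.contMDiffAt h1))).mdifferentiableAt (by simp)
  have hid : R ∘ coordMap X x =ᶠ[𝓝 u₀] id := by
    have ht : ∀ᶠ u in 𝓝 u₀, u ∈ (extChartAt (𝓡 n) x).target :=
      (isOpen_extChartAt_target x).mem_nhds (mem_extChartAt_target x)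
    have hd : ∀ᶠ u in 𝓝 u₀, (extChartAt (𝓡 n) x).symm u ∈ hi.domChart.source := by
      have hc : ContinuousAt (extChartAt (𝓡 n) x).symm u₀ := continuousAt_extChartAt_symm x
      apply hc.preimage_mem_nhds
      rw [hxs]
      exact hi.domChart.open_source.mem_nhds hi.mem_domChart_source
    filter_upwards [ht, hd] with u hu hud
    have h := hi.writtenInCharts (show hi.domChart ((extChartAt (𝓡 n) x).symm u) ∈
      (hi.domChart.extend (𝓡 n)).target by simpa using hi.domChart.map_source hud)
    simp only [Function.comp_apply, OpenPartialHomeomorph.extend_coe,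
      OpenPartialHomeomorph.extend_coe_symm, modelWithCornersSelf_coe,
      modelWithCornersSelf_coe_symm, id] at h
    rw [hi.domChart.left_inv hud] at h
    simp only [Function.comp_apply, coordMap, R, id]
    rw [h]
    simp only [ContinuousLinearEquiv.symm_apply_apply]
    rw [hi.domChart.left_inv hud]
    exact (extChartAt (𝓡 n) x).right_inv hu
  have hD : (fderiv ℝ R (coordMap X x u₀)).comp (fderiv ℝ (coordMap X x) u₀) =
      ContinuousLinearMap.id ℝ (Euc n) := by
    have h1 := (hR.hasFDerivAt.comp u₀ hφ.hasFDerivAt).congr_of_eventuallyEq hid.symm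
    exact h1.unique (hasFDerivAt_id u₀)
  intro a b hab
  have := congrArg (fderiv ℝ R (coordMap X x u₀)) hab
  have ha := DFunLike.congr_fun hD a
  have hb := DFunLike.congr_fun hD b
  simp only [ContinuousLinearMap.comp_apply, ContinuousLinearMap.id_apply] at ha hb
  rw [← ha, ← hb, this]

theorem inner_fderiv_coordMap_self {X ν : M → Euc (n + 1)} (hν : IsUnitNormal X ν) (x : M)
    (a : Euc n) : ⟪fderiv ℝ (coordMap X x) (extChartAt (𝓡 n) x x) a, ν x⟫ = 0 := by
  have ha : a = ∑ i, a i • EuclideanSpace.single i (1 : ℝ) := by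
    ext j; simp [Finset.sum_apply, Pi.single_apply]
  rw [ha, map_sum, sum_inner]
  refine Finset.sum_eq_zero fun i _ => ?_
  rw [map_smul, real_inner_smul_left]
  have := (hν x).2 i
  unfold coordDeriv at this
  rw [this, mul_zero]

/-- `ν` is normal to the hypersurface in every chart. -/
theorem inner_fderiv_coordMap [IsManifold (𝓡 n) ∞ M] {X ν : M → Euc (n + 1)}
    (hX : ContMDiff (𝓡 n) (𝓡 (n + 1)) ∞ X) (hν : IsUnitNormal X ν) (x : M) {u : Euc n}
    (hu : u ∈ (extChartAt (𝓡 n) x).target) (a : Euc n) :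
    ⟪fderiv ℝ (coordMap X x) u a, ν ((extChartAt (𝓡 n) x).symm u)⟫ = 0 := by
  -- `IsUnitNormal` tests each point only in its own preferred chart, so the derivative at `u` is
  -- rewritten through the transition map to the chart at `y`.
  set y := (extChartAt (𝓡 n) x).symm u with hy
  have h1 : DifferentiableAt ℝ (coordMap X y) (extChartAt (𝓡 n) y y) :=
    ((contDiffOn_coordMap hX y).contDiffAt
      ((isOpen_extChartAt_target y).mem_nhds (mem_extChartAt_target y))).differentiableAt (by simp)
  have h2 : DifferentiableAt ℝ (fun v => extChartAt (𝓡 n) y ((extChartAt (𝓡 n) x).symm v)) u := by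
    rw [← mdifferentiableAt_iff_differentiableAt]
    have hs : ContMDiffAt (𝓡 n) (𝓡 n) ∞ (extChartAt (𝓡 n) x).symm u :=
      (contMDiffOn_extChartAt_symm x).contMDiffAt ((isOpen_extChartAt_target x).mem_nhds hu)
    exact (ContMDiffAt.comp u (g := extChartAt (𝓡 n) y) contMDiffAt_extChartAt hs).mdifferentiableAt (by simp)
  have h3 : coordMap X x =ᶠ[𝓝 u]
      coordMap X y ∘ (fun v => extChartAt (𝓡 n) y ((extChartAt (𝓡 n) x).symm v)) := by
    have hc : ContinuousAt (extChartAt (𝓡 n) x).symm u :=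
      (continuousOn_extChartAt_symm x).continuousAt ((isOpen_extChartAt_target x).mem_nhds hu)
    filter_upwards [hc.preimage_mem_nhds (extChartAt_source_mem_nhds (I := 𝓡 n) y)] with v hv
    simp only [coordMap, Function.comp_apply]
    rw [(extChartAt (𝓡 n) y).left_inv hv]
  have h4 := (h1.hasFDerivAt.comp u h2.hasFDerivAt).congr_of_eventuallyEq h3
  rw [h4.fderiv]
  exact inner_fderiv_coordMap_self hν y _

end Charts

/-! ### Comparison of determinants; the normal line of a hyperplane -/

section LinearAlgebra

-- Factor `A = Cᵀ * C`. The congruence by `C⁻¹` turns `A` into the identity and `B` into a symmetric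
-- `D` whose form dominates the identity. All eigenvalues of `D` are then at least one, so `1 ≤
-- D.det`, and multiplying by `C.det ^ 2` gives the claim. Positivity of `B` comes out of the
-- argument.
open Matrix MatrixOrder in
theorem det_le_det_of_posDef {ι : Type*} [Fintype ι] [DecidableEq ι] {A B : Matrix ι ι ℝ}
    (hA : A.PosDef) (hB : B.IsHermitian) (h : ∀ a : ι → ℝ, a ⬝ᵥ (A *ᵥ a) ≤ a ⬝ᵥ (B *ᵥ a)) :
    A.det ≤ B.det := by
  obtain ⟨C, hC⟩ := CStarAlgebra.nonneg_iff_eq_star_mul_self.mp hA.posSemidef.nonneg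
  have hCC : A = Cᵀ * C := by
    rw [hC, Matrix.star_eq_conjTranspose, Matrix.conjTranspose_eq_transpose_of_trivial]
  have hdet : A.det = C.det * C.det := by rw [hCC, det_mul, det_transpose]
  have hC0 : C.det ≠ 0 := by
    intro h0
    have := hA.det_pos
    rw [hdet, h0] at this
    simp at this
  have hCu : IsUnit C.det := isUnit_iff_ne_zero.mpr hC0
  set D : Matrix ι ι ℝ := (C⁻¹)ᵀ * B * C⁻¹ with hD
  have hDh : D.IsHermitian := by
    have := Matrix.isHermitian_conjTranspose_mul_mul C⁻¹ hB
    rwa [Matrix.conjTranspose_eq_transpose_of_trivial] at this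
  have hD1 : ∀ v : ι → ℝ, v ⬝ᵥ v ≤ v ⬝ᵥ (D *ᵥ v) := by
    intro v
    have e1 : C *ᵥ (C⁻¹ *ᵥ v) = v := by
      rw [mulVec_mulVec, mul_nonsing_inv _ hCu, one_mulVec]
    have h1 := h (C⁻¹ *ᵥ v)
    have e2 : (C⁻¹ *ᵥ v) ⬝ᵥ (A *ᵥ (C⁻¹ *ᵥ v)) = v ⬝ᵥ v := by
      rw [hCC, ← mulVec_mulVec, e1, mulVec_transpose, ← dotProduct_comm, ← dotProduct_mulVec, e1]
    have e3 : (C⁻¹ *ᵥ v) ⬝ᵥ (B *ᵥ (C⁻¹ *ᵥ v)) = v ⬝ᵥ (D *ᵥ v) := by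
      rw [hD, ← mulVec_mulVec, ← mulVec_mulVec, mulVec_transpose _ (B *ᵥ (C⁻¹ *ᵥ v)),
        dotProduct_comm v, ← dotProduct_mulVec, dotProduct_comm]
    rwa [e2, e3] at h1
  have hev : ∀ i, 1 ≤ hDh.eigenvalues i := by
    intro i
    have h1 := hD1 (hDh.eigenvectorBasis i)
    rw [hDh.mulVec_eigenvectorBasis i, dotProduct_smul] at h1
    have h2 : ((hDh.eigenvectorBasis i : EuclideanSpace ℝ ι) : ι → ℝ) ⬝ᵥ
        ((hDh.eigenvectorBasis i : EuclideanSpace ℝ ι) : ι → ℝ) = 1 := by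
      have h3 := hDh.eigenvectorBasis.orthonormal.1 i
      have h4 : ⟪hDh.eigenvectorBasis i, hDh.eigenvectorBasis i⟫ = 1 := by
        rw [real_inner_self_eq_norm_sq, h3, one_pow]
      rw [← h4, EuclideanSpace.inner_eq_star_dotProduct]
      simp
    rw [h2] at h1
    simpa using h1
  have hDdet : 1 ≤ D.det := by
    rw [hDh.det_eq_prod_eigenvalues]
    simp only [RCLike.ofReal_real_eq_id, id]
    calc (1 : ℝ) = ∏ _i : ι, (1 : ℝ) := by simp
      _ ≤ _ := Finset.prod_le_prod (fun _ _ => zero_le_one) fun i _ => hev i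
  have hBD : B.det = D.det * (C.det * C.det) := by
    rw [hD, det_mul, det_mul, det_transpose, det_nonsing_inv, Ring.inverse_eq_inv']
    field_simp
  rw [hdet, hBD]
  nlinarith [mul_self_nonneg C.det]

/-- A vector orthogonal to the image of an injective `L : ℝⁿ → ℝⁿ⁺¹` is a multiple of any unit
vector with that property. -/
theorem eq_smul_of_orthogonal_range {n : ℕ} {L : Euc n →L[ℝ] Euc (n + 1)}
    (hL : Function.Injective L) {ν ζ : Euc (n + 1)} (hν : ‖ν‖ = 1) (h : ∀ a, ⟪L a, ν⟫ = 0)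
    (h' : ∀ a, ⟪L a, ζ⟫ = 0) : ζ = ⟪ν, ζ⟫ • ν := by
  set K := (L : Euc n →ₗ[ℝ] Euc (n + 1)).range with hK
  have hfr : Module.finrank ℝ K = n := by
    have := LinearMap.finrank_range_of_inj (f := (L : Euc n →ₗ[ℝ] Euc (n + 1))) hL
    rw [hK, this]; simp
  have hfr' : Module.finrank ℝ Kᗮ = 1 := by
    have := K.finrank_add_finrank_orthogonal
    rw [hfr] at this
    simp at this
    omega
  have hνK : ν ∈ Kᗮ := by
    rw [Submodule.mem_orthogonal]
    rintro _ ⟨a, rfl⟩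
    exact h a
  have hζK : ζ ∈ Kᗮ := by
    rw [Submodule.mem_orthogonal]
    rintro _ ⟨a, rfl⟩
    exact h' a
  have hν0 : (⟨ν, hνK⟩ : Kᗮ) ≠ 0 := by
    intro h0
    have : ν = 0 := congrArg Subtype.val h0
    rw [this] at hν
    simp at hν
  obtain ⟨c, hc⟩ := (finrank_eq_one_iff_of_nonzero' _ hν0).mp hfr' ⟨ζ, hζK⟩
  have hc' : c • ν = ζ := congrArg Subtype.val hc
  rw [← hc', real_inner_smul_right, real_inner_self_eq_norm_sq, hν]
  simp

/-- A vector orthogonal to the unit normal of `L` lies in the image of `L`. -/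
theorem mem_range_of_orthogonal {n : ℕ} {L : Euc n →L[ℝ] Euc (n + 1)}
    (hL : Function.Injective L) {ν v : Euc (n + 1)} (hν : ‖ν‖ = 1) (h : ∀ a, ⟪L a, ν⟫ = 0)
    (hv : ⟪v, ν⟫ = 0) : ∃ a, L a = v := by
  set K := (L : Euc n →ₗ[ℝ] Euc (n + 1)).range with hK
  have hvK : v ∈ Kᗮᗮ := by
    rw [Submodule.mem_orthogonal]
    intro ζ hζ
    rw [Submodule.mem_orthogonal] at hζ
    rw [eq_smul_of_orthogonal_range hL hν h (ζ := ζ) fun a => hζ _ ⟨a, rfl⟩, real_inner_smul_left,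
      real_inner_comm v ν, hv, mul_zero]
  rw [Submodule.orthogonal_orthogonal] at hvK
  exact hvK

end LinearAlgebra

/-! ### Second order Taylor estimates along lines -/

section Taylor

/-- Integration twice, carried out by monotonicity so that no integrability of `g''` enters: `g' τ +
K τ` and then `g τ + K τ ^ 2 / 2` are antitone. -/
theorem le_neg_half_of_second_deriv_le {g g' g'' : ℝ → ℝ} {K : ℝ}
    (hg : ∀ τ ∈ Icc (0 : ℝ) 1, HasDerivAt g (g' τ) τ)
    (hg' : ∀ τ ∈ Icc (0 : ℝ) 1, HasDerivAt g' (g'' τ) τ) (h0 : g 0 = 0) (h0' : g' 0 = 0)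
    (hK : ∀ τ ∈ Icc (0 : ℝ) 1, g'' τ ≤ -K) : g 1 ≤ -(K / 2) := by
  have h1 : AntitoneOn (fun τ => g' τ + K * τ) (Icc 0 1) := by
    refine antitoneOn_of_hasDerivWithinAt_nonpos (f' := fun τ => g'' τ + K * 1) (convex_Icc 0 1)
      (fun τ hτ => ((hg' τ hτ).add ((hasDerivAt_id τ).const_mul K)).continuousAt.continuousWithinAt)
      (fun τ hτ => ((hg' τ (interior_subset hτ)).add
        ((hasDerivAt_id τ).const_mul K)).hasDerivWithinAt)
      (fun τ hτ => by have := hK τ (interior_subset hτ); linarith)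
  have h2 : ∀ τ ∈ Icc (0 : ℝ) 1, g' τ ≤ -K * τ := fun τ hτ => by
    have := h1 (by simp : (0 : ℝ) ∈ Icc 0 1) hτ hτ.1
    simp only [h0'] at this
    linarith
  have h3 : AntitoneOn (fun τ => g τ + K / 2 * τ ^ 2) (Icc 0 1) := by
    refine antitoneOn_of_hasDerivWithinAt_nonpos
      (f' := fun τ => g' τ + K / 2 * ((2 : ℕ) * τ ^ (2 - 1))) (convex_Icc 0 1)
      (fun τ hτ => ((hg τ hτ).add ((hasDerivAt_pow 2 τ).const_mul
        (K / 2))).continuousAt.continuousWithinAt)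
      (fun τ hτ => ((hg τ (interior_subset hτ)).add
        ((hasDerivAt_pow 2 τ).const_mul (K / 2))).hasDerivWithinAt)
      (fun τ hτ => by
        have := h2 τ (interior_subset hτ)
        norm_num
        linarith)
  have := h3 (by simp : (0 : ℝ) ∈ Icc 0 1) (by simp : (1 : ℝ) ∈ Icc 0 1) zero_le_one
  simp only [h0] at this
  linarith

variable {V W : Type*} [NormedAddCommGroup V] [NormedSpace ℝ V]
  [NormedAddCommGroup W] [NormedSpace ℝ W]

theorem hasDerivAt_line (u a : V) (s : ℝ) : HasDerivAt (fun s : ℝ => u + s • a) a s := by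
  simpa using ((hasDerivAt_id s).smul_const a).const_add u

/-- Second order Taylor expansion along a line. -/
theorem tendsto_taylor_two {φ : V → W} {u : V} (hφ : ContDiffAt ℝ 2 φ u) (a : V) :
    Tendsto (fun s : ℝ => (s ^ 2)⁻¹ • (φ (u + s • a) - φ u - s • fderiv ℝ φ u a)) (𝓝[>] 0)
      (𝓝 ((1 / 2 : ℝ) • fderiv ℝ (fderiv ℝ φ) u a a)) := by
  have hd : ∀ᶠ v in 𝓝 u, DifferentiableAt ℝ φ v :=
    (hφ.eventually (by simp)).mono fun v hv => hv.differentiableAt (by simp)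
  have hd2 : DifferentiableAt ℝ (fderiv ℝ φ) u :=
    (hφ.fderiv_right (m := 1) (by norm_num)).differentiableAt (by simp)
  have hline : Tendsto (fun s : ℝ => u + s • a) (𝓝 0) (𝓝 u) := by
    have := (hasDerivAt_line u a 0).continuousAt.tendsto
    simpa using this
  have hg2 : HasDerivAt (fun s : ℝ => fderiv ℝ φ (u + s • a) a) (fderiv ℝ (fderiv ℝ φ) u a a) 0 := by
    have h1 : HasFDerivAt (fderiv ℝ φ) (fderiv ℝ (fderiv ℝ φ) u) (u + (0 : ℝ) • a) := by
      simpa using hd2.hasFDerivAt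
    have h2 := h1.comp_hasDerivAt (0 : ℝ) (hasDerivAt_line u a 0)
    simpa using h2.clm_apply (hasDerivAt_const (0 : ℝ) a)
  rw [Metric.tendsto_nhds]
  intro ε hε
  have hsmall : ∀ᶠ s : ℝ in 𝓝 0, ‖fderiv ℝ φ (u + s • a) a - fderiv ℝ φ u a -
      s • fderiv ℝ (fderiv ℝ φ) u a a‖ ≤ ε / 2 * ‖s‖ := by
    have := (hasDerivAt_iff_isLittleO.mp hg2).def (half_pos hε)
    simpa using this
  obtain ⟨r, hr, hball⟩ := Metric.eventually_nhds_iff.mp (hsmall.and (hline.eventually hd))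
  have hev : ∀ᶠ s : ℝ in 𝓝[>] 0, s ∈ Ioo 0 r := Ioo_mem_nhdsGT hr
  filter_upwards [hev] with s hs
  -- `F` is the remainder after the quadratic term. Its derivative is at most `ε / 2 * s` on `[0,
  -- s]`, so the mean value inequality gives `‖F s‖ ≤ ε / 2 * s ^ 2`.
  set F : ℝ → W := fun σ => φ (u + σ • a) - φ u - σ • fderiv ℝ φ u a -
    (σ ^ 2 / 2) • fderiv ℝ (fderiv ℝ φ) u a a with hF
  have hin : ∀ σ ∈ Icc 0 s, dist σ 0 < r := fun σ hσ => by
    rw [Real.dist_eq, sub_zero, abs_of_nonneg hσ.1]; exact hσ.2.trans_lt hs.2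
  have hFd : ∀ σ ∈ Icc 0 s, HasDerivWithinAt F (fderiv ℝ φ (u + σ • a) a - fderiv ℝ φ u a -
      σ • fderiv ℝ (fderiv ℝ φ) u a a) (Icc 0 s) σ := by
    intro σ hσ
    have h1 := ((hball (hin σ hσ)).2).hasFDerivAt.comp_hasDerivAt σ (hasDerivAt_line u a σ)
    have h2 : HasDerivAt (fun σ : ℝ => σ • fderiv ℝ φ u a) (fderiv ℝ φ u a) σ := by
      simpa using (hasDerivAt_id σ).smul_const (fderiv ℝ φ u a)
    have h3 : HasDerivAt (fun σ : ℝ => (σ ^ 2 / 2) • fderiv ℝ (fderiv ℝ φ) u a a)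
        (σ • fderiv ℝ (fderiv ℝ φ) u a a) σ := by
      have : HasDerivAt (fun σ : ℝ => σ ^ 2 / 2) σ σ := by
        have := (hasDerivAt_pow 2 σ).div_const 2
        simpa using this
      exact this.smul_const _
    exact (((h1.sub_const (φ u)).sub h2).sub h3).hasDerivWithinAt
  have hmv := (convex_Icc (0 : ℝ) s).norm_image_sub_le_of_norm_hasDerivWithin_le
    (C := ε / 2 * s) hFd (fun σ hσ => by
      refine ((hball (hin σ hσ)).1).trans ?_
      have : ‖σ‖ ≤ s := by rw [Real.norm_eq_abs, abs_of_nonneg hσ.1]; exact hσ.2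
      gcongr) (left_mem_Icc.mpr hs.1.le) (right_mem_Icc.mpr hs.1.le)
  have hF0 : F 0 = 0 := by simp [hF]
  rw [hF0, sub_zero, sub_zero, Real.norm_eq_abs, abs_of_pos hs.1] at hmv
  have hs2 : (0 : ℝ) < s ^ 2 := pow_pos hs.1 2
  have hrew : (s ^ 2)⁻¹ • (φ (u + s • a) - φ u - s • fderiv ℝ φ u a) -
      (1 / 2 : ℝ) • fderiv ℝ (fderiv ℝ φ) u a a = (s ^ 2)⁻¹ • F s := by
    rw [hF]
    simp only [smul_sub, smul_smul]
    congr 2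
    field_simp [hs.1.ne']
  rw [dist_eq_norm, hrew, norm_smul, norm_inv, Real.norm_eq_abs, abs_of_pos hs2, inv_mul_lt_iff₀ hs2]
  calc ‖F s‖ ≤ ε / 2 * s * s := hmv
    _ < s ^ 2 * ε := by nlinarith

end Taylor

/-! ### The metric and the second fundamental form as quadratic forms -/

section Charts

attribute [local instance 2000] chartedSpaceSelf

variable {n : ℕ} {M : Type*} [TopologicalSpace M] [ChartedSpace (EuclideanSpace ℝ (Fin n)) M]

/-- The first derivative of `X` in the chart at `x`, at the point `x`. -/
def chartD (X : M → Euc (n + 1)) (x : M) : Euc n →L[ℝ] Euc (n + 1) :=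
  fderiv ℝ (coordMap X x) (extChartAt (𝓡 n) x x)

/-- The second derivative of `X` in the chart at `x`, at the point `x`. -/
def chartD2 (X : M → Euc (n + 1)) (x : M) : Euc n →L[ℝ] Euc n →L[ℝ] Euc (n + 1) :=
  fderiv ℝ (fderiv ℝ (coordMap X x)) (extChartAt (𝓡 n) x x)

variable {X ν : M → Euc (n + 1)}

theorem euc_eq_sum (a : Euc n) : a = ∑ i, a i • EuclideanSpace.single i (1 : ℝ) := by
  ext j; simp [Finset.sum_apply, Pi.single_apply]

open Matrix in
theorem dotProduct_metric (x : M) (a b : Euc n) :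
    (a : Fin n → ℝ) ⬝ᵥ (metric X x *ᵥ b) = ⟪chartD X x a, chartD X x b⟫ := by
  conv_rhs => rw [euc_eq_sum a, euc_eq_sum b]
  simp only [map_sum, sum_inner, inner_sum, map_smul, real_inner_smul_left, real_inner_smul_right]
  simp only [dotProduct, mulVec, metric, coordDeriv, chartD, Matrix.of_apply, Finset.mul_sum]
  rw [Finset.sum_comm]
  conv_rhs => rw [Finset.sum_comm]
  rw [Finset.sum_comm]
  refine Finset.sum_congr rfl fun i _ => Finset.sum_congr rfl fun j _ => by ring

theorem gaussCurvature_eq_div (x : M) :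
    gaussCurvature X ν x = (secondFundamentalForm X ν x).det / (metric X x).det := by
  rw [gaussCurvature, weingarten, Matrix.det_mul, Matrix.det_nonsing_inv, Ring.inverse_eq_inv',
    div_eq_inv_mul]

variable [IsManifold (𝓡 n) ∞ M]

theorem contDiffAt_coordMap (hX : ContMDiff (𝓡 n) (𝓡 (n + 1)) ∞ X) (x : M) :
    ContDiffAt ℝ ∞ (coordMap X x) (extChartAt (𝓡 n) x x) :=
  (contDiffOn_coordMap hX x).contDiffAt
    ((isOpen_extChartAt_target x).mem_nhds (mem_extChartAt_target x))

theorem coordDeriv₂_eq (hX : ContMDiff (𝓡 n) (𝓡 (n + 1)) ∞ X) (x : M) (i j : Fin n) :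
    coordDeriv₂ X x i j =
      chartD2 X x (EuclideanSpace.single i 1) (EuclideanSpace.single j 1) := by
  have hd : DifferentiableAt ℝ (fderiv ℝ (coordMap X x)) (extChartAt (𝓡 n) x x) :=
    ((contDiffAt_coordMap hX x).fderiv_right (m := ∞) (by simp)).differentiableAt (by simp)
  have h := hd.hasFDerivAt.clm_apply
    (hasFDerivAt_const (EuclideanSpace.single j (1 : ℝ) : Euc n) (extChartAt (𝓡 n) x x))
  unfold coordDeriv₂ coordDeriv
  rw [h.fderiv]
  simp [chartD2]

theorem chartD2_symm (hX : ContMDiff (𝓡 n) (𝓡 (n + 1)) ∞ X) (x : M) (a b : Euc n) :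
    chartD2 X x a b = chartD2 X x b a :=
  ((contDiffAt_coordMap hX x).isSymmSndFDerivAt
    (by simpa using (ENat.LEInfty.out : (2 : WithTop ℕ∞) ≤ ∞))).eq a b

theorem sff_isHermitian (hX : ContMDiff (𝓡 n) (𝓡 (n + 1)) ∞ X) (x : M) :
    (secondFundamentalForm X ν x).IsHermitian := by
  ext i j
  simp only [Matrix.conjTranspose_apply, secondFundamentalForm, Matrix.of_apply, star_trivial]
  rw [coordDeriv₂_eq hX, coordDeriv₂_eq hX, chartD2_symm hX]

open Matrix in
theorem dotProduct_sff (hX : ContMDiff (𝓡 n) (𝓡 (n + 1)) ∞ X) (x : M) (a b : Euc n) :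
    (a : Fin n → ℝ) ⬝ᵥ (secondFundamentalForm X ν x *ᵥ b) = -⟪chartD2 X x a b, ν x⟫ := by
  conv_rhs => rw [euc_eq_sum a, euc_eq_sum b]
  simp only [map_sum, _root_.sum_apply, sum_inner, map_smul,
    _root_.smul_apply, real_inner_smul_left, ← coordDeriv₂_eq hX]
  simp only [dotProduct, mulVec, secondFundamentalForm, Matrix.of_apply, ← Finset.sum_neg_distrib,
    Finset.mul_sum]
  rw [Finset.sum_comm]
  refine Finset.sum_congr rfl fun i _ => Finset.sum_congr rfl fun j _ => by ring

theorem posDef_sff_iff (hX : ContMDiff (𝓡 n) (𝓡 (n + 1)) ∞ X) (x : M) :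
    (secondFundamentalForm X ν x).PosDef ↔ ∀ a, a ≠ 0 → ⟪chartD2 X x a a, ν x⟫ < 0 := by
  rw [Matrix.posDef_iff_dotProduct_mulVec]
  constructor
  · rintro ⟨-, h⟩ a ha
    have := h (x := a) (by simpa using ha)
    rw [star_trivial, dotProduct_sff hX] at this
    linarith
  · refine fun h => ⟨sff_isHermitian hX x, fun a ha => ?_⟩
    have := h (WithLp.toLp 2 a) (by simpa using ha)
    have e := dotProduct_sff (ν := ν) hX x (WithLp.toLp 2 a) (WithLp.toLp 2 a)
    rw [star_trivial]
    simp only at e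
    rw [e]; linarith

theorem posDef_metric (hX : Manifold.IsSmoothEmbedding (𝓡 n) (𝓡 (n + 1)) ∞ X) (x : M) :
    (metric X x).PosDef := by
  refine Matrix.PosDef.of_dotProduct_mulVec_pos ?_ fun a ha => ?_
  · ext i j
    simp [metric, real_inner_comm]
  · have e := dotProduct_metric (X := X) x (WithLp.toLp 2 a) (WithLp.toLp 2 a)
    rw [star_trivial]
    simp only at e
    rw [e]
    refine real_inner_self_pos.mpr fun h0 => ha ?_
    have := fderiv_coordMap_injective hX x (h0.trans (map_zero _).symm)
    simpa using this

theorem gaussCurvature_pos (hX : Manifold.IsSmoothEmbedding (𝓡 n) (𝓡 (n + 1)) ∞ X) {x : M}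
    (h : (secondFundamentalForm X ν x).PosDef) : 0 < gaussCurvature X ν x := by
  rw [gaussCurvature_eq_div]
  exact div_pos h.det_pos (posDef_metric hX x).det_pos

/-- At a local maximum of a linear function `⟨ζ, ·⟩`, the normal is `±ζ`. -/
theorem eq_or_eq_neg_of_isLocalMax (hX : Manifold.IsSmoothEmbedding (𝓡 n) (𝓡 (n + 1)) ∞ X)
    (hν : IsUnitNormal X ν) {ζ : Euc (n + 1)} (hζ : ‖ζ‖ = 1) {x : M}
    (hx : IsLocalMax (fun y => ⟪ζ, X y⟫) x) : ν x = ζ ∨ ν x = -ζ := by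
  have hd : DifferentiableAt ℝ (coordMap X x) (extChartAt (𝓡 n) x x) :=
    (contDiffAt_coordMap hX.contMDiff x).differentiableAt (by simp)
  have hmax : IsLocalMax (fun u => ⟪ζ, coordMap X x u⟫) (extChartAt (𝓡 n) x x) := by
    have hc : ContinuousAt (extChartAt (𝓡 n) x).symm (extChartAt (𝓡 n) x x) :=
      continuousAt_extChartAt_symm x
    have hx' : ∀ᶠ y in 𝓝 ((extChartAt (𝓡 n) x).symm (extChartAt (𝓡 n) x x)),
        ⟪ζ, X y⟫ ≤ ⟪ζ, X x⟫ := by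
      rw [extChartAt_to_inv x]; exact hx
    filter_upwards [hc.eventually hx'] with u hu
    simp only [coordMap, Function.comp_apply, extChartAt_to_inv x]
    exact hu
  have h0 := hmax.hasFDerivAt_eq_zero ((hasFDerivAt_const ζ _).inner ℝ hd.hasFDerivAt)
  have horth : ∀ a, ⟪fderiv ℝ (coordMap X x) (extChartAt (𝓡 n) x x) a, ζ⟫ = 0 := fun a => by
    have := DFunLike.congr_fun h0 a
    simp at this
    rw [real_inner_comm]; exact this
  have h1 := eq_smul_of_orthogonal_range (fderiv_coordMap_injective hX x) (hν x).1
    (inner_fderiv_coordMap_self hν x) horth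
  set c := ⟪ν x, ζ⟫
  have hc : |c| = 1 := by
    have := congrArg norm h1
    rw [norm_smul, (hν x).1, hζ, mul_one] at this
    exact this.symm
  rcases (abs_eq zero_le_one).mp hc with h | h
  · left; rw [h1, h, one_smul]
  · right; rw [h1, h]; simp

end Charts

/-! ### Quantitative strict convexity and contact with hyperplanes -/

section StrongConvexity

attribute [local instance 2000] chartedSpaceSelf

/-- Compactness of the unit sphere and homogeneity of degree two; when the space is trivial the
sphere is empty and any constant serves. -/
theorem exists_le_neg_sq_of_neg {V : Type*} [NormedAddCommGroup V] [NormedSpace ℝ V]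
    [FiniteDimensional ℝ V] {W : Type*} [NormedAddCommGroup W] [InnerProductSpace ℝ W]
    (B : V →L[ℝ] V →L[ℝ] W) (w : W) (h : ∀ a, a ≠ 0 → ⟪B a a, w⟫ < 0) :
    ∃ c > 0, ∀ a, ⟪B a a, w⟫ ≤ -c * ‖a‖ ^ 2 := by
  have hcont : Continuous fun a : V => ⟪B a a, w⟫ := by fun_prop
  have hproper : ProperSpace V := FiniteDimensional.proper ℝ V
  have key : ∃ c > 0, ∀ a ∈ Metric.sphere (0 : V) 1, ⟪B a a, w⟫ ≤ -c := by
    rcases (Metric.sphere (0 : V) 1).eq_empty_or_nonempty with he | hne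
    · exact ⟨1, one_pos, fun a ha => by rw [he] at ha; exact ha.elim⟩
    · obtain ⟨a₀, ha₀, hmax⟩ := (isCompact_sphere (0 : V) 1).exists_isMaxOn hne hcont.continuousOn
      have ha₀' : a₀ ≠ 0 := by
        rintro rfl
        simp at ha₀
      refine ⟨-⟪B a₀ a₀, w⟫, by have := h a₀ ha₀'; linarith, fun a ha => ?_⟩
      rw [neg_neg]
      exact hmax ha
  obtain ⟨c, hc, hle⟩ := key
  refine ⟨c, hc, fun a => ?_⟩
  by_cases ha : a = 0
  · simp [ha]
  have hn : 0 < ‖a‖ := norm_pos_iff.mpr ha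
  have h1 := hle (‖a‖⁻¹ • a) (by simp [norm_smul, hn.ne'])
  simp only [map_smul, _root_.smul_apply, real_inner_smul_left] at h1
  have h2 : ⟪B a a, w⟫ = ‖a‖ ^ 2 * (‖a‖⁻¹ * (‖a‖⁻¹ * ⟪B a a, w⟫)) := by field_simp
  rw [h2]
  nlinarith [sq_nonneg ‖a‖]

theorem eventually_norm_sub_lt {S W : Type*} [TopologicalSpace S] [NormedAddCommGroup W]
    {f : S → W} {s : Set S} {x : S} (h : ContinuousWithinAt f s x) {ε : ℝ} (hε : 0 < ε) :
    ∀ᶠ y in 𝓝[s] x, ‖f y - f x‖ < ε := by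
  filter_upwards [h.tendsto.eventually (Metric.ball_mem_nhds _ hε)] with y hy
  rwa [← dist_eq_norm]

theorem tendsto_slope_line {V W : Type*} [NormedAddCommGroup V] [NormedSpace ℝ V]
    [NormedAddCommGroup W] [NormedSpace ℝ W] {φ : V → W} {φ' : V →L[ℝ] W} {u : V}
    (h : HasFDerivAt φ φ' u) (a : V) :
    Tendsto (fun s : ℝ => s⁻¹ • (φ (u + s • a) - φ u)) (𝓝[>] 0) (𝓝 (φ' a)) := by
  have h2 : HasFDerivAt φ φ' (u + (0 : ℝ) • a) := by simpa using h
  have h3 := (h2.comp_hasDerivAt (0 : ℝ) (hasDerivAt_line u a 0)).tendsto_slope_zero_right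
  simpa using h3

variable {n : ℕ} {M : Type*} [TopologicalSpace M]

/-- Every point of the hypersurface lies in a ball that touches each tangent hyperplane from
inside. -/
def IsStronglyConvex (X ν : M → Euc (n + 1)) (δ : ℝ) : Prop :=
  ∀ x y, ⟪X y - X x, ν x⟫ ≤ -δ * ‖X y - X x‖ ^ 2

variable [ChartedSpace (EuclideanSpace ℝ (Fin n)) M] [IsManifold (𝓡 n) ∞ M]

/-- For definiteness, apply the inequality along `u₀ + s • a`, divide by `s ^ 2` and let `s → 0`.
The first order term is killed by the normal, the left side tends to half the second derivative
paired with `ν x`, and the right side to `-δ * ‖chartD X x a‖ ^ 2`, which is negative because `X` is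
an immersion. -/
theorem IsStronglyConvex.isStrictlyConvex {X ν : M → Euc (n + 1)} {δ : ℝ} (hδ : 0 < δ)
    (h : IsStronglyConvex X ν δ) (hX : Manifold.IsSmoothEmbedding (𝓡 n) (𝓡 (n + 1)) ∞ X)
    (hν : IsUnitNormal X ν) : IsStrictlyConvex X ν where
  supporting x y := (h x y).trans (by nlinarith [sq_nonneg ‖X y - X x‖])
  posDef x := by
    rw [posDef_sff_iff hX.contMDiff]
    intro a ha
    set u₀ := extChartAt (𝓡 n) x x with hu₀
    have hC2 : ContDiffAt ℝ 2 (coordMap X x) u₀ :=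
      (contDiffAt_coordMap hX.contMDiff x).of_le ENat.LEInfty.out
    have hT := tendsto_taylor_two hC2 a
    have hdx : coordMap X x u₀ = X x := congrArg X (extChartAt_to_inv x)
    have hT1 : Tendsto (fun s : ℝ => s⁻¹ • (coordMap X x (u₀ + s • a) - coordMap X x u₀)) (𝓝[>] 0)
        (𝓝 (chartD X x a)) :=
      tendsto_slope_line (hC2.differentiableAt (by simp)).hasFDerivAt a
    have hL := (hT.inner (𝕜 := ℝ) (tendsto_const_nhds (x := ν x)))
    have hR := ((hT1.norm).pow 2).const_mul (-δ)
    have hle := le_of_tendsto_of_tendsto hL hR (by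
      filter_upwards [self_mem_nhdsWithin] with s hs
      have hs0 : (0 : ℝ) < s := hs
      have h3 := h x ((extChartAt (𝓡 n) x).symm (u₀ + s • a))
      rw [real_inner_smul_left, inner_sub_left, real_inner_smul_left,
        inner_fderiv_coordMap_self hν x a, mul_zero, sub_zero, norm_smul, mul_pow, norm_inv,
        Real.norm_eq_abs, abs_of_pos hs0, hdx, inv_pow]
      have h4 : (0 : ℝ) < (s ^ 2)⁻¹ := by positivity
      have h5 := mul_le_mul_of_nonneg_left h3 h4.le
      simp only [coordMap, Function.comp_apply]
      linarith)
    rw [real_inner_smul_left] at hle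
    have hpos : 0 < ‖chartD X x a‖ ^ 2 := by
      refine pow_pos (norm_pos_iff.mpr fun h0 => ha ?_) 2
      exact fderiv_coordMap_injective hX x (h0.trans (map_zero _).symm)
    change 1 / 2 * ⟪chartD2 X x a a, ν x⟫ ≤ _ at hle
    nlinarith

/-- If the normal direction at a strict local contact point moves a little, the contact point moves
a little. -/
theorem exists_normal_eq_near [T2Space M] [CompactSpace M] {X ν : M → Euc (n + 1)}
    (hX : Manifold.IsSmoothEmbedding (𝓡 n) (𝓡 (n + 1)) ∞ X) (hν : IsUnitNormal X ν)
    (hνc : Continuous ν) {x₀ : M}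
    (hx₀ : ∀ᶠ y in 𝓝 x₀, y ≠ x₀ → ⟪X y - X x₀, ν x₀⟫ < 0) {N : Set M} (hN : N ∈ 𝓝 x₀) :
    ∀ᶠ ζ in 𝓝 (ν x₀), ‖ζ‖ = 1 → ∃ x ∈ N, ν x = ζ := by
  have hXc : Continuous X := hX.contMDiff.continuous
  have hpos : ∀ᶠ y in 𝓝 x₀, 0 < ⟪ν y, ν x₀⟫ := by
    have hc : ContinuousAt (fun y => ⟪ν y, ν x₀⟫) x₀ :=
      (hνc.inner continuous_const).continuousAt
    refine hc.eventually_const_lt ?_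
    simp only [real_inner_self_eq_norm_sq, (hν x₀).1]; norm_num
  -- On a compact neighbourhood `K` the point `x₀` is the strict maximum in direction `ν x₀`, and
  -- all normals lie in its open hemisphere. The strict gap on `K \ interior K` survives a small
  -- change of direction to `ζ`, so the maximum of `⟪ζ, X ·⟫` over `K` is attained in the interior.
  -- There the normal is `ζ` or `-ζ`, and the hemisphere condition excludes the latter.
  obtain ⟨K, hKx, hKsub, hK⟩ := local_compact_nhds (Filter.inter_mem (Filter.inter_mem hx₀ hpos) hN)
  set F := K \ interior K with hF
  have hFc : IsCompact F := hK.diff isOpen_interior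
  have hgap : ∀ᶠ ζ in 𝓝 (ν x₀), ∀ y ∈ F, ⟪ζ, X y - X x₀⟫ < 0 := by
    refine hFc.eventually_forall_of_forall_eventually fun y hy => ?_
    have hne : y ≠ x₀ := by
      rintro rfl
      exact hy.2 (mem_interior_iff_mem_nhds.mpr hKx)
    have hc : ContinuousAt (fun q : Euc (n + 1) × M => ⟪q.1, X q.2 - X x₀⟫) (ν x₀, y) := by
      fun_prop
    refine hc.eventually_lt_const ?_
    have := (hKsub hy.1).1.1 hne
    rwa [real_inner_comm] at this
  have hζpos : ∀ᶠ ζ in 𝓝 (ν x₀), 0 < ⟪ζ, ν x₀⟫ := by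
    have hc : ContinuousAt (fun ζ => ⟪ζ, ν x₀⟫) (ν x₀) := by fun_prop
    refine hc.eventually_const_lt ?_
    simp only [real_inner_self_eq_norm_sq, (hν x₀).1]; norm_num
  filter_upwards [hgap, hζpos] with ζ h1 h2 hζ
  obtain ⟨x, hxK, hmax⟩ := hK.exists_isMaxOn ⟨x₀, mem_of_mem_nhds hKx⟩
    (f := fun y => ⟪ζ, X y⟫) (by fun_prop)
  have hxi : x ∈ interior K := by
    by_contra hxi
    have h3 := h1 x ⟨hxK, hxi⟩
    have h4 : ⟪ζ, X x₀⟫ ≤ ⟪ζ, X x⟫ := hmax (mem_of_mem_nhds hKx)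
    rw [inner_sub_right] at h3
    linarith
  refine ⟨x, (hKsub hxK).2, ?_⟩
  have hloc : IsLocalMax (fun y => ⟪ζ, X y⟫) x :=
    (hmax.isLocalMax (mem_interior_iff_mem_nhds.mp hxi))
  rcases eq_or_eq_neg_of_isLocalMax hX hν hζ hloc with h | h
  · exact h
  · have h3 : 0 < ⟪ν x, ν x₀⟫ := (hKsub hxK).1.2
    rw [h, inner_neg_left] at h3
    linarith

/-- A point on the inner side of all tangent hyperplanes, and lying on the tangent hyperplane at
`x₀`, is the contact point. -/
theorem eq_of_supporting [T2Space M] [CompactSpace M] {X ν : M → Euc (n + 1)}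
    (hX : Manifold.IsSmoothEmbedding (𝓡 n) (𝓡 (n + 1)) ∞ X) (hν : IsUnitNormal X ν)
    (hνc : Continuous ν) (hsupp : ∀ x y, ⟪X y - X x, ν x⟫ ≤ 0) {x₀ : M}
    (hx₀ : ∀ᶠ y in 𝓝 x₀, y ≠ x₀ → ⟪X y - X x₀, ν x₀⟫ < 0) {p : Euc (n + 1)}
    (hp : ∀ x, ⟪p - X x, ν x⟫ ≤ 0) (hp₀ : ⟪p - X x₀, ν x₀⟫ = 0) : p = X x₀ := by
  by_contra hne
  set e := p - X x₀ with he
  have he0 : 0 < ‖e‖ := norm_pos_iff.mpr (sub_ne_zero.mpr hne)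
  have hXc : Continuous X := hX.contMDiff.continuous
  have hN : {x | ‖X x₀ - X x‖ < ‖e‖} ∈ 𝓝 x₀ := by
    have hc : ContinuousAt (fun x => ‖X x₀ - X x‖) x₀ := by fun_prop
    exact hc.eventually_lt_const (by simpa using he0)
  have hev := exists_normal_eq_near hX hν hνc hx₀ hN
  -- Tilt the normal towards `e = p - X x₀`. The contact point `x` for the tilted direction is so
  -- close to `x₀` that `⟪p - X x, e⟫ > 0`, while `⟪p - X x, ν x₀⟫ ≥ 0` by support at `x₀`. So `p`
  -- lies strictly outside the tangent hyperplane at `x`, a contradiction.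
  have hlim : Tendsto (fun ε : ℝ => ‖ν x₀ + ε • e‖⁻¹ • (ν x₀ + ε • e)) (𝓝[>] 0) (𝓝 (ν x₀)) := by
    have hc : ContinuousAt (fun ε : ℝ => ‖ν x₀ + ε • e‖⁻¹ • (ν x₀ + ε • e)) 0 := by
      have hc1 : ContinuousAt (fun ε : ℝ => ν x₀ + ε • e) 0 := by fun_prop
      refine ContinuousAt.smul (ContinuousAt.inv₀ hc1.norm ?_) hc1
      simp [(hν x₀).1]
    have := hc.tendsto
    simp only [zero_smul, add_zero, (hν x₀).1, inv_one, one_smul] at this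
    exact this.mono_left nhdsWithin_le_nhds
  have hnz : ∀ᶠ ε : ℝ in 𝓝[>] 0, ν x₀ + ε • e ≠ 0 := by
    have hc : ContinuousAt (fun ε : ℝ => ν x₀ + ε • e) 0 := by fun_prop
    refine (hc.eventually_ne ?_).filter_mono nhdsWithin_le_nhds
    have : ν x₀ ≠ 0 := by
      intro h0
      have := (hν x₀).1
      rw [h0, norm_zero] at this
      exact zero_ne_one this
    simpa using this
  obtain ⟨ε, ⟨hε, hεnz⟩, hε0⟩ := ((hlim.eventually hev).and hnz |>.and self_mem_nhdsWithin).exists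
  have hε0' : (0 : ℝ) < ε := hε0
  obtain ⟨x, hxN, hνx⟩ := hε (by
    rw [norm_smul, norm_inv, norm_norm, inv_mul_cancel₀ (norm_ne_zero_iff.mpr hεnz)])
  have h1 := hp x
  rw [hνx, real_inner_smul_right] at h1
  have h2 : ⟪p - X x, ν x₀ + ε • e⟫ ≤ 0 := by
    by_contra h
    push Not at h
    have : 0 < ‖ν x₀ + ε • e‖⁻¹ := inv_pos.mpr (norm_pos_iff.mpr hεnz)
    nlinarith [mul_pos this h]
  have h3 := hsupp x₀ x
  have h4 : p - X x = e + (X x₀ - X x) := by rw [he]; abel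
  have h5 : ⟪p - X x, ν x₀⟫ = -⟪X x - X x₀, ν x₀⟫ := by
    rw [h4, inner_add_left, hp₀, zero_add, ← inner_neg_left, neg_sub]
  have h6 : -(‖X x₀ - X x‖ * ‖e‖) ≤ ⟪X x₀ - X x, e⟫ := by
    have := abs_real_inner_le_norm (X x₀ - X x) e
    exact (abs_le.mp this).1
  have h7 : ‖X x₀ - X x‖ * ‖e‖ < ‖e‖ * ‖e‖ := by
    have : ‖X x₀ - X x‖ < ‖e‖ := hxN
    exact mul_lt_mul_of_pos_right this he0
  have h8 : 0 < ⟪p - X x, e⟫ := by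
    rw [h4, inner_add_left, real_inner_self_eq_norm_mul_norm]
    linarith
  rw [inner_add_right, real_inner_smul_right, h5] at h2
  nlinarith [mul_pos hε0' h8]

variable {α T : ℝ} {X ν : ℝ → M → Euc (n + 1)}

/-- Taylor's formula on the segment between two nearby points of one chart. The first order term
vanishes because `ν` is normal in every chart, and the second order term is uniformly negative for
times and points near `(t, x₀)` by continuity of the second space derivative and of `ν`. A Lipschitz
bound then replaces chart distance by distance in space. -/
theorem IsGaussCurvatureFlow.locally_stronglyConvex (hX : IsGaussCurvatureFlow α T X ν) {t : ℝ}
    (ht : t ∈ Ico 0 T) (x₀ : M) (hpd : (secondFundamentalForm (X t) (ν t) x₀).PosDef) :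
    ∃ δ > 0, ∀ᶠ p : ℝ × (M × M) in 𝓝[Ico 0 T] t ×ˢ (𝓝 x₀ ×ˢ 𝓝 x₀),
      ⟪X p.1 p.2.2 - X p.1 p.2.1, ν p.1 p.2.1⟫ ≤ -δ * ‖X p.1 p.2.2 - X p.1 p.2.1‖ ^ 2 := by
  set U := (extChartAt (𝓡 n) x₀).target with hU
  have hUo : IsOpen U := isOpen_extChartAt_target x₀
  set I := Ico (0 : ℝ) T with hI
  set u₀ := extChartAt (𝓡 n) x₀ x₀ with hu₀
  have hu₀U : u₀ ∈ U := mem_extChartAt_target x₀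
  set φ := chartFlow X x₀ with hφ
  have hφs : ContDiffOn ℝ ∞ φ (I ×ˢ U) := contDiffOn_chartFlow hX.smooth x₀
  have hIu : UniqueDiffOn ℝ I := uniqueDiffOn_Ico 0 T
  set D1 : ℝ × Euc n → Euc n →L[ℝ] Euc (n + 1) := fun q => fderiv ℝ (fun v => φ (q.1, v)) q.2
    with hD1
  have hD1s : ContDiffOn ℝ ∞ D1 (I ×ˢ U) := contDiffOn_fderiv_slice hIu hUo hφs
  set D2 : ℝ × Euc n → Euc n →L[ℝ] Euc n →L[ℝ] Euc (n + 1) :=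
    fun q => fderiv ℝ (fun v => D1 (q.1, v)) q.2 with hD2
  have hD2s : ContDiffOn ℝ ∞ D2 (I ×ˢ U) := contDiffOn_fderiv_slice hIu hUo hD1s
  have hφd : ∀ s ∈ I, ∀ v ∈ U, HasFDerivAt (fun v => φ (s, v)) (D1 (s, v)) v := fun s hs v hv =>
    (hasFDerivAt_slice hUo hφs (q := (s, v)) ⟨hs, hv⟩).differentiableAt.hasFDerivAt
  have hD1d : ∀ s ∈ I, ∀ v ∈ U, HasFDerivAt (fun v => D1 (s, v)) (D2 (s, v)) v := fun s hs v hv =>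
    (hasFDerivAt_slice hUo hD1s (q := (s, v)) ⟨hs, hv⟩).differentiableAt.hasFDerivAt
  have hpd' := (posDef_sff_iff (hX.embedding t ht).contMDiff x₀).mp hpd
  obtain ⟨c, hc, hcle⟩ := exists_le_neg_sq_of_neg (D2 (t, u₀)) (ν t x₀) hpd'
  have hnear : 𝓝[I ×ˢ U] (t, u₀) = 𝓝[I] t ×ˢ 𝓝 u₀ := by
    rw [nhdsWithin_prod_eq, hUo.nhdsWithin_eq hu₀U]
  have hev1 : ∀ᶠ q in 𝓝[I] t ×ˢ 𝓝 u₀,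
      ‖D2 q - D2 (t, u₀)‖ < c / 4 ∧ ‖D1 q‖ < ‖D1 (t, u₀)‖ + 1 := by
    rw [← hnear]
    have c2 : ContinuousWithinAt D2 (I ×ˢ U) (t, u₀) := hD2s.continuousOn _ ⟨ht, hu₀U⟩
    have c1 : ContinuousWithinAt D1 (I ×ˢ U) (t, u₀) := hD1s.continuousOn _ ⟨ht, hu₀U⟩
    filter_upwards [eventually_norm_sub_lt c1 one_pos,
      eventually_norm_sub_lt (W := Euc n →L[ℝ] Euc n →L[ℝ] Euc (n + 1)) (f := D2) c2 (show 0 < c / 4 by positivity)] with q h1 h2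
    refine ⟨h2, ?_⟩
    have := norm_sub_norm_le (D1 q) (D1 (t, u₀))
    linarith
  obtain ⟨pa, hpa, pb, hpb, hpab⟩ := eventually_prod_iff.mp hev1
  obtain ⟨r, hr, hball⟩ := Metric.eventually_nhds_iff_ball.mp (hpb.and (hUo.mem_nhds hu₀U))
  have hev2 : ∀ᶠ q : ℝ × M in 𝓝[I] t ×ˢ 𝓝 x₀,
      ‖ν q.1 q.2 - ν t x₀‖ < c / (4 * (‖D2 (t, u₀)‖ + 1)) := by
    have hnear' : 𝓝[I ×ˢ univ] (t, x₀) = 𝓝[I] t ×ˢ 𝓝 x₀ := by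
      rw [nhdsWithin_prod_eq, nhdsWithin_univ]
    rw [← hnear']
    have c3 : ContinuousWithinAt (Function.uncurry ν) (I ×ˢ univ) (t, x₀) :=
      hX.normal_continuous _ ⟨ht, mem_univ _⟩
    exact eventually_norm_sub_lt c3
      (show 0 < c / (4 * (‖D2 (t, u₀)‖ + 1)) by positivity)
  have hsrc : ∀ᶠ x in 𝓝 x₀, x ∈ (extChartAt (𝓡 n) x₀).source ∧
      extChartAt (𝓡 n) x₀ x ∈ Metric.ball u₀ r :=
    Filter.Eventually.and (extChartAt_source_mem_nhds (I := 𝓡 n) x₀)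
      ((continuousAt_extChartAt (I := 𝓡 n) x₀).eventually (Metric.ball_mem_nhds _ hr))
  set L := ‖D1 (t, u₀)‖ + 1 with hL
  have hLpos : 0 < L := by positivity
  -- Taylor gives `-(c / 4) * ‖v - u‖ ^ 2`, and `L` is a Lipschitz constant of the chart map.
  refine ⟨c / (4 * L ^ 2), by positivity, ?_⟩
  have hI' : ∀ᶠ s in 𝓝[I] t, s ∈ I ∧ pa s := (eventually_mem_nhdsWithin).and hpa
  have hfin : ∀ᶠ p : ℝ × (M × M) in 𝓝[I] t ×ˢ (𝓝 x₀ ×ˢ 𝓝 x₀),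
      (p.1 ∈ I ∧ pa p.1) ∧ (p.2.1 ∈ (extChartAt (𝓡 n) x₀).source ∧
      extChartAt (𝓡 n) x₀ p.2.1 ∈ Metric.ball u₀ r) ∧ (p.2.2 ∈ (extChartAt (𝓡 n) x₀).source ∧
      extChartAt (𝓡 n) x₀ p.2.2 ∈ Metric.ball u₀ r) ∧
      ‖ν p.1 p.2.1 - ν t x₀‖ < c / (4 * (‖D2 (t, u₀)‖ + 1)) := by
    have t1 : Tendsto (fun p : ℝ × (M × M) => p.1) (𝓝[I] t ×ˢ (𝓝 x₀ ×ˢ 𝓝 x₀)) (𝓝[I] t) :=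
      tendsto_fst
    have t2 : Tendsto (fun p : ℝ × (M × M) => p.2.1) (𝓝[I] t ×ˢ (𝓝 x₀ ×ˢ 𝓝 x₀)) (𝓝 x₀) :=
      tendsto_fst.comp tendsto_snd
    have t3 : Tendsto (fun p : ℝ × (M × M) => p.2.2) (𝓝[I] t ×ˢ (𝓝 x₀ ×ˢ 𝓝 x₀)) (𝓝 x₀) :=
      tendsto_snd.comp tendsto_snd
    filter_upwards [t1.eventually hI', t2.eventually hsrc, t3.eventually hsrc,
      (t1.prodMk t2).eventually hev2] with p h1 h2 h3 h4
    exact ⟨h1, h2, h3, h4⟩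
  filter_upwards [hfin]
  rintro ⟨s, x, y⟩ ⟨⟨hs, hps⟩, ⟨hxs, hxb⟩, ⟨hys, hyb⟩, hνn⟩
  simp only at hs hps hxs hxb hys hyb hνn ⊢
  set u := extChartAt (𝓡 n) x₀ x with hu
  set v := extChartAt (𝓡 n) x₀ y with hv
  have hXx : X s x = φ (s, u) := by
    simp only [hφ, chartFlow, coordMap, Function.comp_apply, hu]
    rw [(extChartAt (𝓡 n) x₀).left_inv hxs]
  have hXy : X s y = φ (s, v) := by
    simp only [hφ, chartFlow, coordMap, Function.comp_apply, hv]
    rw [(extChartAt (𝓡 n) x₀).left_inv hys]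
  have hseg : ∀ τ ∈ Icc (0 : ℝ) 1, u + τ • (v - u) ∈ Metric.ball u₀ r := fun τ hτ =>
    (convex_ball u₀ r).add_smul_sub_mem hxb hyb hτ
  have hνs : ‖ν s x‖ = 1 := ((hX.normal s hs) x).1
  have hg : ∀ τ ∈ Icc (0 : ℝ) 1, HasDerivAt
      (fun τ : ℝ => ⟪φ (s, u + τ • (v - u)) - φ (s, u), ν s x⟫)
      ⟪D1 (s, u + τ • (v - u)) (v - u), ν s x⟫ τ := fun τ hτ => by
    have h1 := (hφd s hs _ (hball _ (hseg τ hτ)).2).comp_hasDerivAt τ (hasDerivAt_line u (v - u) τ)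
    have h2 := (h1.sub_const (φ (s, u))).inner ℝ (hasDerivAt_const τ (ν s x))
    simpa using h2
  have hg' : ∀ τ ∈ Icc (0 : ℝ) 1, HasDerivAt
      (fun τ : ℝ => ⟪D1 (s, u + τ • (v - u)) (v - u), ν s x⟫)
      ⟪D2 (s, u + τ • (v - u)) (v - u) (v - u), ν s x⟫ τ := fun τ hτ => by
    have h1 := (hD1d s hs _ (hball _ (hseg τ hτ)).2).comp_hasDerivAt τ (hasDerivAt_line u (v - u) τ)
    have h2 := (h1.clm_apply (hasDerivAt_const τ (v - u))).inner ℝ (hasDerivAt_const τ (ν s x))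
    simpa using h2
  have hg'' : ∀ τ ∈ Icc (0 : ℝ) 1, ⟪D2 (s, u + τ • (v - u)) (v - u) (v - u), ν s x⟫ ≤
      -(c / 2 * ‖v - u‖ ^ 2) := fun τ hτ => by
    have hb := (hpab hps (hball _ (hseg τ hτ)).1).1
    set q := (s, u + τ • (v - u))
    set a := v - u
    -- The three terms are at most `-c`, `c / 4` and `c / 4` times `‖a‖ ^ 2`: the form at `(t, u₀)`,
    -- the change of the second derivative, and the change of the normal.
    have e1 : ⟪D2 q a a, ν s x⟫ = ⟪D2 (t, u₀) a a, ν t x₀⟫ + ⟪(D2 q - D2 (t, u₀)) a a, ν s x⟫ +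
        ⟪D2 (t, u₀) a a, ν s x - ν t x₀⟫ := by
      simp only [_root_.sub_apply, inner_sub_left, inner_sub_right]; ring
    have e2 : ⟪(D2 q - D2 (t, u₀)) a a, ν s x⟫ ≤ c / 4 * ‖a‖ ^ 2 := by
      refine (real_inner_le_norm _ _).trans ?_
      rw [hνs, mul_one]
      refine ((D2 q - D2 (t, u₀)).le_opNorm₂ a a).trans ?_
      rw [mul_assoc, ← pow_two]
      gcongr
    have e3 : ⟪D2 (t, u₀) a a, ν s x - ν t x₀⟫ ≤ c / 4 * ‖a‖ ^ 2 := by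
      refine (real_inner_le_norm _ _).trans ?_
      have h1 := (D2 (t, u₀)).le_opNorm₂ a a
      have h2 : ‖D2 (t, u₀) a a‖ ≤ (‖D2 (t, u₀)‖ + 1) * ‖a‖ ^ 2 := by
        nlinarith [sq_nonneg ‖a‖]
      calc ‖D2 (t, u₀) a a‖ * ‖ν s x - ν t x₀‖
          ≤ ((‖D2 (t, u₀)‖ + 1) * ‖a‖ ^ 2) * (c / (4 * (‖D2 (t, u₀)‖ + 1))) := by gcongr
        _ = c / 4 * ‖a‖ ^ 2 := by field_simp
    have e4 := hcle a
    rw [e1]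
    linarith
  have hcalc := le_neg_half_of_second_deriv_le hg hg' (by simp) (by
    have h1 := inner_fderiv_coordMap (hX.embedding s hs).contMDiff (hX.normal s hs) x₀
      (hball _ hxb).2 (v - u)
    rw [hu, (extChartAt (𝓡 n) x₀).left_inv hxs] at h1
    simp only [zero_smul, add_zero]
    exact h1) hg''
  simp only [one_smul, add_sub_cancel] at hcalc
  have hlip : ‖φ (s, v) - φ (s, u)‖ ≤ L * ‖v - u‖ :=
    (convex_ball u₀ r).norm_image_sub_le_of_norm_hasFDerivWithin_le
      (f := fun w => φ (s, w)) (f' := fun w => D1 (s, w))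
      (fun w hw => (hφd s hs w (hball w hw).2).hasFDerivWithinAt)
      (fun w hw => (hpab hps (hball w hw).1).2.le) hxb hyb
  rw [hXx, hXy]
  refine hcalc.trans ?_
  have h1 : ‖φ (s, v) - φ (s, u)‖ ^ 2 ≤ L ^ 2 * ‖v - u‖ ^ 2 := by
    rw [← mul_pow]; gcongr
  have h2 : c / (4 * L ^ 2) * ‖φ (s, v) - φ (s, u)‖ ^ 2 ≤ c / (4 * L ^ 2) * (L ^ 2 * ‖v - u‖ ^ 2) := by
    gcongr
  have h3 : c / (4 * L ^ 2) * (L ^ 2 * ‖v - u‖ ^ 2) = c / 2 * ‖v - u‖ ^ 2 / 2 := by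
    field_simp; ring
  linarith

end StrongConvexity

/-! ### Contact points and the evolution of the support function -/

section Contact

attribute [local instance 2000] chartedSpaceSelf

/-- A unique maximiser depends continuously on parameters. -/
theorem continuousWithinAt_maximizer {P M : Type*} [TopologicalSpace P] [TopologicalSpace M]
    [CompactSpace M] {s : Set P} {F : P × M → ℝ} (hF : ContinuousOn F (s ×ˢ univ)) {p₀ : P}
    (hp₀ : p₀ ∈ s) {m : P → M} (hm : ∀ p ∈ s, ∀ y, F (p, y) ≤ F (p, m p))
    (huniq : ∀ x, (∀ y, F (p₀, y) ≤ F (p₀, x)) → x = m p₀) : ContinuousWithinAt m s p₀ := by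
  -- In a compact space a filter with only one possible cluster point converges to it. A cluster
  -- point `x` of `m` maximises `F (p₀, ·)`: if some `y` did strictly better, it would still do so
  -- for `p` near `p₀` and `m p` near `x`.
  refine isCompact_univ.le_nhds_of_unique_clusterPt (by simp) fun x _ hx => huniq x fun y => ?_
  by_contra hlt
  push Not at hlt
  have hc1 : ContinuousWithinAt F (s ×ˢ univ) (p₀, x) := hF _ ⟨hp₀, mem_univ _⟩
  have hc2 : ContinuousWithinAt (fun q : P × M => F (q.1, y)) (s ×ˢ univ) (p₀, x) := by
    have h : ContinuousWithinAt F (s ×ˢ univ) ((fun q : P × M => (q.1, y)) (p₀, x)) :=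
      hF _ ⟨hp₀, mem_univ _⟩
    exact h.comp (f := fun q : P × M => (q.1, y)) (by fun_prop) (fun q hq => ⟨hq.1, mem_univ _⟩)
  have hev : ∀ᶠ q in 𝓝[s ×ˢ univ] (p₀, x), F q < F (q.1, y) :=
    Filter.Tendsto.eventually_lt hc1 hc2 hlt
  rw [nhdsWithin_prod_eq, nhdsWithin_univ] at hev
  obtain ⟨pa, hpa, pb, hpb, hab⟩ := eventually_prod_iff.mp hev
  have hfr : ∃ᶠ p in 𝓝[s] p₀, pb (m p) := by
    have hcl : MapClusterPt x (𝓝[s] p₀) m := hx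
    exact hcl.frequently hpb
  obtain ⟨p, hp, hpa', hps⟩ := (hfr.and_eventually (hpa.and eventually_mem_nhdsWithin)).exists
  exact absurd (hab hpa' hp) (not_lt.mpr (hm p hps y))

variable {n : ℕ} {M : Type*} [TopologicalSpace M] [CompactSpace M]

theorem supportFunction_eq {X : M → Euc (n + 1)} {ζ : Euc (n + 1)} {x : M}
    (h : ∀ y, ⟪ζ, X y⟫ ≤ ⟪ζ, X x⟫) : supportFunction X ζ = ⟪ζ, X x⟫ :=
  haveI : Nonempty M := ⟨x⟩
  IsLUB.ciSup_eq (f := fun x => ⟪ζ, X x⟫) ⟨by rintro _ ⟨y, rfl⟩; exact h y, fun _ hb => hb ⟨x, rfl⟩⟩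

/-- A point of the hypersurface where `⟨ζ, ·⟩` is maximal. -/
def contact [Nonempty M] (X : M → Euc (n + 1)) (ζ : Euc (n + 1)) : M :=
  Classical.epsilon fun x => ∀ y, ⟪ζ, X y⟫ ≤ ⟪ζ, X x⟫

theorem inner_le_contact [Nonempty M] {X : M → Euc (n + 1)} (hX : Continuous X)
    (ζ : Euc (n + 1)) (y : M) : ⟪ζ, X y⟫ ≤ ⟪ζ, X (contact X ζ)⟫ := by
  have h : ∃ x, ∀ y, ⟪ζ, X y⟫ ≤ ⟪ζ, X x⟫ := by
    obtain ⟨x, -, hx⟩ := isCompact_univ.exists_isMaxOn univ_nonempty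
      (f := fun y => ⟪ζ, X y⟫) (by fun_prop)
    exact ⟨x, fun y => hx (mem_univ y)⟩
  exact Classical.epsilon_spec h y

theorem supportFunction_eq_contact [Nonempty M] {X : M → Euc (n + 1)} (hX : Continuous X)
    (ζ : Euc (n + 1)) : supportFunction X ζ = ⟪ζ, X (contact X ζ)⟫ :=
  supportFunction_eq (inner_le_contact hX ζ)

theorem inner_le_supportFunction [Nonempty M] {X : M → Euc (n + 1)} (hX : Continuous X)
    (ζ : Euc (n + 1)) (y : M) : ⟪ζ, X y⟫ ≤ supportFunction X ζ := by
  rw [supportFunction_eq_contact hX]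
  exact inner_le_contact hX ζ y

variable [ChartedSpace (EuclideanSpace ℝ (Fin n)) M] [IsManifold (𝓡 n) ∞ M]

/-- The normal at a maximum of `⟪ζ, ·⟫` is `ζ` or `-ζ`. In the second case strong convexity at that
point, combined with maximality, forces `X` to be constant, which an immersion of positive dimension
is not. -/
theorem normal_contact [Nonempty M] (hn : 1 ≤ n) {X ν : M → Euc (n + 1)} {δ : ℝ} (hδ : 0 < δ)
    (h : IsStronglyConvex X ν δ) (hX : Manifold.IsSmoothEmbedding (𝓡 n) (𝓡 (n + 1)) ∞ X)
    (hν : IsUnitNormal X ν) {ζ : Euc (n + 1)} (hζ : ‖ζ‖ = 1) : ν (contact X ζ) = ζ := by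
  set x := contact X ζ with hx
  have hmax := inner_le_contact hX.contMDiff.continuous ζ
  have hloc : IsLocalMax (fun y => ⟪ζ, X y⟫) x := Filter.Eventually.of_forall hmax
  rcases eq_or_eq_neg_of_isLocalMax hX hν hζ hloc with h1 | h1
  · exact h1
  · exfalso
    have hconst : ∀ y, X y = X x := fun y => by
      have h2 := h x y
      have h3 := hmax y
      rw [h1, inner_neg_right, inner_sub_left, real_inner_comm, real_inner_comm ζ (X x)] at h2
      have h4 : ‖X y - X x‖ ^ 2 ≤ 0 := by
        by_contra hpos
        push Not at hpos
        nlinarith [mul_pos hδ hpos]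
      have h5 : ‖X y - X x‖ = 0 := by
        have := sq_nonneg ‖X y - X x‖
        exact pow_eq_zero_iff (two_ne_zero) |>.mp (le_antisymm h4 this)
      exact sub_eq_zero.mp (norm_eq_zero.mp h5)
    have hc : coordMap X x = fun _ => X x := funext fun u => hconst _
    have hinj := fderiv_coordMap_injective hX x
    rw [hc] at hinj
    have h6 : (EuclideanSpace.single (⟨0, hn⟩ : Fin n) (1 : ℝ) : Euc n) = 0 := by
      apply hinj
      simp
    have := congrArg norm h6
    simp at this

variable {α T : ℝ} {X ν : ℝ → M → Euc (n + 1)}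

theorem IsGaussCurvatureFlow.continuousOn (hX : IsGaussCurvatureFlow α T X ν) :
    ContinuousOn (Function.uncurry X) (Ico 0 T ×ˢ univ) :=
  hX.smooth.continuousOn

theorem IsGaussCurvatureFlow.continuous (hX : IsGaussCurvatureFlow α T X ν) {t : ℝ}
    (ht : t ∈ Ico 0 T) : Continuous (X t) :=
  (hX.embedding t ht).contMDiff.continuous

theorem IsGaussCurvatureFlow.continuous_normal (hX : IsGaussCurvatureFlow α T X ν) {t : ℝ}
    (ht : t ∈ Ico 0 T) : Continuous (ν t) := by
  have h : ContinuousOn (Function.uncurry ν ∘ fun x : M => (t, x)) univ :=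
    hX.normal_continuous.comp (by fun_prop) (fun x _ => ⟨ht, mem_univ _⟩)
  exact continuousOn_univ.mp h

/-- Strict convexity is an open condition along the flow, and it is locally uniform. -/
theorem IsGaussCurvatureFlow.eventually_stronglyConvex [T2Space M]
    (hX : IsGaussCurvatureFlow α T X ν) {t : ℝ} (ht : t ∈ Ico 0 T)
    (hconv : IsStrictlyConvex (X t) (ν t)) :
    ∃ δ > 0, ∀ᶠ s in 𝓝[Ico 0 T] t, IsStronglyConvex (X s) (ν s) δ := by
  have hlocal : ∀ x₀, ∀ᶠ y in 𝓝 x₀, y ≠ x₀ → ⟪X t y - X t x₀, ν t x₀⟫ < 0 := fun x₀ => by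
    obtain ⟨δ, hδ, hev⟩ := hX.locally_stronglyConvex ht x₀ (hconv.posDef x₀)
    have htend : Tendsto (fun y => (t, (x₀, y))) (𝓝 x₀) (𝓝[Ico 0 T] t ×ˢ (𝓝 x₀ ×ˢ 𝓝 x₀)) := by
      refine Tendsto.prodMk ?_ (tendsto_const_nhds.prodMk tendsto_id)
      exact tendsto_const_pure.mono_right (pure_le_nhdsWithin ht)
    filter_upwards [htend.eventually hev] with y hy hne
    have hpos : 0 < ‖X t y - X t x₀‖ ^ 2 := pow_pos (norm_pos_iff.mpr (sub_ne_zero.mpr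
      fun h => hne ((hX.embedding t ht).isEmbedding.injective h))) 2
    change ⟪X t y - X t x₀, ν t x₀⟫ ≤ -δ * ‖X t y - X t x₀‖ ^ 2 at hy
    nlinarith
  have hstrict : ∀ x y, y ≠ x → ⟪X t y - X t x, ν t x⟫ < 0 := fun x y hne => by
    refine lt_of_le_of_ne (hconv.supporting x y) fun h0 => hne ?_
    exact (hX.embedding t ht).isEmbedding.injective
      (eq_of_supporting (hX.embedding t ht) (hX.normal t ht) (hX.continuous_normal ht)
        hconv.supporting (hlocal x) (fun z => hconv.supporting z y) h0)
  -- On the diagonal the second fundamental form provides the constant. Off the diagonal the strict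
  -- inequality persists nearby, with the negative value `a` halved and the squared distance bounded
  -- by `b + 1`.
  have hpt : ∀ p₀ : M × M, ∃ δ > 0, ∀ᶠ p : ℝ × (M × M) in 𝓝[Ico 0 T] t ×ˢ 𝓝 p₀,
      ⟪X p.1 p.2.2 - X p.1 p.2.1, ν p.1 p.2.1⟫ ≤ -δ * ‖X p.1 p.2.2 - X p.1 p.2.1‖ ^ 2 := by
    rintro ⟨x, y⟩
    rw [nhds_prod_eq]
    by_cases hxy : y = x
    · subst hxy
      exact hX.locally_stronglyConvex ht y (hconv.posDef y)
    set a := ⟪X t y - X t x, ν t x⟫ with ha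
    have ha0 : a < 0 := hstrict x y hxy
    set b := ‖X t y - X t x‖ ^ 2 with hb
    have hb0 : 0 ≤ b := sq_nonneg _
    have t1 : Tendsto (fun p : ℝ × (M × M) => (p.1, p.2.1)) (𝓝[Ico 0 T] t ×ˢ (𝓝 x ×ˢ 𝓝 y))
        (𝓝[Ico 0 T ×ˢ univ] (t, x)) := by
      rw [nhdsWithin_prod_eq, nhdsWithin_univ]
      exact tendsto_fst.prodMk (tendsto_fst.comp tendsto_snd)
    have t2 : Tendsto (fun p : ℝ × (M × M) => (p.1, p.2.2)) (𝓝[Ico 0 T] t ×ˢ (𝓝 x ×ˢ 𝓝 y))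
        (𝓝[Ico 0 T ×ˢ univ] (t, y)) := by
      rw [nhdsWithin_prod_eq, nhdsWithin_univ]
      exact tendsto_fst.prodMk (tendsto_snd.comp tendsto_snd)
    have c1 := (hX.continuousOn (t, x) ⟨ht, mem_univ _⟩).tendsto.comp t1
    have c2 := (hX.continuousOn (t, y) ⟨ht, mem_univ _⟩).tendsto.comp t2
    have c3 := (hX.normal_continuous (t, x) ⟨ht, mem_univ _⟩).tendsto.comp t1
    have l1 := ((c2.sub c1).inner (𝕜 := ℝ) c3).eventually_lt_const
      (show a < a / 2 by linarith)
    have l2 := ((c2.sub c1).norm.pow 2).eventually_lt_const (show b < b + 1 by linarith)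
    refine ⟨-a / 2 / (b + 1), by apply div_pos <;> linarith, ?_⟩
    filter_upwards [l1, l2] with p h1 h2
    simp only [Function.comp_apply, Function.uncurry_apply_pair] at h1 h2
    refine h1.le.trans ?_
    have h3 : -a / 2 / (b + 1) * ‖X p.1 p.2.2 - X p.1 p.2.1‖ ^ 2 ≤ -a / 2 / (b + 1) * (b + 1) :=
      mul_le_mul_of_nonneg_left h2.le (div_nonneg (by linarith) (by linarith))
    have h4 : -a / 2 / (b + 1) * (b + 1) = -a / 2 := by field_simp
    linarith
  -- Finitely many of these neighbourhoods cover `M × M`, and the smallest of their constants serves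
  -- all pairs.
  have hcomp := isCompact_univ.induction_on (X := M × M)
    (p := fun K => ∃ δ > 0, ∀ᶠ s in 𝓝[Ico 0 T] t, ∀ p ∈ K,
      ⟪X s p.2 - X s p.1, ν s p.1⟫ ≤ -δ * ‖X s p.2 - X s p.1‖ ^ 2)
    ⟨1, one_pos, by simp⟩
    (fun K L hKL ⟨δ, hδ, h⟩ => ⟨δ, hδ, h.mono fun s hs p hp => hs p (hKL hp)⟩)
    (fun K L ⟨δ, hδ, h⟩ ⟨δ', hδ', h'⟩ => ⟨min δ δ', lt_min hδ hδ', by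
      filter_upwards [h, h'] with s hs hs' p hp
      rcases hp with hp | hp
      · exact (hs p hp).trans (by nlinarith [min_le_left δ δ', sq_nonneg ‖X s p.2 - X s p.1‖])
      · exact (hs' p hp).trans (by nlinarith [min_le_right δ δ', sq_nonneg ‖X s p.2 - X s p.1‖])⟩)
    (fun p₀ _ => by
      obtain ⟨δ, hδ, h⟩ := hpt p₀
      obtain ⟨pa, hpa, pb, hpb, hab⟩ := eventually_prod_iff.mp h
      exact ⟨{p | pb p}, mem_nhdsWithin_of_mem_nhds hpb, δ, hδ, hpa.mono fun s hs p hp => hab hs hp⟩)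
  obtain ⟨δ, hδ, h⟩ := hcomp
  exact ⟨δ, hδ, h.mono fun s hs x y => hs (x, y) (mem_univ _)⟩

theorem IsGaussCurvatureFlow.stronglyConvex [T2Space M]
    (hX : IsGaussCurvatureFlow α T X ν) {t : ℝ} (ht : t ∈ Ico 0 T)
    (hconv : IsStrictlyConvex (X t) (ν t)) : ∃ δ > 0, IsStronglyConvex (X t) (ν t) δ := by
  obtain ⟨δ, hδ, h⟩ := hX.eventually_stronglyConvex ht hconv
  exact ⟨δ, hδ, h.self_of_nhdsWithin ht⟩

/-- The normal speed `K^α` of the flow. -/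
def speed (α : ℝ) (X ν : ℝ → M → Euc (n + 1)) (t : ℝ) (x : M) : ℝ :=
  gaussCurvature (X t) (ν t) x ^ α

/-- The speed is read off the time derivative: `-K^α ν` equals a component of the derivative of the
smooth chart flow, so it is continuous, and pairing with `ν` isolates `K^α`. No sign of the
curvature is needed. -/
theorem IsGaussCurvatureFlow.continuousOn_speed (hX : IsGaussCurvatureFlow α T X ν) :
    ContinuousOn (Function.uncurry (speed α X ν)) (Ico 0 T ×ˢ univ) := by
  have hW : ContinuousOn (fun q : ℝ × M => -(speed α X ν q.1 q.2) • ν q.1 q.2)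
      (Ico 0 T ×ˢ univ) := by
    rintro ⟨t, x₀⟩ ⟨ht, -⟩
    set U := (extChartAt (𝓡 n) x₀).target with hU
    have hφs : ContDiffOn ℝ ∞ (chartFlow X x₀) (Ico 0 T ×ˢ U) := contDiffOn_chartFlow hX.smooth x₀
    have hUo : IsOpen U := isOpen_extChartAt_target x₀
    have hu : UniqueDiffOn ℝ (Ico (0 : ℝ) T ×ˢ U) :=
      (uniqueDiffOn_Ico 0 T).prod hUo.uniqueDiffOn
    have hc : ContinuousOn (fun q => fderivWithin ℝ (chartFlow X x₀) (Ico 0 T ×ˢ U) q (1, 0))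
        (Ico 0 T ×ˢ U) :=
      (hφs.continuousOn_fderivWithin hu (by simp)).clm_apply continuousOn_const
    have hS : (extChartAt (𝓡 n) x₀).source ∈ 𝓝 x₀ := extChartAt_source_mem_nhds x₀
    have hc2 : ContinuousOn (fun q : ℝ × M => fderivWithin ℝ (chartFlow X x₀) (Ico 0 T ×ˢ U)
        (q.1, extChartAt (𝓡 n) x₀ q.2) (1, 0)) (Ico 0 T ×ˢ (extChartAt (𝓡 n) x₀).source) := by
      refine hc.comp (f := fun q : ℝ × M => (q.1, extChartAt (𝓡 n) x₀ q.2)) ?_ ?_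
      · exact continuousOn_fst.prodMk
          ((continuousOn_extChartAt x₀).comp continuousOn_snd fun q hq => hq.2)
      · exact fun q hq => ⟨hq.1, (extChartAt (𝓡 n) x₀).map_source hq.2⟩
    have heq : ∀ q ∈ Ico 0 T ×ˢ (extChartAt (𝓡 n) x₀).source,
        -(speed α X ν q.1 q.2) • ν q.1 q.2 = fderivWithin ℝ (chartFlow X x₀) (Ico 0 T ×ˢ U)
        (q.1, extChartAt (𝓡 n) x₀ q.2) (1, 0) := by
      rintro ⟨s, x⟩ ⟨hs, hx⟩
      have h1 := hasDerivWithinAt_slice hφs (q := (s, extChartAt (𝓡 n) x₀ x))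
        ⟨hs, (extChartAt (𝓡 n) x₀).map_source hx⟩
      have h2 := hX.evolution s hs x
      have h3 : (fun r => chartFlow X x₀ (r, extChartAt (𝓡 n) x₀ x)) = fun r => X r x := by
        funext r
        simp only [chartFlow, coordMap, Function.comp_apply]
        rw [(extChartAt (𝓡 n) x₀).left_inv hx]
      simp only [h3] at h1
      exact (uniqueDiffOn_Ico 0 T s hs).eq_deriv _ h2 h1
    have h4 := (hc2.congr heq) (t, x₀) ⟨ht, mem_extChartAt_source x₀⟩
    refine h4.mono_of_mem_nhdsWithin ?_
    rw [nhdsWithin_prod_eq, nhdsWithin_univ]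
    exact prod_mem_prod self_mem_nhdsWithin hS
  refine (hW.inner (𝕜 := ℝ) hX.normal_continuous).neg.congr ?_
  rintro ⟨s, x⟩ ⟨hs, -⟩
  simp only [Function.uncurry_apply_pair, Pi.neg_apply]
  rw [real_inner_smul_left, real_inner_self_eq_norm_sq, (hX.normal s hs x).1]
  ring

theorem IsGaussCurvatureFlow.eq_contact [T2Space M] [Nonempty M] (hn : 1 ≤ n)
    (hX : IsGaussCurvatureFlow α T X ν) {t : ℝ} (ht : t ∈ Ico 0 T)
    (hconv : IsStrictlyConvex (X t) (ν t)) {ζ : Euc (n + 1)} (hζ : ‖ζ‖ = 1) {x : M}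
    (hx : ∀ y, ⟪ζ, X t y⟫ ≤ ⟪ζ, X t x⟫) : x = contact (X t) ζ := by
  obtain ⟨δ, hδ, h⟩ := hX.stronglyConvex ht hconv
  have h1 := normal_contact hn hδ h (hX.embedding t ht) (hX.normal t ht) hζ
  set y := contact (X t) ζ
  have h2 := h y x
  rw [h1, inner_sub_left, real_inner_comm, real_inner_comm ζ (X t y)] at h2
  have h3 := hx y
  have h4 : ‖X t x - X t y‖ ^ 2 ≤ 0 := by
    by_contra hpos
    push Not at hpos
    nlinarith [mul_pos hδ hpos]
  have h5 : ‖X t x - X t y‖ = 0 :=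
    pow_eq_zero_iff (two_ne_zero) |>.mp (le_antisymm h4 (sq_nonneg _))
  exact (hX.embedding t ht).isEmbedding.injective (sub_eq_zero.mp (norm_eq_zero.mp h5))

theorem IsGaussCurvatureFlow.continuousWithinAt_contact [T2Space M] [Nonempty M] (hn : 1 ≤ n)
    (hX : IsGaussCurvatureFlow α T X ν) {t : ℝ} (ht : t ∈ Ico 0 T)
    (hconv : IsStrictlyConvex (X t) (ν t)) {ζ : Euc (n + 1)} (hζ : ‖ζ‖ = 1) :
    ContinuousWithinAt (fun q : ℝ × Euc (n + 1) => contact (X q.1) q.2) (Ico 0 T ×ˢ univ)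
      (t, ζ) := by
  refine continuousWithinAt_maximizer (s := Ico 0 T ×ˢ univ)
    (F := fun q : (ℝ × Euc (n + 1)) × M => ⟪q.1.2, X q.1.1 q.2⟫) ?_ ⟨ht, mem_univ _⟩ ?_ ?_
  · refine ContinuousOn.inner (𝕜 := ℝ) (by fun_prop) ?_
    exact hX.continuousOn.comp (f := fun q : (ℝ × Euc (n + 1)) × M => (q.1.1, q.2)) (by fun_prop)
      (fun q hq => ⟨hq.1.1, mem_univ _⟩)
  · rintro ⟨s, ζ'⟩ ⟨hs, -⟩ y
    exact inner_le_contact (hX.continuous hs) ζ' y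
  · exact fun x hx => hX.eq_contact hn ht hconv hζ hx

/-- The support function evolves by `∂S/∂t = -K^α`. -/
theorem IsGaussCurvatureFlow.hasDerivWithinAt_supportFunction [T2Space M] [Nonempty M] (hn : 1 ≤ n)
    (hX : IsGaussCurvatureFlow α T X ν) {t : ℝ} (ht : t ∈ Ico 0 T)
    (hconv : IsStrictlyConvex (X t) (ν t)) {ζ : Euc (n + 1)} (hζ : ‖ζ‖ = 1) :
    HasDerivWithinAt (fun s => supportFunction (X s) ζ)
      (-speed α X ν t (contact (X t) ζ)) (Ico 0 T) t := by
  set I := Ico (0 : ℝ) T with hI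
  set x₀ := contact (X t) ζ with hx₀
  set D := -speed α X ν t x₀ with hD
  have hν₀ : ν t x₀ = ζ := by
    obtain ⟨δ, hδ, h⟩ := hX.stronglyConvex ht hconv
    exact normal_contact hn hδ h (hX.embedding t ht) (hX.normal t ht) hζ
  have hm : Tendsto (fun s => contact (X s) ζ) (𝓝[I] t) (𝓝 x₀) := by
    have h1 := hX.continuousWithinAt_contact hn ht hconv hζ
    exact ContinuousWithinAt.comp (g := fun q : ℝ × Euc (n + 1) => contact (X q.1) q.2)
      (f := fun s => (s, ζ)) (x := t) h1 (by fun_prop) (fun s hs => ⟨hs, mem_univ _⟩)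
  -- Subtracting `s * D` makes the time derivative of `⟪ζ, X s x⟫` small for all `(s, x)` near `(t,
  -- x₀)`. It is used at the fixed point `x₀`, which bounds the support function at time `s` from
  -- below, and at the moving contact point, whose value at time `t` is at most the support
  -- function.
  have hder : ∀ s ∈ I, ∀ x, HasDerivWithinAt (fun s => ⟪ζ, X s x⟫ - s * D)
      (-speed α X ν s x * ⟪ζ, ν s x⟫ - D) I s := fun s hs x => by
    have h1 := (hasDerivWithinAt_const s I ζ).inner ℝ (hX.evolution s hs x)
    have h2 := h1.sub ((hasDerivWithinAt_id s I).mul_const D)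
    refine h2.congr_deriv ?_
    rw [inner_zero_left, add_zero, real_inner_smul_right, one_mul, speed]
  have hcont : ContinuousOn (fun q : ℝ × M => -speed α X ν q.1 q.2 * ⟪ζ, ν q.1 q.2⟫ - D)
      (I ×ˢ univ) :=
    (hX.continuousOn_speed.neg.mul
      (continuousOn_const.inner (𝕜 := ℝ) hX.normal_continuous)).sub continuousOn_const
  rw [hasDerivWithinAt_iff_isLittleO, Asymptotics.isLittleO_iff]
  intro c hc
  have hev := eventually_norm_sub_lt (hcont (t, x₀) ⟨ht, mem_univ _⟩) hc
  have h0 : -speed α X ν t x₀ * ⟪ζ, ν t x₀⟫ - D = 0 := by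
    rw [hν₀, real_inner_self_eq_norm_sq, hζ, hD]; ring
  simp only [h0, sub_zero] at hev
  rw [nhdsWithin_prod_eq, nhdsWithin_univ] at hev
  obtain ⟨pa, hpa, pb, hpb, hab⟩ := eventually_prod_iff.mp hev
  obtain ⟨r, hr, hball⟩ := Metric.mem_nhdsWithin_iff.mp hpa
  have hMV : ∀ s ∈ Metric.ball t r ∩ I, ∀ x, pb x →
      ‖(⟪ζ, X s x⟫ - s * D) - (⟪ζ, X t x⟫ - t * D)‖ ≤ c * ‖s - t‖ := fun s hs x hx =>
    ((convex_ball t r).inter (convex_Ico 0 T)).norm_image_sub_le_of_norm_hasDerivWithin_le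
      (f := fun s => ⟪ζ, X s x⟫ - s * D)
      (fun r hr => (hder r hr.2 x).mono inter_subset_right)
      (fun r hr => (hab (hball hr) hx).le) ⟨Metric.mem_ball_self hr, ht⟩ hs
  filter_upwards [inter_mem (mem_nhdsWithin_of_mem_nhds (Metric.ball_mem_nhds t hr))
    self_mem_nhdsWithin, hm.eventually hpb] with s hs hps
  have e1 := hMV s hs x₀ hpb.self_of_nhds
  have e2 := hMV s hs _ hps
  have e3 : supportFunction (X t) ζ = ⟪ζ, X t x₀⟫ := supportFunction_eq_contact (hX.continuous ht) ζ
  have e4 := supportFunction_eq_contact (hX.continuous hs.2) ζ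
  have e5 := inner_le_contact (hX.continuous hs.2) ζ x₀
  have e6 := inner_le_contact (hX.continuous ht) ζ (contact (X s) ζ)
  rw [Real.norm_eq_abs] at e1 e2 ⊢
  rw [abs_le] at e1 e2 ⊢
  rw [smul_eq_mul, e3, e4]
  rw [← hx₀] at e6
  constructor <;> nlinarith [e1.1, e2.2]

end Contact

/-! ### Preservation of strict convexity by comparison with a time translate -/

section Preservation

attribute [local instance 2000] chartedSpaceSelf

variable {n : ℕ} {M : Type*} [TopologicalSpace M] [CompactSpace M]
  [ChartedSpace (EuclideanSpace ℝ (Fin n)) M] [IsManifold (𝓡 n) ∞ M]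

open Matrix in
/-- If a hypersurface touches a strictly convex one from inside, its Gauss curvature at the contact
point is at least as large. -/
theorem gaussCurvature_le_of_touching {X₁ ν₁ X₂ ν₂ : M → Euc (n + 1)}
    (hX₁ : Manifold.IsSmoothEmbedding (𝓡 n) (𝓡 (n + 1)) ∞ X₁) (hν₁ : IsUnitNormal X₁ ν₁)
    (hν₁c : Continuous ν₁)
    (hX₂ : Manifold.IsSmoothEmbedding (𝓡 n) (𝓡 (n + 1)) ∞ X₂) (hν₂ : IsUnitNormal X₂ ν₂)
    {x₁ x₂ : M} {v : Euc (n + 1)} (hsupp : ∀ x y, ⟪X₂ y - v - X₁ x, ν₁ x⟫ ≤ 0)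
    (htouch : X₂ x₂ - v = X₁ x₁) (hν : ν₂ x₂ = ν₁ x₁)
    (hpd : (secondFundamentalForm X₁ ν₁ x₁).PosDef) :
    gaussCurvature X₁ ν₁ x₁ ≤ gaussCurvature X₂ ν₂ x₂ := by
  -- Follow both hypersurfaces along curves with a common tangent. The support inequality is tested
  -- against the normal of `X₁` at its moving point; the zeroth and first order terms cancel, and
  -- dividing by `s ^ 2` leaves the second derivatives against the limiting normal.
  have hsecond : ∀ a b : Euc n, chartD X₁ x₁ a = chartD X₂ x₂ b →
      ⟪chartD2 X₂ x₂ b b, ν₁ x₁⟫ ≤ ⟪chartD2 X₁ x₁ a a, ν₁ x₁⟫ := by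
    intro a b hab
    set u₁ := extChartAt (𝓡 n) x₁ x₁ with hu₁
    set u₂ := extChartAt (𝓡 n) x₂ x₂ with hu₂
    have hT₁ := tendsto_taylor_two
      ((contDiffAt_coordMap hX₁.contMDiff x₁).of_le ENat.LEInfty.out) a
    have hT₂ := tendsto_taylor_two
      ((contDiffAt_coordMap hX₂.contMDiff x₂).of_le ENat.LEInfty.out) b
    have hd₁ : coordMap X₁ x₁ u₁ = X₁ x₁ := congrArg X₁ (extChartAt_to_inv x₁)
    have hd₂ : coordMap X₂ x₂ u₂ = X₂ x₂ := congrArg X₂ (extChartAt_to_inv x₂)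
    have hN : Tendsto (fun s : ℝ => ν₁ ((extChartAt (𝓡 n) x₁).symm (u₁ + s • a))) (𝓝[>] 0)
        (𝓝 (ν₁ x₁)) := by
      have h1 : Tendsto (fun s : ℝ => u₁ + s • a) (𝓝 0) (𝓝 u₁) := by
        have := (hasDerivAt_line u₁ a 0).continuousAt.tendsto
        simpa using this
      have h2 : Tendsto (extChartAt (𝓡 n) x₁).symm (𝓝 u₁) (𝓝 x₁) := by
        have := (continuousAt_extChartAt_symm (I := 𝓡 n) x₁).tendsto
        rwa [extChartAt_to_inv] at this
      exact ((hν₁c.tendsto x₁).comp (h2.comp h1)).mono_left nhdsWithin_le_nhds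
    have hlim := (hT₂.sub hT₁).inner (𝕜 := ℝ) hN
    have hle := le_of_tendsto hlim (b := 0) (by
      filter_upwards [self_mem_nhdsWithin] with s hs
      have h4 : (0 : ℝ) < (s ^ 2)⁻¹ := by
        have hs0 : (0 : ℝ) < s := hs
        positivity
      have h3 := hsupp ((extChartAt (𝓡 n) x₁).symm (u₁ + s • a))
        ((extChartAt (𝓡 n) x₂).symm (u₂ + s • b))
      have hab' : fderiv ℝ (coordMap X₁ x₁) u₁ a = fderiv ℝ (coordMap X₂ x₂) u₂ b := hab
      rw [hab', hd₁, hd₂, ← smul_sub, real_inner_smul_left]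
      refine mul_nonpos_of_nonneg_of_nonpos h4.le ?_
      have e : coordMap X₂ x₂ (u₂ + s • b) - X₂ x₂ - s • fderiv ℝ (coordMap X₂ x₂) u₂ b -
          (coordMap X₁ x₁ (u₁ + s • a) - X₁ x₁ - s • fderiv ℝ (coordMap X₂ x₂) u₂ b) =
          X₂ ((extChartAt (𝓡 n) x₂).symm (u₂ + s • b)) - v -
          X₁ ((extChartAt (𝓡 n) x₁).symm (u₁ + s • a)) := by
        rw [← htouch]
        unfold coordMap
        simp only [Function.comp_apply]
        abel
      rw [e]
      exact h3)
    rw [← smul_sub, real_inner_smul_left, inner_sub_left] at hle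
    change 1 / 2 * (⟪chartD2 X₂ x₂ b b, ν₁ x₁⟫ - ⟪chartD2 X₁ x₁ a a, ν₁ x₁⟫) ≤ 0 at hle
    linarith
  have hex : ∀ i : Fin n, ∃ b : Euc n,
      chartD X₂ x₂ b = chartD X₁ x₁ (EuclideanSpace.single i 1) := fun i =>
    mem_range_of_orthogonal (fderiv_coordMap_injective hX₂ x₂) (hν₂ x₂).1
      (inner_fderiv_coordMap_self hν₂ x₂)
      (by rw [hν]; exact inner_fderiv_coordMap_self hν₁ x₁ _)
  choose b hb using hex
  -- `P` expresses the tangent frame of the first hypersurface in that of the second. Both quadratic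
  -- forms transform by `Pᵀ · P`, so the factor `P.det ^ 2` cancels in the quotient defining the
  -- Gauss curvature.
  set P : Matrix (Fin n) (Fin n) ℝ := Matrix.of fun j i => b i j with hP
  have hPa : ∀ a : Euc n, (WithLp.toLp 2 (P *ᵥ a) : Euc n) = ∑ i, a i • b i := fun a => by
    ext j
    simp [P, mulVec, dotProduct, mul_comm]
  have hDP : ∀ a : Euc n, chartD X₁ x₁ a = chartD X₂ x₂ (WithLp.toLp 2 (P *ᵥ a)) := fun a => by
    conv_lhs => rw [euc_eq_sum a]
    rw [hPa]
    simp only [map_sum, map_smul, hb]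
  have hmet : metric X₁ x₁ = Pᵀ * metric X₂ x₂ * P := by
    ext i j
    have h1 := dotProduct_metric (X := X₁) x₁ (EuclideanSpace.single i 1) (EuclideanSpace.single j 1)
    have h2 := dotProduct_metric (X := X₂) x₂ (b i) (b j)
    rw [hb, hb, ← h1] at h2
    have h3 : (Pᵀ * metric X₂ x₂ * P) i j = (b i : Fin n → ℝ) ⬝ᵥ (metric X₂ x₂ *ᵥ (b j)) := by
      rw [dotProduct_mulVec, Matrix.mul_apply']
      rfl
    rw [h3, h2]
    simp
  have hdm : (metric X₁ x₁).det = P.det ^ 2 * (metric X₂ x₂).det := by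
    rw [hmet, det_mul, det_mul, det_transpose]; ring
  have hdet : (secondFundamentalForm X₁ ν₁ x₁).det ≤
      (Pᵀ * secondFundamentalForm X₂ ν₂ x₂ * P).det := by
    refine det_le_det_of_posDef hpd ?_ fun a => ?_
    · have := Matrix.isHermitian_conjTranspose_mul_mul P
        (sff_isHermitian (ν := ν₂) hX₂.contMDiff x₂)
      rwa [Matrix.conjTranspose_eq_transpose_of_trivial] at this
    · have h1 := dotProduct_sff (ν := ν₁) hX₁.contMDiff x₁ (WithLp.toLp 2 a) (WithLp.toLp 2 a)
      have h2 := dotProduct_sff (ν := ν₂) hX₂.contMDiff x₂ (WithLp.toLp 2 (P *ᵥ a))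
        (WithLp.toLp 2 (P *ᵥ a))
      have h3 := hsecond (WithLp.toLp 2 a) (WithLp.toLp 2 (P *ᵥ a)) (hDP _)
      simp only at h1 h2
      rw [← mulVec_mulVec, ← mulVec_mulVec, dotProduct_mulVec a Pᵀ, vecMul_transpose, h1, h2, hν]
      linarith
  rw [det_mul, det_mul, det_transpose] at hdet
  rw [gaussCurvature_eq_div, gaussCurvature_eq_div, hdm]
  have hg₁ := (posDef_metric hX₁ x₁).det_pos
  have hg₂ := (posDef_metric hX₂ x₂).det_pos
  rw [hdm] at hg₁
  rw [div_le_div_iff₀ hg₁ hg₂]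
  nlinarith

variable [T2Space M] [Nonempty M] {α T : ℝ} {X ν : ℝ → M → Euc (n + 1)}

theorem IsGaussCurvatureFlow.continuousOn_supportFunction (hn : 1 ≤ n)
    (hX : IsGaussCurvatureFlow α T X ν) {I : Set ℝ} (hI : I ⊆ Ico 0 T)
    (hconv : ∀ t ∈ I, IsStrictlyConvex (X t) (ν t)) :
    ContinuousOn (fun q : ℝ × Euc (n + 1) => supportFunction (X q.1) q.2)
      (I ×ˢ Metric.sphere 0 1) := by
  rintro ⟨t, ζ⟩ ⟨ht, hζ⟩
  have hsub : I ×ˢ Metric.sphere (0 : Euc (n + 1)) 1 ⊆ Ico 0 T ×ˢ univ :=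
    prod_mono hI (subset_univ _)
  have h1 := (hX.continuousWithinAt_contact hn (hI ht) (hconv t ht) (by simpa using hζ)).mono hsub
  have h2 : ContinuousWithinAt (fun q : ℝ × Euc (n + 1) => X q.1 (contact (X q.1) q.2))
      (I ×ˢ Metric.sphere 0 1) (t, ζ) :=
    ContinuousWithinAt.comp (g := Function.uncurry X) (t := Ico 0 T ×ˢ univ)
      (f := fun q : ℝ × Euc (n + 1) => (q.1, contact (X q.1) q.2))
      (hX.continuousOn _ ⟨hI ht, mem_univ _⟩) (continuousWithinAt_fst.prodMk h1)
      (fun q hq => ⟨hI hq.1, mem_univ _⟩)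
  refine (continuousWithinAt_snd.inner (𝕜 := ℝ) h2).congr (fun q hq => ?_) ?_
  · exact supportFunction_eq_contact (hX.continuous (hI hq.1)) _
  · exact supportFunction_eq_contact (hX.continuous (hI ht)) _

theorem supportFunction_normal {X ν : M → Euc (n + 1)} (h : IsStrictlyConvex X ν) (x : M) :
    supportFunction X (ν x) = ⟪ν x, X x⟫ :=
  supportFunction_eq fun y => by
    have := h.supporting x y
    rw [real_inner_comm, inner_sub_right] at this
    linarith

/-- At a direction where the difference of the support functions of an inner and an outer
hypersurface of the flow is maximal, the inner one moves faster. -/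
theorem IsGaussCurvatureFlow.speed_le_of_isMaxOn (hn : 1 ≤ n) (hα : 0 ≤ α)
    (hX : IsGaussCurvatureFlow α T X ν) {s t : ℝ} (hs : s ∈ Ico 0 T) (ht : t ∈ Ico 0 T)
    (hsc : IsStrictlyConvex (X s) (ν s)) (htc : IsStrictlyConvex (X t) (ν t))
    {ζ₀ : Euc (n + 1)} (hζ₀ : ‖ζ₀‖ = 1)
    (hmax : ∀ ζ, ‖ζ‖ = 1 → supportFunction (X t) ζ - supportFunction (X s) ζ ≤
      supportFunction (X t) ζ₀ - supportFunction (X s) ζ₀)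
    (hneg : supportFunction (X t) ζ₀ - supportFunction (X s) ζ₀ ≤ 0) :
    speed α X ν s (contact (X s) ζ₀) ≤ speed α X ν t (contact (X t) ζ₀) := by
  set m := supportFunction (X t) ζ₀ - supportFunction (X s) ζ₀ with hm
  obtain ⟨δs, hδs, hδs'⟩ := hX.stronglyConvex hs hsc
  obtain ⟨δt, hδt, hδt'⟩ := hX.stronglyConvex ht htc
  have hν₁ := normal_contact hn hδs hδs' (hX.embedding s hs) (hX.normal s hs) hζ₀
  have hν₂ := normal_contact hn hδt hδt' (hX.embedding t ht) (hX.normal t ht) hζ₀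
  have hS₁ := supportFunction_eq_contact (hX.continuous hs) ζ₀
  have hS₂ := supportFunction_eq_contact (hX.continuous ht) ζ₀
  set x₁ := contact (X s) ζ₀
  set x₂ := contact (X t) ζ₀
  -- Translating the inner hypersurface by `-m • ζ₀` keeps it inside: its support function in
  -- direction `ν` is at most that of the outer one plus `m - m * ⟪ζ₀, ν⟫`, which is nonpositive
  -- since `m ≤ 0` and `⟪ζ₀, ν⟫ ≤ 1`. Equality holds in direction `ζ₀`, so the two touch.
  have hsupp : ∀ x y, ⟪X t y - m • ζ₀ - X s x, ν s x⟫ ≤ 0 := fun x y => by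
    have hνx := (hX.normal s hs x).1
    have h1 := inner_le_supportFunction (hX.continuous ht) (ν s x) y
    have h2 := hmax (ν s x) hνx
    have h3 := supportFunction_normal hsc x
    have h4 : ⟪ζ₀, ν s x⟫ ≤ 1 := by
      have := real_inner_le_norm ζ₀ (ν s x)
      rwa [hζ₀, hνx, one_mul] at this
    rw [real_inner_comm, inner_sub_right, inner_sub_right, real_inner_smul_right,
      real_inner_comm ζ₀]
    nlinarith
  have hlocal : ∀ᶠ y in 𝓝 x₁, y ≠ x₁ → ⟪X s y - X s x₁, ν s x₁⟫ < 0 :=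
    Filter.Eventually.of_forall fun y hy => by
      have h1 := hδs' x₁ y
      have hpos : 0 < ‖X s y - X s x₁‖ ^ 2 := pow_pos (norm_pos_iff.mpr (sub_ne_zero.mpr
        fun h => hy ((hX.embedding s hs).isEmbedding.injective h))) 2
      nlinarith
  have htouch : X t x₂ - m • ζ₀ = X s x₁ := by
    refine eq_of_supporting (hX.embedding s hs) (hX.normal s hs) (hX.continuous_normal hs)
      hsc.supporting hlocal (fun x => hsupp x x₂) ?_
    rw [hν₁, real_inner_comm, inner_sub_right, inner_sub_right, real_inner_smul_right,
      real_inner_self_eq_norm_sq, hζ₀, ← hS₁, ← hS₂, hm]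
    ring
  have hK := gaussCurvature_le_of_touching (hX.embedding s hs) (hX.normal s hs)
    (hX.continuous_normal hs) (hX.embedding t ht) (hX.normal t ht) hsupp htouch
    (hν₂.trans hν₁.symm) (hsc.posDef x₁)
  exact Real.rpow_le_rpow (gaussCurvature_pos (hX.embedding s hs) (hsc.posDef x₁)).le hK hα

theorem tendsto_clm_apply₂ {ι V W : Type*} [NormedAddCommGroup V] [NormedSpace ℝ V]
    [NormedAddCommGroup W] [NormedSpace ℝ W] {l : Filter ι} {B : ι → V →L[ℝ] V →L[ℝ] W}
    {B₀ : V →L[ℝ] V →L[ℝ] W} (h : Tendsto B l (𝓝 B₀)) (a b : V) :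
    Tendsto (fun i => B i a b) l (𝓝 (B₀ a b)) := by
  have hc : Continuous fun L : V →L[ℝ] V →L[ℝ] W => L a b := by fun_prop
  exact (hc.tendsto B₀).comp h

theorem nonneg_of_hasDerivWithinAt_of_le {g : ℝ → ℝ} {g' t₀ : ℝ} (ht₀ : 0 < t₀)
    (hg : HasDerivWithinAt g g' (Icc 0 t₀) t₀) (hle : ∀ s ∈ Ico 0 t₀, g s ≤ g t₀) : 0 ≤ g' := by
  rw [hasDerivWithinAt_iff_tendsto_slope] at hg
  have h : Icc 0 t₀ \ {t₀} = Ico 0 t₀ := by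
    ext s
    simp only [Set.mem_sdiff, mem_Icc, mem_singleton_iff, mem_Ico]
    grind
  rw [h] at hg
  have : (𝓝[Ico 0 t₀] t₀).NeBot := by
    rw [nhdsWithin_Ico_eq_nhdsLT ht₀]; infer_instance
  refine ge_of_tendsto hg ?_
  filter_upwards [self_mem_nhdsWithin] with s hs
  rw [slope_def_field]
  exact div_nonneg_of_nonpos (by linarith [hle s hs]) (by linarith [hs.2])

/-- Comparison of the flow with its translate in time. -/
theorem IsGaussCurvatureFlow.supportFunction_sub_le (hn : 1 ≤ n) (hα : 0 ≤ α)
    (hX : IsGaussCurvatureFlow α T X ν) {b h m₀ : ℝ} (hb : b ≤ T) (hh : 0 < h)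
    (hconv : ∀ t ∈ Ico 0 b, IsStrictlyConvex (X t) (ν t)) (hm₀ : m₀ < 0)
    (h0 : ∀ ζ, ‖ζ‖ = 1 → supportFunction (X h) ζ - supportFunction (X 0) ζ ≤ m₀) {t₁ : ℝ}
    (ht₁ : 0 ≤ t₁) (ht₁b : t₁ + h < b) {ζ₁ : Euc (n + 1)} (hζ₁ : ‖ζ₁‖ = 1) :
    supportFunction (X (t₁ + h)) ζ₁ - supportFunction (X t₁) ζ₁ ≤ m₀ := by
  by_contra hcon
  push Not at hcon
  set F : ℝ × Euc (n + 1) → ℝ :=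
    fun q => supportFunction (X (q.1 + h)) q.2 - supportFunction (X q.1) q.2 with hF
  have hIb : Ico 0 b ⊆ Ico 0 T := Ico_subset_Ico_right hb
  have hSc := hX.continuousOn_supportFunction hn hIb hconv
  have hFc : ContinuousOn F (Icc 0 t₁ ×ˢ Metric.sphere 0 1) := by
    refine ContinuousOn.sub ?_ (hSc.mono (prod_mono (fun t ht => ⟨ht.1, by linarith [ht.2]⟩)
      le_rfl))
    exact hSc.comp (f := fun q : ℝ × Euc (n + 1) => (q.1 + h, q.2)) (by fun_prop)
      (fun q hq => ⟨⟨by linarith [hq.1.1], by linarith [hq.1.2]⟩, hq.2⟩)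
  -- The barrier `m₀ + ε (1 + t)` has slope `ε`, lies strictly above the initial difference, and
  -- stays negative up to `t₁`, as the touching argument needs a nonpositive difference.
  obtain ⟨ε, hε, hε1, hε2⟩ : ∃ ε > 0, m₀ + ε * (1 + t₁) < 0 ∧ m₀ + ε * (1 + t₁) < F (t₁, ζ₁) := by
    have hc : Tendsto (fun ε : ℝ => m₀ + ε * (1 + t₁)) (𝓝[>] 0) (𝓝 m₀) := by
      have : Continuous fun ε : ℝ => m₀ + ε * (1 + t₁) := by fun_prop
      have := (this.tendsto 0).mono_left (nhdsWithin_le_nhds (s := Ioi 0))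
      simpa using this
    obtain ⟨ε, ⟨h1, h2⟩, h3⟩ := (((hc.eventually_lt_const hm₀).and
      (hc.eventually_lt_const hcon)).and self_mem_nhdsWithin).exists
    exact ⟨ε, h3, h1, h2⟩
  set G : ℝ × Euc (n + 1) → ℝ := fun q => F q - (m₀ + ε * (1 + q.1)) with hG
  have hGc : ContinuousOn G (Icc 0 t₁ ×ˢ Metric.sphere 0 1) := hFc.sub (by fun_prop)
  have hKc : IsCompact ((Icc (0 : ℝ) t₁ ×ˢ Metric.sphere (0 : Euc (n + 1)) 1) ∩ G ⁻¹' Ici 0) :=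
    hGc.preimage_isClosed_of_isClosed (isCompact_Icc.prod (isCompact_sphere _ _)).isClosed isClosed_Ici
    |> (isCompact_Icc.prod (isCompact_sphere _ _)).of_isClosed_subset <| inter_subset_left
  -- The earliest time at which the barrier is reached. By continuity the difference is then at most
  -- the barrier in every direction, so `ζ₀` maximises it.
  obtain ⟨⟨t₀, ζ₀⟩, ⟨⟨ht₀, hζ₀⟩, hG₀⟩, hmin⟩ := hKc.exists_isMinOn
    (f := fun q : ℝ × Euc (n + 1) => q.1)
    ⟨(t₁, ζ₁), ⟨⟨ht₁, le_rfl⟩, by simpa using hζ₁⟩, by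
      simp only [mem_preimage, mem_Ici, hG]; linarith⟩ (by fun_prop)
  have hζ₀' : ‖ζ₀‖ = 1 := by simpa using hζ₀
  have hGneg : ∀ t ∈ Ico 0 t₀, ∀ ζ, ‖ζ‖ = 1 → G (t, ζ) < 0 := fun t ht ζ hζ => by
    by_contra hge
    push Not at hge
    have : t₀ ≤ t := hmin (a := (t, ζ))
      ⟨⟨⟨ht.1, ht.2.le.trans ht₀.2⟩, by simpa using hζ⟩, hge⟩
    exact absurd ht.2 (not_lt.mpr this)
  have hG₀' : 0 ≤ G (t₀, ζ₀) := hG₀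
  have ht₀pos : 0 < t₀ := by
    rcases ht₀.1.eq_or_lt with h1 | h1
    · exfalso
      have h1' : 0 = t₀ := h1
      rw [← h1'] at hG₀'
      have := h0 ζ₀ hζ₀'
      simp only [hG, hF, zero_add] at hG₀'
      linarith
    · exact h1
  have hcl : ∀ ζ, ‖ζ‖ = 1 → G (t₀, ζ) ≤ 0 := fun ζ hζ => by
    have hc : ContinuousWithinAt (fun t => G (t, ζ)) (Icc 0 t₁) t₀ :=
      ContinuousWithinAt.comp (g := G) (f := fun t => (t, ζ)) (x := t₀)
        (hGc (t₀, ζ) ⟨ht₀, by simpa using hζ⟩) (by fun_prop)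
        (fun t ht => ⟨ht, by simpa using hζ⟩)
    have : (𝓝[Ico 0 t₀] t₀).NeBot := by
      rw [nhdsWithin_Ico_eq_nhdsLT ht₀pos]; infer_instance
    have hc' : Tendsto (fun t => G (t, ζ)) (𝓝[Ico 0 t₀] t₀) (𝓝 (G (t₀, ζ))) :=
      (hc.mono fun t ht => ⟨ht.1, ht.2.le.trans ht₀.2⟩).tendsto
    refine le_of_tendsto hc' ?_
    filter_upwards [self_mem_nhdsWithin] with t ht
    exact (hGneg t ht ζ hζ).le
  have hG0 : G (t₀, ζ₀) = 0 := le_antisymm (hcl ζ₀ hζ₀') hG₀'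
  have ht₀b : t₀ ∈ Ico 0 b := ⟨ht₀.1, by linarith [ht₀.2]⟩
  have ht₀h : t₀ + h ∈ Ico 0 b := ⟨by linarith [ht₀.1], by linarith [ht₀.2]⟩
  have hspeed := hX.speed_le_of_isMaxOn hn hα (hIb ht₀b) (hIb ht₀h) (hconv _ ht₀b)
    (hconv _ ht₀h) hζ₀' (fun ζ hζ => by
      have h1 := hcl ζ hζ
      simp only [hG, hF] at h1 hG0
      linarith) (by
      have h1 : ε * (1 + t₀) ≤ ε * (1 + t₁) := by gcongr; exact ht₀.2
      simp only [hG, hF] at hG0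
      linarith)
  have hd1 : HasDerivWithinAt (fun s => supportFunction (X (s + h)) ζ₀)
      (-speed α X ν (t₀ + h) (contact (X (t₀ + h)) ζ₀)) (Icc 0 t₀) t₀ := by
    have h1 := hX.hasDerivWithinAt_supportFunction hn (hIb ht₀h) (hconv _ ht₀h) hζ₀'
    have h2 := HasDerivWithinAt.comp (h₂ := fun s => supportFunction (X s) ζ₀) (h := fun s => s + h)
      t₀ h1 ((hasDerivWithinAt_id t₀ (Icc 0 t₀)).add_const h)
      (fun s hs => hIb ⟨by linarith [hs.1], by linarith [hs.2, ht₀.2]⟩)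
    exact h2.congr_deriv (mul_one _)
  have hd2 : HasDerivWithinAt (fun s => supportFunction (X s) ζ₀)
      (-speed α X ν t₀ (contact (X t₀) ζ₀)) (Icc 0 t₀) t₀ :=
    (hX.hasDerivWithinAt_supportFunction hn (hIb ht₀b) (hconv _ ht₀b) hζ₀').mono
      (fun s hs => hIb ⟨hs.1, by linarith [hs.2, ht₀.2]⟩)
  have hd3 : HasDerivWithinAt (fun s : ℝ => m₀ + ε * (1 + s)) ε (Icc 0 t₀) t₀ := by
    have := ((((hasDerivAt_id t₀).const_add 1).const_mul ε).const_add m₀).hasDerivWithinAt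
      (s := Icc 0 t₀)
    simpa using this
  have hd := (hd1.sub hd2).sub hd3
  -- First contact makes the derivative of the difference minus the barrier nonnegative. But the
  -- inner hypersurface is at least as fast there, so that derivative is at most `-ε`.
  have := nonneg_of_hasDerivWithinAt_of_le ht₀pos hd (fun s hs => by
    have h1 := (hGneg s hs ζ₀ hζ₀').le
    rw [← hG0] at h1
    exact h1)
  linarith

theorem IsGaussCurvatureFlow.contact_normal (hn : 1 ≤ n) (hX : IsGaussCurvatureFlow α T X ν)
    {t : ℝ} (ht : t ∈ Ico 0 T) (hconv : IsStrictlyConvex (X t) (ν t)) (x : M) :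
    contact (X t) (ν t x) = x :=
  (hX.eq_contact hn ht hconv (hX.normal t ht x).1 fun y => by
    have := hconv.supporting x y
    rw [real_inner_comm, inner_sub_right] at this
    linarith).symm

theorem IsGaussCurvatureFlow.speed_pos (hX : IsGaussCurvatureFlow α T X ν)
    {t : ℝ} (ht : t ∈ Ico 0 T) (hconv : IsStrictlyConvex (X t) (ν t)) (x : M) :
    0 < speed α X ν t x :=
  Real.rpow_pos_of_pos (gaussCurvature_pos (hX.embedding t ht) (hconv.posDef x)) _

/-- The speed stays bounded below as long as the hypersurfaces are strictly convex. -/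
theorem IsGaussCurvatureFlow.exists_le_speed (hn : 1 ≤ n) (hα : 0 ≤ α)
    (hX : IsGaussCurvatureFlow α T X ν) {b : ℝ} (hb0 : 0 < b) (hb : b ≤ T)
    (hconv : ∀ t ∈ Ico 0 b, IsStrictlyConvex (X t) (ν t)) :
    ∃ c > 0, ∀ t ∈ Ico 0 b, ∀ x, c ≤ speed α X ν t x := by
  have hIb : Ico 0 b ⊆ Ico 0 T := Ico_subset_Ico_right hb
  have hhalf : Icc 0 (b / 2) ⊆ Ico 0 b := fun t ht => ⟨ht.1, by linarith [ht.2]⟩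
  -- The constant is the minimum of the speed on the compact first half `[0, b / 2]`. It makes every
  -- support function drop by at least `c * h` during `[0, h]`, and comparison with the translate
  -- transfers this drop to `[t, t + h]`.
  obtain ⟨⟨t₀, x₀⟩, ⟨ht₀, -⟩, hmin⟩ :=
    ((isCompact_Icc (a := (0 : ℝ)) (b := b / 2)).prod (isCompact_univ (X := M))).exists_isMinOn
    ⟨(0, Classical.arbitrary M), ⟨⟨le_rfl, by positivity⟩, mem_univ _⟩⟩
    (hX.continuousOn_speed.mono (prod_mono (hhalf.trans hIb) le_rfl))
  set c := speed α X ν t₀ x₀ with hc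
  have hcpos : 0 < c := hX.speed_pos (hIb (hhalf ht₀)) (hconv _ (hhalf ht₀)) x₀
  have hcle : ∀ t ∈ Icc 0 (b / 2), ∀ x, c ≤ speed α X ν t x := fun t ht x =>
    hmin (a := (t, x)) ⟨ht, mem_univ _⟩
  have hinit : ∀ h ∈ Ioc 0 (b / 2), ∀ ζ, ‖ζ‖ = 1 →
      supportFunction (X h) ζ - supportFunction (X 0) ζ ≤ -(c * h) := fun h hh ζ hζ => by
    have hd : ∀ t ∈ Icc 0 (b / 2), HasDerivWithinAt (fun s => supportFunction (X s) ζ + c * s)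
        (-speed α X ν t (contact (X t) ζ) + c * 1) (Icc 0 (b / 2)) t := fun t ht =>
      ((hX.hasDerivWithinAt_supportFunction hn (hIb (hhalf ht)) (hconv _ (hhalf ht)) hζ).mono
        (hhalf.trans hIb)).add ((hasDerivWithinAt_id t _).const_mul c)
    have hanti := antitoneOn_of_hasDerivWithinAt_nonpos (convex_Icc 0 (b / 2))
      (fun t ht => (hd t ht).continuousWithinAt)
      (fun t ht => (hd t (interior_subset ht)).mono interior_subset)
      (fun t ht => by have := hcle t (interior_subset ht) (contact (X t) ζ); linarith)
    have := hanti ⟨le_rfl, by positivity⟩ ⟨hh.1.le, hh.2⟩ hh.1.le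
    simp only [mul_zero, add_zero] at this
    linarith
  refine ⟨c, hcpos, fun t ht x => ?_⟩
  have hζ := (hX.normal t (hIb ht) x).1
  have hd := hX.hasDerivWithinAt_supportFunction hn (hIb ht) (hconv t ht) hζ
  rw [hX.contact_normal hn (hIb ht) (hconv t ht)] at hd
  have hd' := (hasDerivWithinAt_iff_tendsto_slope' (by simp)).mp
    (hd.mono (Ioo_subset_Ico_self.trans (Ico_subset_Ico ht.1 hb) : Ioo t b ⊆ Ico 0 T))
  have : (𝓝[Ioo t b] t).NeBot := left_nhdsWithin_Ioo_neBot ht.2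
  -- The difference quotients of the support function from the right are at most `-c`, and they tend
  -- to minus the speed.
  have hle : -speed α X ν t x ≤ -c := by
    refine le_of_tendsto hd' ?_
    have hev : ∀ᶠ s in 𝓝[Ioo t b] t, s < t + b / 2 :=
      mem_nhdsWithin_of_mem_nhds (Iio_mem_nhds (by linarith))
    filter_upwards [self_mem_nhdsWithin, hev] with s hs hs'
    have h1 := hX.supportFunction_sub_le hn hα hb (h := s - t) (m₀ := -(c * (s - t)))
      (by linarith [hs.1]) hconv (by have := mul_pos hcpos (sub_pos.mpr hs.1); linarith)
      (hinit (s - t) ⟨by linarith [hs.1], by linarith⟩) ht.1 (by linarith [hs.2]) hζ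
    rw [add_sub_cancel] at h1
    rw [slope_def_field, div_le_iff₀ (by linarith [hs.1])]
    linarith
  linarith

theorem IsGaussCurvatureFlow.tendsto_chartD2 (hX : IsGaussCurvatureFlow α T X ν) {b : ℝ}
    (hb : b ∈ Ico 0 T) (x : M) :
    Tendsto (fun t => chartD2 (X t) x) (𝓝[Ico 0 T] b) (𝓝 (chartD2 (X b) x)) := by
  set U := (extChartAt (𝓡 n) x).target with hU
  have hUo : IsOpen U := isOpen_extChartAt_target x
  have hxU : extChartAt (𝓡 n) x x ∈ U := mem_extChartAt_target x
  have hφs : ContDiffOn ℝ ∞ (chartFlow X x) (Ico 0 T ×ˢ U) := contDiffOn_chartFlow hX.smooth x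
  have hIu := uniqueDiffOn_Ico (0 : ℝ) T
  have hD2 := contDiffOn_fderiv_slice hIu hUo (contDiffOn_fderiv_slice hIu hUo hφs)
  have h1 := (hD2.continuousOn (b, extChartAt (𝓡 n) x x) ⟨hb, hxU⟩).tendsto
  have h2 : Tendsto (fun t => (t, extChartAt (𝓡 n) x x)) (𝓝[Ico 0 T] b)
      (𝓝[Ico 0 T ×ˢ U] (b, extChartAt (𝓡 n) x x)) := by
    rw [nhdsWithin_prod_eq]
    exact tendsto_id.prodMk (tendsto_const_pure.mono_right (pure_le_nhdsWithin hxU))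
  exact h1.comp h2

/-- Supporting inequalities and semidefiniteness pass to the limit. Definiteness can only be lost
through a vanishing determinant, which would make the Gauss curvature, and since `α > 0` also the
speed, equal to zero, against the uniform lower bound. -/
theorem IsGaussCurvatureFlow.strictlyConvex_of_forall_lt (hn : 1 ≤ n) (hα : 0 < α)
    (hX : IsGaussCurvatureFlow α T X ν) {b : ℝ} (hb0 : 0 < b) (hb : b < T)
    (hconv : ∀ t ∈ Ico 0 b, IsStrictlyConvex (X t) (ν t)) : IsStrictlyConvex (X b) (ν b) := by
  obtain ⟨c, hc, hcle⟩ := hX.exists_le_speed hn hα.le hb0 hb.le hconv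
  have hbT : b ∈ Ico 0 T := ⟨hb0.le, hb⟩
  have hIb : Ico 0 b ⊆ Ico 0 T := Ico_subset_Ico_right hb.le
  have hne : (𝓝[Ico 0 b] b).NeBot := by
    rw [nhdsWithin_Ico_eq_nhdsLT hb0]; infer_instance
  have hslice : ∀ x : M, Tendsto (fun t => (t, x)) (𝓝[Ico 0 b] b) (𝓝[Ico 0 T ×ˢ univ] (b, x)) :=
    fun x => by
      rw [nhdsWithin_prod_eq, nhdsWithin_univ]
      exact (tendsto_id.mono_right (nhdsWithin_mono _ hIb)).prodMk tendsto_const_nhds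
  have hXt : ∀ x, Tendsto (fun t => X t x) (𝓝[Ico 0 b] b) (𝓝 (X b x)) := fun x =>
    (hX.continuousOn (b, x) ⟨hbT, mem_univ _⟩).tendsto.comp (hslice x)
  have hνt : ∀ x, Tendsto (fun t => ν t x) (𝓝[Ico 0 b] b) (𝓝 (ν b x)) := fun x =>
    (hX.normal_continuous (b, x) ⟨hbT, mem_univ _⟩).tendsto.comp (hslice x)
  refine ⟨fun x y => ?_, fun x => ?_⟩
  · refine le_of_tendsto (((hXt y).sub (hXt x)).inner (𝕜 := ℝ) (hνt x)) ?_
    filter_upwards [self_mem_nhdsWithin] with t ht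
    exact (hconv t ht).supporting x y
  · have hspeed : c ≤ speed α X ν b x := by
      have h1 := (hX.continuousOn_speed (b, x) ⟨hbT, mem_univ _⟩).tendsto.comp (hslice x)
      rw [Function.comp_def] at h1
      simp only [Function.uncurry_apply_pair] at h1
      refine ge_of_tendsto h1 ?_
      filter_upwards [self_mem_nhdsWithin] with t ht
      exact hcle t ht x
    have hdet : (secondFundamentalForm (X b) (ν b) x).det ≠ 0 := by
      intro h0
      rw [speed, gaussCurvature_eq_div, h0, zero_div, Real.zero_rpow hα.ne'] at hspeed
      linarith
    have hherm := sff_isHermitian (ν := ν b) (hX.embedding b hbT).contMDiff x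
    refine (Matrix.PosSemidef.posDef_iff_det_ne_zero ?_).mpr hdet
    refine Matrix.PosSemidef.of_dotProduct_mulVec_nonneg hherm fun a => ?_
    have e := dotProduct_sff (ν := ν b) (hX.embedding b hbT).contMDiff x (WithLp.toLp 2 a)
      (WithLp.toLp 2 a)
    rw [star_trivial]
    simp only at e
    rw [e, neg_nonneg]
    have hlim := (hX.tendsto_chartD2 hbT x).mono_left (nhdsWithin_mono b hIb)
    have hlim2 : Tendsto (fun t => chartD2 (X t) x (WithLp.toLp 2 a) (WithLp.toLp 2 a))
        (𝓝[Ico 0 b] b) (𝓝 (chartD2 (X b) x (WithLp.toLp 2 a) (WithLp.toLp 2 a))) :=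
      tendsto_clm_apply₂ hlim _ _
    refine le_of_tendsto (hlim2.inner (𝕜 := ℝ) (hνt x)) ?_
    filter_upwards [self_mem_nhdsWithin] with t ht
    have e' := dotProduct_sff (ν := ν t) (hX.embedding t (hIb ht)).contMDiff x (WithLp.toLp 2 a)
      (WithLp.toLp 2 a)
    have h1 := ((hconv t ht).posDef x).posSemidef.dotProduct_mulVec_nonneg a
    rw [star_trivial] at h1
    simp only at e'
    rw [e'] at h1
    linarith

/-- Strict convexity is preserved by the flow. -/
theorem IsGaussCurvatureFlow.strictlyConvex (hn : 1 ≤ n) (hα : 0 < α)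
    (hX : IsGaussCurvatureFlow α T X ν) {t : ℝ} (ht : t ∈ Ico 0 T) :
    IsStrictlyConvex (X t) (ν t) := by
  by_contra hcon
  -- At the infimum of the bad times convexity still holds, by closedness or by the initial
  -- condition, and openness then extends it beyond the infimum.
  set B := {t | t ∈ Ico 0 T ∧ ¬IsStrictlyConvex (X t) (ν t)} with hB
  have hBne : B.Nonempty := ⟨t, ht, hcon⟩
  have hBbdd : BddBelow B := ⟨0, fun s hs => hs.1.1⟩
  set b := sInf B with hb
  have hb0 : 0 ≤ b := le_csInf hBne fun s hs => hs.1.1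
  have hbt : b ≤ t := csInf_le hBbdd ⟨ht, hcon⟩
  have hbT : b ∈ Ico 0 T := ⟨hb0, hbt.trans_lt ht.2⟩
  have hlt : ∀ s ∈ Ico 0 b, IsStrictlyConvex (X s) (ν s) := fun s hs => by
    by_contra h
    exact absurd (csInf_le hBbdd (show s ∈ B from ⟨⟨hs.1, hs.2.trans hbT.2⟩, h⟩))
      (not_le.mpr hs.2)
  have hbconv : IsStrictlyConvex (X b) (ν b) := by
    rcases hb0.eq_or_lt with h | h
    · rw [← h]; exact hX.initial
    · exact hX.strictlyConvex_of_forall_lt hn hα h hbT.2 hlt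
  obtain ⟨δ, hδ, hev⟩ := hX.eventually_stronglyConvex hbT hbconv
  obtain ⟨ε, hε, hball⟩ := Metric.mem_nhdsWithin_iff.mp hev
  have hge : b + ε ≤ b := le_csInf hBne fun s hs => by
    by_contra hlt'
    push Not at hlt'
    have hbs : b ≤ s := csInf_le hBbdd hs
    refine hs.2 (IsStronglyConvex.isStrictlyConvex hδ (hball ⟨?_, hs.1⟩) (hX.embedding s hs.1)
      (hX.normal s hs.1))
    rw [Metric.mem_ball, Real.dist_eq, abs_of_nonneg (by linarith)]
    linarith
  linarith

end Preservation

/-! ### Determinants computed in a frame of tangent vectors and the normal -/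

section FrameDeterminant

variable {n : ℕ}

/-- An injective `D : ℝⁿ → ℝⁿ⁺¹` together with its unit normal is a frame. -/
def frameBasis {D : Euc n →L[ℝ] Euc (n + 1)} (hD : Function.Injective D) {ν : Euc (n + 1)}
    (hν : ‖ν‖ = 1) (h : ∀ a, ⟪D a, ν⟫ = 0) : Module.Basis (Fin n ⊕ Unit) ℝ (Euc (n + 1)) :=
  basisOfTopLeSpanOfCardEqFinrank
    (Sum.elim (fun i => D (EuclideanSpace.single i 1)) (fun _ => ν))
    (by
      intro w _
      obtain ⟨a, ha⟩ := mem_range_of_orthogonal hD hν h (v := w - ⟪w, ν⟫ • ν) (by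
        rw [inner_sub_left, real_inner_smul_left, real_inner_self_eq_norm_sq, hν]; ring)
      have hw : w = (∑ i, a i • D (EuclideanSpace.single i 1)) + ⟪w, ν⟫ • ν := by
        have h1 : D a = ∑ i, a i • D (EuclideanSpace.single i 1) := by
          conv_lhs => rw [euc_eq_sum a]
          simp only [map_sum, map_smul]
        rw [← h1, ha]; abel
      rw [hw]
      refine Submodule.add_mem _ (Submodule.sum_mem _ fun i _ => Submodule.smul_mem _ _ ?_)
        (Submodule.smul_mem _ _ ?_)
      · exact Submodule.subset_span ⟨Sum.inl i, rfl⟩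
      · exact Submodule.subset_span ⟨Sum.inr (), rfl⟩)
    (by simp)

theorem frameBasis_apply {D : Euc n →L[ℝ] Euc (n + 1)} (hD : Function.Injective D)
    {ν : Euc (n + 1)} (hν : ‖ν‖ = 1) (h : ∀ a, ⟪D a, ν⟫ = 0) :
    (frameBasis hD hν h : Fin n ⊕ Unit → Euc (n + 1)) =
      Sum.elim (fun i => D (EuclideanSpace.single i 1)) (fun _ => ν) := by
  simp [frameBasis]

theorem det_mul_det_eq {ι E : Type*} [Fintype ι] [DecidableEq ι] [AddCommGroup E] [Module ℝ E]
    (b : Module.Basis ι ℝ E) (L : E →ₗ[ℝ] E) (v : ι → E) (m₁ m₂ : Matrix ι ι ℝ)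
    (h₁ : ∀ j, v j = ∑ i, m₁ i j • b i) (h₂ : ∀ j, L (v j) = ∑ i, m₂ i j • b i) :
    LinearMap.det L * m₁.det = m₂.det := by
  have h : ∀ (v : ι → E) (m : Matrix ι ι ℝ), (∀ j, v j = ∑ i, m i j • b i) →
      b.det v = m.det := fun v m hv => by
    rw [Module.Basis.det_apply]
    congr 1
    ext i j
    rw [Module.Basis.toMatrix_apply, hv j]
    simp [Finsupp.single_apply]
  rw [← h v m₁ h₁, ← h (L ∘ v) m₂ h₂, Module.Basis.det_comp]

/-- In the frame of tangent vectors and `ν`, both the family `(r • w j, w₀)` and its image under `L`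
have block upper triangular coefficient matrices. The tangential parts of `w₀` and `L w₀` therefore
do not affect the determinants. -/
theorem det_of_frame {D : Euc n →L[ℝ] Euc (n + 1)} (hD : Function.Injective D)
    {ν : Euc (n + 1)} (hν : ‖ν‖ = 1) (h : ∀ a, ⟪D a, ν⟫ = 0) (L : Euc (n + 1) →L[ℝ] Euc (n + 1))
    (W : Matrix (Fin n) (Fin n) ℝ) {w : Fin n → Euc (n + 1)} {w₀ : Euc (n + 1)} {r s : ℝ}
    (hw : ∀ j, w j = ∑ k, W k j • D (EuclideanSpace.single k 1))
    (hLw : ∀ j, L (r • w j) = s • D (EuclideanSpace.single j 1)) (hw₀ : ⟪w₀, ν⟫ = 1) :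
    L.det * (r ^ n * W.det) = s ^ n * ⟪L w₀, ν⟫ := by
  set b := frameBasis hD hν h
  have hb := frameBasis_apply hD hν h
  have hdecomp : ∀ w : Euc (n + 1), ∃ a : Euc n,
      w = (∑ i, a i • D (EuclideanSpace.single i 1)) + ⟪w, ν⟫ • ν := fun w => by
    obtain ⟨a, ha⟩ := mem_range_of_orthogonal hD hν h (v := w - ⟪w, ν⟫ • ν) (by
      rw [inner_sub_left, real_inner_smul_left, real_inner_self_eq_norm_sq, hν]; ring)
    refine ⟨a, ?_⟩
    have h1 : D a = ∑ i, a i • D (EuclideanSpace.single i 1) := by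
      conv_lhs => rw [euc_eq_sum a]
      simp only [map_sum, map_smul]
    rw [← h1, ha]; abel
  obtain ⟨a, ha⟩ := hdecomp w₀
  obtain ⟨c, hc⟩ := hdecomp (L w₀)
  have hdet := det_mul_det_eq b (L : Euc (n + 1) →ₗ[ℝ] Euc (n + 1))
    (Sum.elim (fun j => r • w j) (fun _ => w₀))
    (Matrix.fromBlocks (r • W) (Matrix.of fun i _ => a i) 0 1)
    (Matrix.fromBlocks (s • (1 : Matrix (Fin n) (Fin n) ℝ)) (Matrix.of fun i _ => c i) 0
      (Matrix.of fun _ _ => ⟪L w₀, ν⟫))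
    (by
      rintro (j | j)
      · simp only [Fintype.sum_sum_type, b, hb]
        simp [hw, Finset.smul_sum, smul_smul]
      · simp only [Fintype.sum_sum_type, b, hb]
        conv_lhs => rw [Sum.elim_inr, ha, hw₀]
        simp)
    (by
      rintro (j | j)
      · simp only [Fintype.sum_sum_type, b, hb]
        simp only [Sum.elim_inl, ContinuousLinearMap.coe_coe, hLw]
        simp [Matrix.one_apply]
      · simp only [Fintype.sum_sum_type, b, hb]
        simp only [Sum.elim_inr, ContinuousLinearMap.coe_coe]
        conv_lhs => rw [hc]
        simp)
  rw [Matrix.det_fromBlocks_zero₂₁, Matrix.det_fromBlocks_zero₂₁] at hdet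
  simp only [Matrix.det_smul, Fintype.card_fin, Matrix.det_one, mul_one, Matrix.det_unique,
    Matrix.of_apply, Matrix.one_apply_eq] at hdet
  exact hdet

end FrameDeterminant

/-! ### Jacobians in polar coordinates around a hypersurface -/

section Jacobian

variable {n : ℕ}

/-- The Jacobian of a map written in polar coordinates `y = r N(r, u)` around a hypersurface with
normal field `N` and Weingarten matrix `W`. -/
theorem exists_hasFDerivAt_polar {N Ξ : ℝ × Euc n → Euc (n + 1)}
    {N' Ξ' : ℝ × Euc n →L[ℝ] Euc (n + 1)} {q₀ : ℝ × Euc n} (hr : 0 < q₀.1)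
    {D : Euc n →L[ℝ] Euc (n + 1)} (hD : Function.Injective D) (hDν : ∀ a, ⟪D a, N q₀⟫ = 0)
    (hN : HasFDerivAt N N' q₀) (hunit : ∀ᶠ q in 𝓝 q₀, ‖N q‖ = 1)
    {W : Matrix (Fin n) (Fin n) ℝ} (hW : W.det ≠ 0)
    (hNW : ∀ j, N' (0, EuclideanSpace.single j 1) = ∑ k, W k j • D (EuclideanSpace.single k 1))
    (hΞ : HasFDerivAt Ξ Ξ' q₀) {ρ : ℝ} (hΞD : ∀ a, Ξ' (0, a) = ρ • D a)
    {g : Euc (n + 1) → ℝ × Euc n} (hg : ContinuousAt g (q₀.1 • N q₀)) (hg₀ : g (q₀.1 • N q₀) = q₀)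
    (hleft : ∀ᶠ y in 𝓝 (q₀.1 • N q₀), (g y).1 • N (g y) = y) :
    ∃ L : Euc (n + 1) →L[ℝ] Euc (n + 1), HasFDerivAt (Ξ ∘ g) L (q₀.1 • N q₀) ∧
      L.det * (q₀.1 ^ n * W.det) = ρ ^ n * ⟪Ξ' (1, 0), N q₀⟫ := by
  have hν : ‖N q₀‖ = 1 := hunit.self_of_nhds
  -- Differentiating `⟪N, N⟫ = 1` shows that the derivative of a unit field is orthogonal to the
  -- field.
  have hN'ν : ∀ p, ⟪N' p, N q₀⟫ = 0 := fun p => by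
    have h1 := hN.inner ℝ hN
    have h2 : (fun q => ⟪N q, N q⟫) =ᶠ[𝓝 q₀] fun _ => (1 : ℝ) := by
      filter_upwards [hunit] with q hq
      rw [real_inner_self_eq_norm_sq, hq, one_pow]
    have h3 := (h1.congr_of_eventuallyEq h2.symm).unique (hasFDerivAt_const (1 : ℝ) q₀)
    have h4 := DFunLike.congr_fun h3 p
    simp at h4
    rw [real_inner_comm] at h4 ⊢
    rw [real_inner_comm] at h4
    linarith
  set Θ : ℝ × Euc n → Euc (n + 1) := fun q => q.1 • N q with hΘ
  set Θ' : ℝ × Euc n →L[ℝ] Euc (n + 1) :=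
    q₀.1 • N' + (ContinuousLinearMap.fst ℝ ℝ (Euc n)).smulRight (N q₀) with hΘ'
  have hΘd : HasFDerivAt Θ Θ' q₀ := hasFDerivAt_fst.smul hN
  have hΘ'app : ∀ p, Θ' p = q₀.1 • N' p + p.1 • N q₀ := fun p => by simp [hΘ']
  have hN'a : ∀ a : Euc n, N' (0, a) = D (WithLp.toLp 2 (W.mulVec a)) := fun a => by
    have h1 : ((0 : ℝ), a) = ∑ j, a j • ((0 : ℝ), (EuclideanSpace.single j (1 : ℝ) : Euc n)) := by
      ext1
      · simp [Prod.fst_sum]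
      · rw [Prod.snd_sum]; exact euc_eq_sum a
    have h2 : (WithLp.toLp 2 (W.mulVec a) : Euc n) =
        ∑ k, (W.mulVec a) k • EuclideanSpace.single k (1 : ℝ) := euc_eq_sum _
    rw [h1, h2]
    simp only [map_sum, map_smul, hNW, Finset.smul_sum, Matrix.mulVec, dotProduct, Finset.sum_smul]
    rw [Finset.sum_comm]
    simp only [smul_smul, mul_comm]
  have hinj : Function.Injective Θ' := by
    rw [injective_iff_map_eq_zero]
    rintro ⟨σ, a⟩ h0
    rw [hΘ'app] at h0
    have h1 := congrArg (fun w => ⟪w, N q₀⟫) h0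
    simp only [inner_add_left, real_inner_smul_left, hN'ν, mul_zero, zero_add,
      real_inner_self_eq_norm_sq, hν, inner_zero_left] at h1
    have hσ : σ = 0 := by simpa using h1
    subst hσ
    rw [zero_smul, add_zero, smul_eq_zero_iff_right hr.ne', hN'a] at h0
    have h2 := hD (h0.trans (map_zero D).symm)
    have h3 : W.mulVec a = 0 := by simpa using h2
    have h4 := Matrix.eq_zero_of_mulVec_eq_zero hW h3
    have h5 : a = 0 := by simpa using h4
    rw [h5]; rfl
  let e : (ℝ × Euc n) ≃L[ℝ] Euc (n + 1) :=
    (LinearMap.linearEquivOfInjective (Θ' : ℝ × Euc n →ₗ[ℝ] Euc (n + 1)) hinj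
      (by simp [add_comm])).toContinuousLinearEquiv
  have he : (e : ℝ × Euc n →L[ℝ] Euc (n + 1)) = Θ' :=
    ContinuousLinearMap.ext fun p => rfl
  -- `g` is only known to be continuous. Being a right inverse of the polar map `Θ` near the base
  -- point, with `Θ'` invertible, it is differentiable with derivative `Θ'⁻¹`.
  have hgd : HasFDerivAt g (e.symm : Euc (n + 1) →L[ℝ] ℝ × Euc n) (q₀.1 • N q₀) := by
    refine HasFDerivAt.of_local_left_inverse (f := Θ) hg ?_ hleft
    rw [he, hg₀]
    exact hΘd
  refine ⟨Ξ'.comp (e.symm : Euc (n + 1) →L[ℝ] ℝ × Euc n), ?_, ?_⟩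
  · refine HasFDerivAt.comp _ ?_ hgd
    rw [hg₀]; exact hΞ
  · have hLe : ∀ p, (Ξ'.comp (e.symm : Euc (n + 1) →L[ℝ] ℝ × Euc n)) (Θ' p) = Ξ' p := fun p => by
      have : Θ' p = e p := by rw [← he]; rfl
      rw [this]; simp
    have h := det_of_frame hD hν hDν (Ξ'.comp (e.symm : Euc (n + 1) →L[ℝ] ℝ × Euc n)) W
      (w := fun j => N' (0, EuclideanSpace.single j 1)) (w₀ := Θ' (1, 0)) (r := q₀.1) (s := ρ)
      hNW (fun j => by
        have h1 : q₀.1 • N' (0, EuclideanSpace.single j 1) =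
            Θ' (0, EuclideanSpace.single j 1) := by rw [hΘ'app]; simp
        rw [h1, hLe, hΞD]) (by
        rw [hΘ'app, inner_add_left, real_inner_smul_left, real_inner_smul_left, hN'ν,
          real_inner_self_eq_norm_sq, hν]; norm_num)
    rwa [hLe] at h

end Jacobian

/-! ### Differentiability of a continuous unit normal field -/

section NormalDerivative

attribute [local instance 2000] chartedSpaceSelf

variable {n : ℕ}

theorem contDiffAt_clm_apply_of {V F G : Type*} [NormedAddCommGroup V] [NormedSpace ℝ V]
    [NormedAddCommGroup F] [NormedSpace ℝ F] [FiniteDimensional ℝ F] [NormedAddCommGroup G]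
    [NormedSpace ℝ G] {k : WithTop ℕ∞} {L : V → F →L[ℝ] G} {q : V}
    (h : ∀ w, ContDiffAt ℝ k (fun p => L p w) q) : ContDiffAt ℝ k L q := by
  have hd : Module.finrank ℝ F = Module.finrank ℝ (Fin (Module.finrank ℝ F) → ℝ) :=
    (Module.finrank_fin_fun ℝ).symm
  let e₁ := ContinuousLinearEquiv.ofFinrankEq hd
  let e₂ := (e₁.arrowCongr (1 : G ≃L[ℝ] G)).trans (ContinuousLinearEquiv.piRing (Fin _))
  have h1 : ContDiffAt ℝ k (e₂ ∘ L) q := contDiffAt_pi.mpr fun i => h _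
  rw [← Function.id_comp L, ← e₂.symm_comp_self]
  exact e₂.symm.contDiff.contDiffAt.comp q h1

/-- The normal is given only as a continuous field. The solution `Z` of the linear system
"orthogonal to the tangent vectors, inner product one with `ν₀`" depends differentiably on the
parameter, since inversion of linear maps is smooth. Near `q₀` the field `N` is a multiple of `Z`,
positive by continuity, so it is the normalization of `Z`. -/
theorem differentiableAt_unit_normal {V : Type*} [NormedAddCommGroup V] [NormedSpace ℝ V]
    {D : V → Euc n →L[ℝ] Euc (n + 1)} {N : V → Euc (n + 1)} {q₀ : V}
    (hD : ContDiffAt ℝ 1 D q₀) (hinj : Function.Injective (D q₀)) (hNc : ContinuousAt N q₀)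
    (hunit : ∀ᶠ q in 𝓝 q₀, ‖N q‖ = 1) (hDN : ∀ᶠ q in 𝓝 q₀, ∀ a, ⟪D q a, N q⟫ = 0) :
    DifferentiableAt ℝ N q₀ := by
  set ν₀ := N q₀ with hν₀
  have hν : ‖ν₀‖ = 1 := hunit.self_of_nhds
  set L : V → Euc (n + 1) →L[ℝ] (Fin n → ℝ) × ℝ := fun q =>
    (ContinuousLinearMap.pi fun i => innerSL ℝ (D q (EuclideanSpace.single i 1))).prod
      (innerSL ℝ ν₀) with hL
  have hLapp : ∀ q w, L q w = (fun i => ⟪D q (EuclideanSpace.single i 1), w⟫, ⟪ν₀, w⟫) :=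
    fun q w => rfl
  have hLc : ContDiffAt ℝ 1 L q₀ := by
    refine contDiffAt_clm_apply_of fun w => ?_
    simp only [hLapp]
    refine ContDiffAt.prodMk (contDiffAt_pi.mpr fun i => ?_) contDiffAt_const
    exact (hD.clm_apply contDiffAt_const).inner ℝ contDiffAt_const
  have hLinj : Function.Injective (L q₀) := by
    rw [injective_iff_map_eq_zero]
    intro w hw
    rw [hLapp] at hw
    have h1 : ∀ i, ⟪D q₀ (EuclideanSpace.single i 1), w⟫ = 0 := fun i =>
      congrFun (congrArg Prod.fst hw) i
    have h2 : ⟪ν₀, w⟫ = 0 := congrArg Prod.snd hw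
    have h3 := eq_smul_of_orthogonal_range hinj hν hDN.self_of_nhds (ζ := w) fun a => by
      rw [euc_eq_sum a, map_sum, sum_inner]
      refine Finset.sum_eq_zero fun i _ => ?_
      rw [map_smul, real_inner_smul_left, h1, mul_zero]
    rw [h3, h2, zero_smul]
  let e : Euc (n + 1) ≃L[ℝ] (Fin n → ℝ) × ℝ :=
    (LinearMap.linearEquivOfInjective (L q₀ : Euc (n + 1) →ₗ[ℝ] (Fin n → ℝ) × ℝ) hLinj
      (by simp)).toContinuousLinearEquiv
  have he : (e : Euc (n + 1) →L[ℝ] (Fin n → ℝ) × ℝ) = L q₀ := by ext1 p; rfl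
  set Z : V → Euc (n + 1) := fun q => (L q).inverse (0, 1) with hZ
  have hinv : ContDiffAt ℝ 1 (fun q => (L q).inverse) q₀ := by
    have h1 : ContDiffAt ℝ 1 ContinuousLinearMap.inverse (L q₀) := by
      rw [← he]; exact contDiffAt_map_inverse e
    exact h1.comp q₀ hLc
  have hZd : DifferentiableAt ℝ Z q₀ :=
    (hinv.differentiableAt one_ne_zero).clm_apply (differentiableAt_const _)
  have hev : ∀ᶠ q in 𝓝 q₀, L q ∈ range ((↑) : (Euc (n + 1) ≃L[ℝ] (Fin n → ℝ) × ℝ) →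
      Euc (n + 1) →L[ℝ] (Fin n → ℝ) × ℝ) := by
    refine hLc.continuousAt.eventually ?_
    rw [← he]
    exact ContinuousLinearEquiv.nhds e
  have hpos : ∀ᶠ q in 𝓝 q₀, 0 < ⟪ν₀, N q⟫ := by
    have hc : ContinuousAt (fun q => ⟪ν₀, N q⟫) q₀ := continuousAt_const.inner (𝕜 := ℝ) hNc
    refine hc.eventually_const_lt ?_
    show 0 < ⟪ν₀, ν₀⟫
    rw [real_inner_self_eq_norm_sq, hν]; norm_num
  have hNZ : ∀ᶠ q in 𝓝 q₀, N q = ⟪ν₀, N q⟫ • Z q := by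
    filter_upwards [hev, hDN] with q ⟨e', he'⟩ h2
    have h3 : L q (N q) = ⟪ν₀, N q⟫ • (0, 1) := by
      rw [hLapp]
      ext1
      · funext i; simp [h2]
      · simp
    have h4 : Z q = e'.symm (0, 1) := by
      simp only [hZ, ← he', ContinuousLinearMap.inverse_equiv]; rfl
    rw [h4, ← map_smul, ← h3, ← he']
    simp
  have hNeq : N =ᶠ[𝓝 q₀] fun q => ‖Z q‖⁻¹ • Z q := by
    filter_upwards [hNZ, hpos, hunit] with q h1 h2 h3
    have h4 : ⟪ν₀, N q⟫ * ‖Z q‖ = 1 := by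
      rw [← h3]
      conv_rhs => rw [h1]
      rw [norm_smul, Real.norm_eq_abs, abs_of_pos h2]
    have h5 : ⟪ν₀, N q⟫ = ‖Z q‖⁻¹ := eq_inv_of_mul_eq_one_left h4
    rw [← h5]; exact h1
  have hZ0 : Z q₀ ≠ 0 := by
    intro h0
    have h1 := hNZ.self_of_nhds
    rw [h0, smul_zero] at h1
    rw [← hν₀] at h1
    rw [h1, norm_zero] at hν
    exact zero_ne_one hν
  have hfin : DifferentiableAt ℝ (fun q => ‖Z q‖⁻¹ • Z q) q₀ :=
    ((hZd.norm ℝ hZ0).inv (norm_ne_zero_iff.mpr hZ0)).smul hZd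
  exact hfin.congr_of_eventuallyEq hNeq

end NormalDerivative

/-! ### Weingarten equation and Jacobians of maps parametrized by the normal -/

section NormalMap

attribute [local instance 2000] chartedSpaceSelf

variable {n : ℕ} {M : Type*} [TopologicalSpace M] [CompactSpace M]
  [ChartedSpace (EuclideanSpace ℝ (Fin n)) M] [IsManifold (𝓡 n) ∞ M]
  {α T : ℝ} {X ν : ℝ → M → Euc (n + 1)}

theorem IsGaussCurvatureFlow.contDiffAt_chartFlow (hX : IsGaussCurvatureFlow α T X ν) {t : ℝ}
    (ht : t ∈ Ioo 0 T) (x : M) :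
    ContDiffAt ℝ ∞ (chartFlow X x) (t, extChartAt (𝓡 n) x x) :=
  (contDiffOn_chartFlow hX.smooth x).contDiffAt
    (prod_mem_nhds (Ico_mem_nhds ht.1 ht.2)
      ((isOpen_extChartAt_target x).mem_nhds (mem_extChartAt_target x)))

theorem IsGaussCurvatureFlow.exists_hasFDerivAt_chartFlow (hX : IsGaussCurvatureFlow α T X ν)
    {t : ℝ} (ht : t ∈ Ioo 0 T) (x : M) :
    ∃ Ξ' : ℝ × Euc n →L[ℝ] Euc (n + 1),
      HasFDerivAt (chartFlow X x) Ξ' (t, extChartAt (𝓡 n) x x) ∧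
      (∀ a, Ξ' (0, a) = chartD (X t) x a) ∧
      Ξ' (1, 0) = -(speed α X ν t x) • ν t x := by
  have hd := ((hX.contDiffAt_chartFlow ht x).differentiableAt (by simp)).hasFDerivAt
  set u₀ := extChartAt (𝓡 n) x x
  refine ⟨_, hd, fun a => ?_, ?_⟩
  · have h1 : HasFDerivAt (fun v => (t, v)) (ContinuousLinearMap.inr ℝ ℝ (Euc n)) u₀ :=
      hasFDerivAt_prodMk_right t u₀
    have h2 : HasFDerivAt (coordMap (X t) x)
        ((fderiv ℝ (chartFlow X x) (t, u₀)).comp (ContinuousLinearMap.inr ℝ ℝ (Euc n))) u₀ :=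
      HasFDerivAt.comp u₀ (g := chartFlow X x) (f := fun v => (t, v)) hd h1
    rw [chartD, h2.fderiv]
    rfl
  · have h1 : HasDerivAt (fun s : ℝ => (s, u₀)) ((1 : ℝ), (0 : Euc n)) t :=
      (hasDerivAt_id t).prodMk (hasDerivAt_const t u₀)
    have h2 := hd.comp_hasDerivAt_of_eq t h1 rfl
    have h3 := (hX.evolution t (Ioo_subset_Ico_self ht) x).hasDerivAt (Ico_mem_nhds ht.1 ht.2)
    have h4 : chartFlow X x ∘ (fun s : ℝ => (s, u₀)) = fun s => X s x := by
      funext s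
      simp only [chartFlow, coordMap, Function.comp_apply, u₀]
      rw [extChartAt_to_inv x]
    rw [h4] at h2
    exact h2.unique h3

open Matrix in
/-- The Weingarten equation: the normal is differentiable in space-time and its spatial derivative
is given by the Weingarten matrix. -/
theorem IsGaussCurvatureFlow.exists_hasFDerivAt_normal (hX : IsGaussCurvatureFlow α T X ν)
    {t : ℝ} (ht : t ∈ Ioo 0 T) (x : M) :
    ∃ N' : ℝ × Euc n →L[ℝ] Euc (n + 1),
      HasFDerivAt (fun q : ℝ × Euc n => ν q.1 ((extChartAt (𝓡 n) x).symm q.2)) N'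
        (t, extChartAt (𝓡 n) x x) ∧
      ∀ j, N' (0, EuclideanSpace.single j 1) =
        ∑ k, weingarten (X t) (ν t) x k j • chartD (X t) x (EuclideanSpace.single k 1) := by
  have htI : t ∈ Ico 0 T := Ioo_subset_Ico_self ht
  set u₀ := extChartAt (𝓡 n) x x with hu₀
  set q₀ : ℝ × Euc n := (t, u₀) with hq₀
  set N : ℝ × Euc n → Euc (n + 1) := fun q => ν q.1 ((extChartAt (𝓡 n) x).symm q.2) with hN
  set D1 : ℝ × Euc n → Euc n →L[ℝ] Euc (n + 1) :=
    fun q => fderiv ℝ (fun v => chartFlow X x (q.1, v)) q.2 with hD1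
  have hnhds : Ico 0 T ×ˢ (extChartAt (𝓡 n) x).target ∈ 𝓝 q₀ :=
    prod_mem_nhds (Ico_mem_nhds ht.1 ht.2)
      ((isOpen_extChartAt_target x).mem_nhds (mem_extChartAt_target x))
  have hD1c : ContDiffAt ℝ ∞ D1 q₀ :=
    (contDiffOn_fderiv_slice (uniqueDiffOn_Ico 0 T) (isOpen_extChartAt_target x)
      (contDiffOn_chartFlow hX.smooth x)).contDiffAt hnhds
  have hsymm : (extChartAt (𝓡 n) x).symm u₀ = x := extChartAt_to_inv x
  have hD10 : D1 q₀ = chartD (X t) x := rfl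
  have hN0 : N q₀ = ν t x := by simp only [hN, hq₀, hsymm]
  have hinj : Function.Injective (D1 q₀) := fderiv_coordMap_injective (hX.embedding t htI) x
  have hunit : ∀ᶠ q in 𝓝 q₀, ‖N q‖ = 1 := by
    filter_upwards [hnhds] with q hq
    exact (hX.normal q.1 hq.1 _).1
  have horth : ∀ᶠ q in 𝓝 q₀, ∀ a, ⟪D1 q a, N q⟫ = 0 := by
    filter_upwards [hnhds] with q hq a
    exact inner_fderiv_coordMap (hX.embedding q.1 hq.1).contMDiff (hX.normal q.1 hq.1) x hq.2 a
  have hNc : ContinuousAt N q₀ := by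
    have h1 : ContinuousOn N (Ico 0 T ×ˢ (extChartAt (𝓡 n) x).target) := by
      refine hX.normal_continuous.comp
        (f := fun q : ℝ × Euc n => (q.1, (extChartAt (𝓡 n) x).symm q.2)) ?_ ?_
      · exact continuousOn_fst.prodMk
          ((continuousOn_extChartAt_symm x).comp continuousOn_snd fun q hq => hq.2)
      · exact fun q hq => ⟨hq.1, mem_univ _⟩
    exact h1.continuousAt hnhds
  have hNd := (differentiableAt_unit_normal (hD1c.of_le (by simp)) hinj hNc hunit horth).hasFDerivAt
  set N' := fderiv ℝ N q₀
  have hD1d := (hD1c.differentiableAt (by simp)).hasFDerivAt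
  have hD2 : ∀ b, fderiv ℝ D1 q₀ (0, b) = chartD2 (X t) x b := fun b => by
    have h1 : HasFDerivAt (fun v => (t, v)) (ContinuousLinearMap.inr ℝ ℝ (Euc n)) u₀ :=
      hasFDerivAt_prodMk_right t u₀
    have h2 : HasFDerivAt (fderiv ℝ (coordMap (X t) x))
        ((fderiv ℝ D1 q₀).comp (ContinuousLinearMap.inr ℝ ℝ (Euc n))) u₀ :=
      HasFDerivAt.comp u₀ (g := D1) (f := fun v => (t, v)) hD1d h1
    rw [chartD2, h2.fderiv]
    rfl
  -- Obtained by differentiating the orthogonality relation `⟪D1 q a, N q⟫ = 0` in the space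
  -- direction `b`.
  have hkey : ∀ a b, ⟪chartD (X t) x a, N' (0, b)⟫ = -⟪chartD2 (X t) x b a, ν t x⟫ :=
    fun a b => by
      have h1 := (hD1d.clm_apply (hasFDerivAt_const a q₀)).inner ℝ hNd
      have h2 : (fun q => ⟪D1 q a, N q⟫) =ᶠ[𝓝 q₀] fun _ => (0 : ℝ) := by
        filter_upwards [horth] with q hq using hq a
      have h3 := (h1.congr_of_eventuallyEq h2.symm).unique (hasFDerivAt_const (0 : ℝ) q₀)
      have h4 := DFunLike.congr_fun h3 (0, b)
      simp at h4
      rw [hD2, hN0, hD10] at h4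
      linarith
  have hperp : ∀ b, ⟪N' (0, b), ν t x⟫ = 0 := fun b => by
    have h1 := hNd.inner ℝ hNd
    have h2 : (fun q => ⟪N q, N q⟫) =ᶠ[𝓝 q₀] fun _ => (1 : ℝ) := by
      filter_upwards [hunit] with q hq
      rw [real_inner_self_eq_norm_sq, hq, one_pow]
    have h3 := (h1.congr_of_eventuallyEq h2.symm).unique (hasFDerivAt_const (1 : ℝ) q₀)
    have h4 := DFunLike.congr_fun h3 (0, b)
    simp at h4
    rw [hN0, real_inner_comm] at h4
    rw [real_inner_comm] at h4 ⊢
    linarith [real_inner_comm (N' (0, b)) (ν t x)]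
  refine ⟨N', hNd, fun j => ?_⟩
  obtain ⟨c, hc⟩ := mem_range_of_orthogonal (L := chartD (X t) x) hinj
    (hX.normal t htI x).1 (inner_fderiv_coordMap_self (hX.normal t htI) x)
    (hperp (EuclideanSpace.single j 1))
  -- The derivative of the normal is tangent, say the image of `c`. Pairing with tangent vectors
  -- gives `g c = h e_j`, so `c` is the `j`-th column of the Weingarten matrix.
  have hmul : metric (X t) x *ᵥ (c : Fin n → ℝ) =
      secondFundamentalForm (X t) (ν t) x *ᵥ (EuclideanSpace.single j 1 : Euc n) := by
    refine dotProduct_eq _ _ fun a => ?_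
    have h1 := dotProduct_metric (X := X t) x (WithLp.toLp 2 a) c
    have h2 := dotProduct_sff (ν := ν t) (hX.embedding t htI).contMDiff x (WithLp.toLp 2 a)
      (EuclideanSpace.single j 1)
    simp only at h1 h2
    rw [dotProduct_comm, h1, dotProduct_comm, h2, hc, hkey,
      chartD2_symm (hX.embedding t htI).contMDiff]
  have hcW : (c : Fin n → ℝ) = weingarten (X t) (ν t) x *ᵥ (EuclideanSpace.single j 1 : Euc n) := by
    rw [weingarten, ← Matrix.mulVec_mulVec, ← hmul, Matrix.mulVec_mulVec,
      Matrix.nonsing_inv_mul _ (posDef_metric (hX.embedding t htI) x).det_pos.ne'.isUnit,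
      Matrix.one_mulVec]
  rw [← hc, euc_eq_sum c, map_sum]
  refine Finset.sum_congr rfl fun k _ => ?_
  rw [map_smul, hcW]
  congr 1
  simp [Matrix.mulVec, dotProduct]

variable [T2Space M] [Nonempty M]

theorem IsGaussCurvatureFlow.normal_contact (hn : 1 ≤ n) (hα : 0 < α)
    (hX : IsGaussCurvatureFlow α T X ν) {t : ℝ} (ht : t ∈ Ico 0 T) {ζ : Euc (n + 1)}
    (hζ : ‖ζ‖ = 1) : ν t (contact (X t) ζ) = ζ := by
  obtain ⟨δ, hδ, h⟩ := hX.stronglyConvex ht (hX.strictlyConvex hn hα ht)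
  exact GaussFlow.normal_contact hn hδ h (hX.embedding t ht) (hX.normal t ht) hζ

/-- The Jacobian, in polar coordinates, of a function of the point with a given normal. -/
theorem IsGaussCurvatureFlow.exists_hasFDerivAt_contact (hn : 1 ≤ n) (hα : 0 < α)
    (hX : IsGaussCurvatureFlow α T X ν) {r τ' : ℝ} (hr : 0 < r) {τ : ℝ → ℝ}
    (hτ : HasDerivAt τ τ' r) (ht : τ r ∈ Ioo 0 T) {ζ : Euc (n + 1)} (hζ : ‖ζ‖ = 1) {x : M}
    (hx : x = contact (X (τ r)) ζ) {Y : ℝ → M → Euc (n + 1)} {ρ : ℝ}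
    {Ξ' : ℝ × Euc n →L[ℝ] Euc (n + 1)}
    (hΞ : HasFDerivAt (fun q : ℝ × Euc n => Y q.1 ((extChartAt (𝓡 n) x).symm q.2)) Ξ'
      (r, extChartAt (𝓡 n) x x))
    (hΞD : ∀ a, Ξ' (0, a) = ρ • chartD (X (τ r)) x a) :
    ∃ L : Euc (n + 1) →L[ℝ] Euc (n + 1),
      HasFDerivAt (fun y => Y ‖y‖ (contact (X (τ ‖y‖)) (‖y‖⁻¹ • y))) L (r • ζ) ∧
      L.det * (r ^ n * gaussCurvature (X (τ r)) (ν (τ r)) x) = ρ ^ n * ⟪Ξ' (1, 0), ζ⟫ := by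
  have htI : τ r ∈ Ico 0 T := Ioo_subset_Ico_self ht
  have hconv := hX.strictlyConvex hn hα htI
  have hνx : ν (τ r) x = ζ := by rw [hx]; exact hX.normal_contact hn hα htI hζ
  set u₀ := extChartAt (𝓡 n) x x with hu₀
  have hsymm : (extChartAt (𝓡 n) x).symm u₀ = x := extChartAt_to_inv x
  have hnorm : ‖r • ζ‖ = r := by rw [norm_smul, hζ, Real.norm_eq_abs, abs_of_pos hr, mul_one]
  have hζ' : ‖r • ζ‖⁻¹ • r • ζ = ζ := by rw [hnorm, smul_smul, inv_mul_cancel₀ hr.ne', one_smul]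
  have hζ'' : r⁻¹ • r • ζ = ζ := by rw [smul_smul, inv_mul_cancel₀ hr.ne', one_smul]
  have hne : r • ζ ≠ 0 := by rw [← norm_pos_iff, hnorm]; exact hr
  have hτev : ∀ᶠ s in 𝓝 r, τ s ∈ Ico 0 T :=
    hτ.continuousAt.eventually (Ico_mem_nhds ht.1 ht.2)
  have hnormc : Tendsto (fun y : Euc (n + 1) => ‖y‖) (𝓝 (r • ζ)) (𝓝 r) := by
    have := (continuous_norm (E := Euc (n + 1))).tendsto (r • ζ)
    rwa [hnorm] at this
  have hcont : ContinuousAt (fun y : Euc (n + 1) => contact (X (τ ‖y‖)) (‖y‖⁻¹ • y)) (r • ζ) := by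
    have h1 : ContinuousAt (fun q : ℝ × Euc (n + 1) => contact (X q.1) q.2) (τ r, ζ) :=
      (hX.continuousWithinAt_contact hn htI hconv hζ).continuousAt
        (prod_mem_nhds (Ico_mem_nhds ht.1 ht.2) univ_mem)
    have h2 : ContinuousAt (fun y : Euc (n + 1) => (τ ‖y‖, ‖y‖⁻¹ • y)) (r • ζ) := by
      refine ContinuousAt.prodMk ?_ ?_
      · exact ContinuousAt.comp_of_eq (g := τ) hτ.continuousAt continuous_norm.continuousAt hnorm
      · exact (continuous_norm.continuousAt.inv₀ (norm_ne_zero_iff.mpr hne)).smul continuousAt_id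
    have h3 : Tendsto (fun y : Euc (n + 1) => (τ ‖y‖, ‖y‖⁻¹ • y)) (𝓝 (r • ζ)) (𝓝 (τ r, ζ)) := by
      have h4 := h2.tendsto
      simp only [hnorm, hζ''] at h4
      exact h4
    have h5 : (fun y : Euc (n + 1) => contact (X (τ ‖y‖)) (‖y‖⁻¹ • y)) (r • ζ) =
        (fun q : ℝ × Euc (n + 1) => contact (X q.1) q.2) (τ r, ζ) := by
      simp only [hnorm, hζ'']
    change Tendsto _ _ (𝓝 ((fun y : Euc (n + 1) => contact (X (τ ‖y‖)) (‖y‖⁻¹ • y)) (r • ζ)))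
    rw [h5]
    exact Tendsto.comp (f := fun y : Euc (n + 1) => (τ ‖y‖, ‖y‖⁻¹ • y))
      (g := fun q : ℝ × Euc (n + 1) => contact (X q.1) q.2) h1 h3
  have hc0 : contact (X (τ ‖r • ζ‖)) (‖r • ζ‖⁻¹ • r • ζ) = x := by rw [hζ', hnorm, hx]
  have hsrc : ∀ᶠ y in 𝓝 (r • ζ),
      contact (X (τ ‖y‖)) (‖y‖⁻¹ • y) ∈ (extChartAt (𝓡 n) x).source := by
    refine hcont.eventually ?_
    simp only [hc0]
    exact extChartAt_source_mem_nhds x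
  -- The local inverse of `(r, u) ↦ r ν(τ r, u)`: the radius is `‖y‖`, and the contact point in
  -- direction `y / ‖y‖` at time `τ ‖y‖` has exactly that normal.
  set g : Euc (n + 1) → ℝ × Euc n :=
    fun y => (‖y‖, extChartAt (𝓡 n) x (contact (X (τ ‖y‖)) (‖y‖⁻¹ • y))) with hg
  have hg0 : g (r • ζ) = (r, u₀) := by
    simp only [hg, hc0, hu₀]; rw [hnorm]
  have hgc : ContinuousAt g (r • ζ) := by
    refine continuous_norm.continuousAt.prodMk ?_
    exact ContinuousAt.comp_of_eq (continuousAt_extChartAt x) hcont hc0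
  obtain ⟨N', hN', hNW⟩ := hX.exists_hasFDerivAt_normal ht x
  have hσ : HasFDerivAt (fun q : ℝ × Euc n => (τ q.1, q.2))
      ((τ' • ContinuousLinearMap.fst ℝ ℝ (Euc n)).prod (ContinuousLinearMap.snd ℝ ℝ (Euc n)))
      (r, u₀) :=
    (HasDerivAt.comp_hasFDerivAt (r, u₀) (h₂ := τ) (f := Prod.fst) hτ hasFDerivAt_fst).prodMk
      hasFDerivAt_snd
  have hN2 := HasFDerivAt.comp (r, u₀)
    (g := fun q : ℝ × Euc n => ν q.1 ((extChartAt (𝓡 n) x).symm q.2)) hN' hσ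
  have hNq : ν (τ r) ((extChartAt (𝓡 n) x).symm u₀) = ζ := by rw [hsymm, hνx]
  have hpos := gaussCurvature_pos (hX.embedding _ htI) (hconv.posDef x)
  obtain ⟨L, hL, hdet⟩ := exists_hasFDerivAt_polar (q₀ := (r, u₀)) hr
    (N := (fun q : ℝ × Euc n => ν q.1 ((extChartAt (𝓡 n) x).symm q.2)) ∘
      fun q : ℝ × Euc n => (τ q.1, q.2)) (D := chartD (X (τ r)) x)
    (W := weingarten (X (τ r)) (ν (τ r)) x) (g := g) (ρ := ρ)
    (fderiv_coordMap_injective (hX.embedding _ htI) x)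
    (fun a => by
      simp only [Function.comp_apply]
      rw [hsymm]
      exact inner_fderiv_coordMap_self (hX.normal _ htI) x a) hN2
    (by
      have : ∀ᶠ q : ℝ × Euc n in 𝓝 (r, u₀), τ q.1 ∈ Ico 0 T :=
        (continuous_fst.tendsto (r, u₀)).eventually hτev
      filter_upwards [this] with q hq
      exact (hX.normal _ hq _).1)
    hpos.ne'
    (fun j => by
      rw [← hNW j]
      simp)
    hΞ hΞD
    (by simp only [Function.comp_apply, hNq]; exact hgc)
    (by simp only [Function.comp_apply, hNq]; exact hg0)
    (by
      simp only [Function.comp_apply, hNq]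
      filter_upwards [hsrc, hnormc.eventually hτev, eventually_ne_nhds hne] with y h1 h2 h3
      simp only [hg]
      rw [(extChartAt (𝓡 n) x).left_inv h1, hX.normal_contact hn hα h2 (by
        rw [norm_smul, norm_inv, norm_norm, inv_mul_cancel₀ (norm_ne_zero_iff.mpr h3)]),
        smul_smul, mul_inv_cancel₀ (norm_ne_zero_iff.mpr h3), one_smul])
  simp only [Function.comp_apply, hNq] at hL hdet
  refine ⟨L, hL.congr_of_eventuallyEq ?_, hdet⟩
  filter_upwards [hsrc] with y hy
  simp only [Function.comp_apply, hg]
  rw [(extChartAt (𝓡 n) x).left_inv hy]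

/-- The point of the hypersurface at time `t` with outward normal `ζ`. -/
def normalPoint (X : ℝ → M → Euc (n + 1)) (t : ℝ) (ζ : Euc (n + 1)) : Euc (n + 1) :=
  X t (contact (X t) ζ)

/-- The Gauss curvature at the point of the hypersurface at time `t` with outward normal `ζ`. -/
def curv (X ν : ℝ → M → Euc (n + 1)) (t : ℝ) (ζ : Euc (n + 1)) : ℝ :=
  gaussCurvature (X t) (ν t) (contact (X t) ζ)

theorem IsGaussCurvatureFlow.curv_pos (hn : 1 ≤ n) (hα : 0 < α)
    (hX : IsGaussCurvatureFlow α T X ν) {t : ℝ} (ht : t ∈ Ico 0 T) (ζ : Euc (n + 1)) :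
    0 < curv X ν t ζ :=
  gaussCurvature_pos (hX.embedding t ht) ((hX.strictlyConvex hn hα ht).posDef _)

/-- The radius plays the role of time. The normal component of the time derivative is `-K^α`, and
passing from the sphere to the hypersurface contributes `1 / (t ^ n * K)`. -/
theorem IsGaussCurvatureFlow.exists_hasFDerivAt_swept (hn : 1 ≤ n) (hα : 0 < α)
    (hX : IsGaussCurvatureFlow α T X ν) {t : ℝ} (ht : t ∈ Ioo 0 T) {ζ : Euc (n + 1)}
    (hζ : ‖ζ‖ = 1) :
    ∃ L : Euc (n + 1) →L[ℝ] Euc (n + 1),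
      HasFDerivAt (fun y : Euc (n + 1) => normalPoint X ‖y‖ (‖y‖⁻¹ • y)) L (t • ζ) ∧
      |L.det| = curv X ν t ζ ^ (α - 1) / t ^ n := by
  obtain ⟨Ξ', h1, h2, h3⟩ := hX.exists_hasFDerivAt_chartFlow ht (contact (X t) ζ)
  obtain ⟨L, hL, hdet⟩ := hX.exists_hasFDerivAt_contact hn hα (τ := id) (Y := X) (ρ := 1) ht.1
    (hasDerivAt_id t) ht hζ rfl h1 (fun a => by rw [h2, one_smul]; rfl)
  refine ⟨L, hL, ?_⟩
  have hK := hX.curv_pos hn hα (Ioo_subset_Ico_self ht) ζ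
  have htn : 0 < t ^ n := pow_pos ht.1 n
  rw [h3, hX.normal_contact hn hα (Ioo_subset_Ico_self ht) hζ, real_inner_smul_left,
    real_inner_self_eq_norm_sq, hζ] at hdet
  change L.det * (t ^ n * curv X ν t ζ) = 1 ^ n * (-(curv X ν t ζ ^ α) * 1 ^ 2) at hdet
  rw [one_pow, one_pow, one_mul, mul_one] at hdet
  have hdet' : L.det = -(curv X ν t ζ ^ (α - 1) / t ^ n) := by
    rw [Real.rpow_sub_one hK.ne']
    field_simp
    linarith
  rw [hdet', abs_neg, abs_of_pos (by positivity)]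

/-- Time is frozen and the radius is the cone parameter. The tangential part scales by `r`, the
radial derivative is `X - p`, and the powers of `r` cancel. -/
theorem IsGaussCurvatureFlow.exists_hasFDerivAt_cone (hn : 1 ≤ n) (hα : 0 < α)
    (hX : IsGaussCurvatureFlow α T X ν) {t : ℝ} (ht : t ∈ Ioo 0 T) {ζ : Euc (n + 1)}
    (hζ : ‖ζ‖ = 1) {r : ℝ} (hr : 0 < r) (p : Euc (n + 1)) :
    ∃ L : Euc (n + 1) →L[ℝ] Euc (n + 1),
      HasFDerivAt (fun y : Euc (n + 1) => ‖y‖ • (normalPoint X t (‖y‖⁻¹ • y) - p)) L (r • ζ) ∧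
      L.det = (supportFunction (X t) ζ - ⟪ζ, p⟫) / curv X ν t ζ := by
  have htI := Ioo_subset_Ico_self ht
  set x := contact (X t) ζ with hx
  have hd : HasFDerivAt (coordMap (X t) x) (chartD (X t) x) (extChartAt (𝓡 n) x x) :=
    ((contDiffAt_coordMap (hX.embedding t htI).contMDiff x).differentiableAt
      (by simp)).hasFDerivAt
  have h1 : HasFDerivAt (fun q : ℝ × Euc n => q.1 • (coordMap (X t) x q.2 - p)) _
      (r, extChartAt (𝓡 n) x x) :=
    hasFDerivAt_fst.smul ((HasFDerivAt.comp (r, extChartAt (𝓡 n) x x) (g := coordMap (X t) x)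
      (f := Prod.snd) hd hasFDerivAt_snd).sub_const p)
  have hx0 : coordMap (X t) x (extChartAt (𝓡 n) x x) = X t x := by
    simp only [coordMap, Function.comp_apply]; rw [extChartAt_to_inv x]
  obtain ⟨L, hL, hdet⟩ := hX.exists_hasFDerivAt_contact hn hα (τ := fun _ => t)
    (Y := fun r y => r • (X t y - p)) (ρ := r) hr
    (hasDerivAt_const r t) ht hζ hx h1 (fun a => by simp)
  refine ⟨L, hL, ?_⟩
  have hK := hX.curv_pos hn hα htI ζ
  have hrn : 0 < r ^ n := pow_pos hr n
  have e : supportFunction (X t) ζ - ⟪ζ, p⟫ = ⟪X t x - p, ζ⟫ := by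
    rw [supportFunction_eq_contact (hX.continuous htI), inner_sub_left, real_inner_comm,
      real_inner_comm ζ p]
  change L.det * (r ^ n * curv X ν t ζ) = _ at hdet
  simp only [_root_.add_apply, _root_.smul_apply, ContinuousLinearMap.smulRight_apply,
    ContinuousLinearMap.coe_comp, Function.comp_apply, ContinuousLinearMap.coe_snd',
    ContinuousLinearMap.coe_fst', map_zero, smul_zero, zero_add, one_smul, hx0] at hdet
  rw [e, eq_div_iff hK.ne']
  have h5 : r ^ n * (L.det * curv X ν t ζ) = r ^ n * ⟪X t x - p, ζ⟫ := by linarith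
  exact mul_left_cancel₀ hrn.ne' h5

end NormalMap

/-! ### Integration in polar coordinates -/

section Polar

open scoped ENNReal

/-- The surface measure of the unit sphere. -/
abbrev sphMeasure (n : ℕ) : Measure (Metric.sphere (0 : Euc (n + 1)) 1) :=
  (volume : Measure (Euc (n + 1))).toSphere

theorem polar_lintegral {n : ℕ} (G : Euc (n + 1) → ℝ≥0∞) :
    ∫⁻ y, G y = ∫⁻ p : Metric.sphere (0 : Euc (n + 1)) 1 × Ioi (0 : ℝ),
      G ((p.2 : ℝ) • (p.1 : Euc (n + 1))) ∂((sphMeasure n).prod (Measure.volumeIoiPow n)) := by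
  have h := (volume : Measure (Euc (n + 1))).measurePreserving_homeomorphUnitSphereProd
  have hd : Module.finrank ℝ (Euc (n + 1)) - 1 = n := by simp
  rw [hd] at h
  rw [← h.lintegral_comp_emb (Homeomorph.measurableEmbedding _)]
  have h2 : ∀ y : ({0}ᶜ : Set (Euc (n + 1))),
      ((homeomorphUnitSphereProd (Euc (n + 1)) y).2 : ℝ) •
        ((homeomorphUnitSphereProd (Euc (n + 1)) y).1 : Euc (n + 1)) = y := fun y => by
    have h3 : ‖(y : Euc (n + 1))‖ ≠ 0 := norm_ne_zero_iff.mpr y.2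
    simp [smul_smul, h3]
  simp only [h2]
  rw [lintegral_subtype_comap (measurableSet_singleton _).compl, restrict_compl_singleton]

theorem lintegral_volumeIoiPow {n : ℕ} {g : ℝ → ℝ≥0∞} (hg : Measurable g) :
    ∫⁻ r : Ioi (0 : ℝ), g r ∂(Measure.volumeIoiPow n) =
      ∫⁻ r in Ioi (0 : ℝ), ENNReal.ofReal (r ^ n) * g r := by
  rw [Measure.volumeIoiPow, lintegral_withDensity_eq_lintegral_mul]
  · exact lintegral_subtype_comap measurableSet_Ioi fun r : ℝ => ENNReal.ofReal (r ^ n) * g r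
  · fun_prop
  · exact hg.comp measurable_subtype_coe

theorem polar_lintegral_swap {n : ℕ} {G : Euc (n + 1) → ℝ≥0∞} (hG : Measurable G) :
    ∫⁻ y, G y = ∫⁻ r in Ioi (0 : ℝ), ENNReal.ofReal (r ^ n) *
      ∫⁻ ζ, G (r • (ζ : Euc (n + 1))) ∂(sphMeasure n) := by
  have hm : Measurable fun p : Metric.sphere (0 : Euc (n + 1)) 1 × ℝ =>
      G (p.2 • (p.1 : Euc (n + 1))) := hG.comp (by fun_prop)
  rw [polar_lintegral, lintegral_prod_symm]
  · exact lintegral_volumeIoiPow (g := fun r => ∫⁻ ζ, G (r • (ζ : Euc (n + 1))) ∂(sphMeasure n))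
      hm.lintegral_prod_left'
  · exact (hm.comp (g := fun p : Metric.sphere (0 : Euc (n + 1)) 1 × ℝ =>
      G (p.2 • (p.1 : Euc (n + 1)))) (f := fun p : Metric.sphere (0 : Euc (n + 1)) 1 × Ioi (0 : ℝ) =>
        (p.1, (p.2 : ℝ))) (by fun_prop)).aemeasurable

theorem lintegral_ball_radial {n : ℕ} {F : Euc (n + 1) → ℝ≥0∞}
    (hF : Measurable fun ζ : Metric.sphere (0 : Euc (n + 1)) 1 => F ζ) :
    ∫⁻ y in Metric.ball (0 : Euc (n + 1)) 1, F (‖y‖⁻¹ • y) =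
      (∫⁻ ζ, F ζ ∂(sphMeasure n)) * ENNReal.ofReal (1 / (n + 1)) := by
  rw [← lintegral_indicator Metric.isOpen_ball.measurableSet, polar_lintegral]
  have h : ∀ p : Metric.sphere (0 : Euc (n + 1)) 1 × Ioi (0 : ℝ),
      (Metric.ball (0 : Euc (n + 1)) 1).indicator (fun y => F (‖y‖⁻¹ • y))
        ((p.2 : ℝ) • (p.1 : Euc (n + 1))) =
      F p.1 * (Iio (⟨1, mem_Ioi.mpr one_pos⟩ : Ioi (0 : ℝ))).indicator 1 p.2 := by
    rintro ⟨ζ, r⟩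
    have hr : (0 : ℝ) < r := r.2
    have hζ : ‖(ζ : Euc (n + 1))‖ = 1 := by simp
    have hn : ‖(r : ℝ) • (ζ : Euc (n + 1))‖ = r := by
      rw [norm_smul, hζ, mul_one, Real.norm_eq_abs, abs_of_pos hr]
    by_cases h1 : (r : ℝ) < 1
    · rw [indicator_of_mem, indicator_of_mem]
      · rw [hn, smul_smul, inv_mul_cancel₀ hr.ne', one_smul]; simp
      · exact h1
      · rw [mem_ball_zero_iff, hn]; exact h1
    · rw [indicator_of_notMem, indicator_of_notMem, mul_zero]
      · exact h1
      · rw [mem_ball_zero_iff, hn]; exact h1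
  simp only [h]
  rw [lintegral_prod_mul hF.aemeasurable (measurable_one.indicator measurableSet_Iio).aemeasurable,
    lintegral_indicator_one measurableSet_Iio, Measure.volumeIoiPow_apply_Iio]
  simp

theorem continuous_slice_sphere {n : ℕ} {W : Type*} [TopologicalSpace W] {I : Set ℝ}
    {H : ℝ × Euc (n + 1) → W} (hH : ContinuousOn H (I ×ˢ Metric.sphere 0 1)) {t : ℝ} (ht : t ∈ I) :
    Continuous fun ζ : Metric.sphere (0 : Euc (n + 1)) 1 => H (t, ζ) :=
  hH.comp_continuous (by fun_prop) fun ζ => ⟨ht, ζ.2⟩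

theorem continuousOn_integral_sphere {n : ℕ} {a b : ℝ} {H : ℝ × Euc (n + 1) → ℝ}
    (hH : ContinuousOn H (Icc a b ×ˢ Metric.sphere 0 1)) :
    ContinuousOn (fun r => ∫ ζ : Metric.sphere (0 : Euc (n + 1)) 1, H (r, ζ) ∂(sphMeasure n))
      (Icc a b) := by
  obtain ⟨C, hC⟩ := (isCompact_Icc.prod (isCompact_sphere (0 : Euc (n + 1)) 1)).exists_bound_of_continuousOn hH
  refine continuousOn_of_dominated (bound := fun _ => C) ?_ ?_ (integrable_const _) ?_
  · exact fun r hr => (continuous_slice_sphere hH hr).aestronglyMeasurable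
  · exact fun r hr => ae_of_all _ fun ζ => hC _ ⟨hr, ζ.2⟩
  · exact ae_of_all _ fun ζ => hH.comp (by fun_prop) fun r hr => ⟨hr, ζ.2⟩

/-- Dividing by `‖y‖ ^ n` cancels the polar weight. A shell whose radius encodes time thus
integrates as a plain double integral over time and normals, matching the factor in the Jacobian of
the swept map. -/
theorem lintegral_shell {n : ℕ} {a b : ℝ} (ha : 0 < a) (hab : a ≤ b) {H : ℝ × Euc (n + 1) → ℝ}
    (hH : ContinuousOn H (Icc a b ×ˢ Metric.sphere 0 1))
    (hH0 : ∀ q ∈ Icc a b ×ˢ Metric.sphere 0 1, 0 ≤ H q) :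
    ∫⁻ y in {y : Euc (n + 1) | ‖y‖ ∈ Icc a b},
      ENNReal.ofReal (H (‖y‖, ‖y‖⁻¹ • y) / ‖y‖ ^ n) =
    ENNReal.ofReal (∫ r in a..b, ∫ ζ : Metric.sphere (0 : Euc (n + 1)) 1,
      H (r, ζ) ∂(sphMeasure n)) := by
  set Sh : Set (Euc (n + 1)) := {y | ‖y‖ ∈ Icc a b} with hSh
  have hShc : IsClosed Sh := isClosed_Icc.preimage continuous_norm
  have hne : ∀ y ∈ Sh, ‖y‖ ≠ 0 := fun y hy => (ha.trans_le hy.1).ne'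
  have hG : Measurable (Sh.indicator fun y : Euc (n + 1) =>
      ENNReal.ofReal (H (‖y‖, ‖y‖⁻¹ • y) / ‖y‖ ^ n)) := by
    rw [← piecewise_eq_indicator]
    refine ContinuousOn.measurable_piecewise ?_ continuousOn_const hShc.measurableSet
    refine ENNReal.continuous_ofReal.comp_continuousOn ?_
    refine ContinuousOn.div (hH.comp (t := Icc a b ×ˢ Metric.sphere 0 1) ?_ ?_) (by fun_prop)
      fun y hy => pow_ne_zero n (hne y hy)
    · exact continuousOn_id.norm.prodMk ((continuousOn_id.norm.inv₀ hne).smul continuousOn_id)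
    · refine fun y hy => ⟨hy, ?_⟩
      rw [mem_sphere_zero_iff_norm, norm_smul, norm_inv, norm_norm, inv_mul_cancel₀ (hne y hy)]
  rw [← lintegral_indicator hShc.measurableSet, polar_lintegral_swap hG]
  have h1 : ∀ r ∈ Ioi (0 : ℝ), ENNReal.ofReal (r ^ n) * ∫⁻ ζ : Metric.sphere (0 : Euc (n + 1)) 1,
      Sh.indicator (fun y : Euc (n + 1) => ENNReal.ofReal (H (‖y‖, ‖y‖⁻¹ • y) / ‖y‖ ^ n))
        (r • (ζ : Euc (n + 1))) ∂(sphMeasure n) =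
      (Icc a b).indicator (fun r => ENNReal.ofReal
        (∫ ζ : Metric.sphere (0 : Euc (n + 1)) 1, H (r, ζ) ∂(sphMeasure n))) r := by
    intro r hr
    have hnorm : ∀ ζ : Metric.sphere (0 : Euc (n + 1)) 1, ‖r • (ζ : Euc (n + 1))‖ = r := fun ζ => by
      rw [norm_smul, Real.norm_eq_abs, abs_of_pos hr]; simp
    by_cases hrab : r ∈ Icc a b
    · have hin : ∀ ζ : Metric.sphere (0 : Euc (n + 1)) 1, Sh.indicator (fun y : Euc (n + 1) =>
          ENNReal.ofReal (H (‖y‖, ‖y‖⁻¹ • y) / ‖y‖ ^ n)) (r • (ζ : Euc (n + 1))) =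
          ENNReal.ofReal (H (r, ζ) / r ^ n) := fun ζ => by
        rw [indicator_of_mem, hnorm, smul_smul, inv_mul_cancel₀ (ne_of_gt hr), one_smul]
        rw [hSh, mem_ofPred_eq, hnorm]; exact hrab
      have hrn : 0 < r ^ n := pow_pos hr n
      rw [indicator_of_mem hrab, lintegral_congr hin, ← lintegral_const_mul' _ _ ENNReal.ofReal_ne_top,
        ofReal_integral_eq_lintegral_ofReal
          ((continuous_slice_sphere hH hrab).integrable_of_hasCompactSupport
            (HasCompactSupport.of_compactSpace _))
          (ae_of_all _ fun ζ => hH0 _ ⟨hrab, ζ.2⟩)]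
      refine lintegral_congr fun ζ => ?_
      rw [← ENNReal.ofReal_mul hrn.le, mul_div_cancel₀ _ hrn.ne']
    · rw [indicator_of_notMem hrab]
      have hout : ∀ ζ : Metric.sphere (0 : Euc (n + 1)) 1, Sh.indicator (fun y : Euc (n + 1) =>
          ENNReal.ofReal (H (‖y‖, ‖y‖⁻¹ • y) / ‖y‖ ^ n)) (r • (ζ : Euc (n + 1))) = 0 := fun ζ => by
        rw [indicator_of_notMem]
        rw [hSh, mem_ofPred_eq, hnorm]; exact hrab
      rw [lintegral_congr hout, lintegral_zero, mul_zero]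
  rw [setLIntegral_congr_fun measurableSet_Ioi h1, lintegral_indicator measurableSet_Icc,
    Measure.restrict_restrict measurableSet_Icc,
    show Icc a b ∩ Ioi 0 = Icc a b from inter_eq_left.mpr fun r hr => ha.trans_le (mem_Icc.mp hr).1,
    intervalIntegral.integral_of_le hab, ← integral_Icc_eq_integral_Ioc,
    ofReal_integral_eq_lintegral_ofReal
      ((continuousOn_integral_sphere hH).integrableOn_compact isCompact_Icc)]
  filter_upwards [ae_restrict_mem measurableSet_Icc] with r hr
  exact integral_nonneg fun ζ => hH0 _ ⟨hr, ζ.2⟩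

end Polar

/-! ### Compactness of convex hulls and the body as intersection of half-spaces -/

section Hull

/-- By Carathéodory's theorem at most `finrank + 1` points are needed, so the hull is a continuous
image of a simplex times a power of `s`; shorter combinations are padded with zero weights. -/
theorem isCompact_convexHull_of_isCompact {E : Type*} [NormedAddCommGroup E] [NormedSpace ℝ E]
    [FiniteDimensional ℝ E] {s : Set E} (hs : IsCompact s) : IsCompact (convexHull ℝ s) := by
  set m := Module.finrank ℝ E + 1 with hm
  set f : (Fin m → ℝ) × (Fin m → E) → E := fun q => ∑ i, q.1 i • q.2 i with hf
  have hK : IsCompact (stdSimplex ℝ (Fin m) ×ˢ univ.pi fun _ : Fin m => s) :=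
    (isCompact_stdSimplex ℝ (Fin m)).prod (isCompact_univ_pi fun _ => hs)
  have hfc : Continuous f := by fun_prop
  have heq : convexHull ℝ s = f '' (stdSimplex ℝ (Fin m) ×ˢ univ.pi fun _ : Fin m => s) := by
    refine Subset.antisymm (fun x hx => ?_) ?_
    · obtain ⟨ι, _, z, w, hz, haff, hw, hw1, hx⟩ := eq_pos_convex_span_of_mem_convexHull hx
      have hcard : Fintype.card ι ≤ Fintype.card (Fin m) := by
        rw [Fintype.card_fin]
        exact haff.card_le_finrank_succ.trans
          (Nat.succ_le_succ (Submodule.finrank_le _))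
      obtain ⟨e⟩ := Function.Embedding.nonempty_of_card_le hcard
      obtain ⟨i₀⟩ : Nonempty ι := by
        by_contra h
        rw [not_nonempty_iff] at h
        simp at hw1
      refine ⟨(Function.extend e w 0, Function.extend e z fun _ => z i₀), ⟨⟨fun j => ?_, ?_⟩, ?_⟩, ?_⟩
      · by_cases hj : ∃ i, e i = j
        · obtain ⟨i, rfl⟩ := hj
          simpa [e.injective.extend_apply] using (hw i).le
        · simp [Function.extend_apply' _ _ _ hj]
      · rw [← hw1]
        symm
        refine Fintype.sum_of_injective e e.injective _ _ (fun j hj => ?_) fun i => ?_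
        · simp [Function.extend_apply' _ _ _ hj]
        · simp [e.injective.extend_apply]
      · intro j _
        by_cases hj : ∃ i, e i = j
        · obtain ⟨i, rfl⟩ := hj
          simpa [e.injective.extend_apply] using hz ⟨i, rfl⟩
        · simpa [Function.extend_apply' _ _ _ hj] using hz ⟨i₀, rfl⟩
      · rw [← hx]
        symm
        refine Fintype.sum_of_injective e e.injective _ _ (fun j hj => ?_) fun i => ?_
        · simp [Function.extend_apply' _ _ _ hj]
        · simp [e.injective.extend_apply]
    · rintro _ ⟨⟨w, z⟩, ⟨hw, hz⟩, rfl⟩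
      exact (convex_convexHull ℝ s).sum_mem (fun i _ => hw.1 i) hw.2
        fun i _ => subset_convexHull ℝ s (hz i (mem_univ _))
  rw [heq]
  exact hK.image hfc

variable {n : ℕ} {M : Type*} [TopologicalSpace M] [CompactSpace M]

/-- The convex body bounded by the hypersurface. -/
def body (X : M → Euc (n + 1)) : Set (Euc (n + 1)) := convexHull ℝ (range X)

theorem isCompact_body {X : M → Euc (n + 1)} (hX : Continuous X) : IsCompact (body X) :=
  isCompact_convexHull_of_isCompact (isCompact_range hX)

theorem enclosedVolume_eq {X : M → Euc (n + 1)} : enclosedVolume X = volume.real (body X) := rfl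

theorem volume_body {X : M → Euc (n + 1)} (hX : Continuous X) :
    volume (body X) = ENNReal.ofReal (enclosedVolume X) := by
  rw [enclosedVolume_eq, Measure.real, ENNReal.ofReal_toReal (isCompact_body hX).measure_lt_top.ne]

variable [Nonempty M]

theorem inner_le_of_mem_body {X : M → Euc (n + 1)} (hX : Continuous X) {p : Euc (n + 1)}
    (hp : p ∈ body X) (ζ : Euc (n + 1)) : ⟪ζ, p⟫ ≤ supportFunction X ζ := by
  have h : body X ⊆ {y | ⟪ζ, y⟫ ≤ supportFunction X ζ} := by
    refine convexHull_min ?_ ?_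
    · rintro _ ⟨x, rfl⟩
      exact inner_le_supportFunction hX ζ x
    · exact convex_halfSpace_le (innerₛₗ ℝ ζ).isLinear _
  exact h hp

theorem mem_body_iff {X : M → Euc (n + 1)} (hX : Continuous X) {p : Euc (n + 1)} :
    p ∈ body X ↔ ∀ ζ, ‖ζ‖ = 1 → ⟪ζ, p⟫ ≤ supportFunction X ζ := by
  refine ⟨fun hp ζ _ => inner_le_of_mem_body hX hp ζ, fun h => ?_⟩
  by_contra hp
  obtain ⟨f, u, hfu, hup⟩ := geometric_hahn_banach_closed_point (convex_convexHull ℝ (range X))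
    (isCompact_body hX).isClosed hp
  set w := (InnerProductSpace.toDual ℝ (Euc (n + 1))).symm f with hw
  have hfw : ∀ y, f y = ⟪w, y⟫ := fun y => by
    rw [hw, InnerProductSpace.toDual_symm_apply]
  have hlt : ∀ x, ⟪w, X x⟫ < ⟪w, p⟫ := fun x => by
    rw [← hfw, ← hfw]
    exact (hfu _ (subset_convexHull ℝ _ ⟨x, rfl⟩)).trans hup
  have hw0 : w ≠ 0 := by
    rintro h0
    obtain ⟨x⟩ := ‹Nonempty M›
    simpa [h0] using hlt x
  have hwn : 0 < ‖w‖ := norm_pos_iff.mpr hw0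
  have h1 := h (‖w‖⁻¹ • w) (by rw [norm_smul, norm_inv, norm_norm, inv_mul_cancel₀ hwn.ne'])
  rw [supportFunction_eq_contact hX, real_inner_smul_left, real_inner_smul_left] at h1
  have h2 := (mul_le_mul_iff_right₀ (inv_pos.mpr hwn)).mp h1
  exact absurd h2 (not_le.mpr (hlt _))

theorem ball_subset_body {X : M → Euc (n + 1)} (hX : Continuous X) {p : Euc (n + 1)} {c : ℝ}
    (hc : ∀ ζ, ‖ζ‖ = 1 → c ≤ supportFunction X ζ - ⟪ζ, p⟫) : Metric.ball p c ⊆ body X :=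
  fun y hy => (mem_body_iff hX).mpr fun ζ hζ => by
    have h1 := hc ζ hζ
    have h2 : ⟪ζ, y - p⟫ ≤ ‖y - p‖ := by
      have := real_inner_le_norm ζ (y - p)
      rwa [hζ, one_mul] at this
    rw [Metric.mem_ball, dist_eq_norm] at hy
    rw [inner_sub_right] at h2
    linarith

theorem body_mono {X Y : M → Euc (n + 1)} (hX : Continuous X) (hY : Continuous Y)
    (h : ∀ ζ, ‖ζ‖ = 1 → supportFunction X ζ ≤ supportFunction Y ζ) : body X ⊆ body Y :=
  fun _ hp => (mem_body_iff hY).mpr fun ζ hζ => (inner_le_of_mem_body hX hp ζ).trans (h ζ hζ)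

end Hull

/-! ### Swept volume, cone volume and interior points -/

section Area

attribute [local instance 2000] chartedSpaceSelf

variable {n : ℕ} {M : Type*} [TopologicalSpace M] [CompactSpace M]
  [ChartedSpace (EuclideanSpace ℝ (Fin n)) M] [IsManifold (𝓡 n) ∞ M]
  [T2Space M] [Nonempty M] {α T : ℝ} {X ν : ℝ → M → Euc (n + 1)}

theorem IsGaussCurvatureFlow.continuousOn_contact (hn : 1 ≤ n) (hα : 0 < α)
    (hX : IsGaussCurvatureFlow α T X ν) :
    ContinuousOn (fun q : ℝ × Euc (n + 1) => contact (X q.1) q.2)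
      (Ico 0 T ×ˢ Metric.sphere 0 1) := by
  rintro ⟨t, ζ⟩ ⟨ht, hζ⟩
  exact (hX.continuousWithinAt_contact hn ht (hX.strictlyConvex hn hα ht)
    (mem_sphere_zero_iff_norm.mp hζ)).mono (prod_mono_right (subset_univ _))

/-- Recovered from the continuous speed `K^α` by the power `1 / α`, which is legitimate because `K >
0`. -/
theorem IsGaussCurvatureFlow.continuousOn_curv (hn : 1 ≤ n) (hα : 0 < α)
    (hX : IsGaussCurvatureFlow α T X ν) :
    ContinuousOn (fun q : ℝ × Euc (n + 1) => curv X ν q.1 q.2)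
      (Ico 0 T ×ˢ Metric.sphere 0 1) := by
  have h := hX.continuousOn_speed.comp
    (f := fun q : ℝ × Euc (n + 1) => (q.1, contact (X q.1) q.2))
    (continuousOn_fst.prodMk (hX.continuousOn_contact hn hα)) fun q hq => ⟨hq.1, mem_univ _⟩
  have h2 : ContinuousOn (fun q : ℝ × Euc (n + 1) => curv X ν q.1 q.2 ^ α)
    (Ico 0 T ×ˢ Metric.sphere 0 1) := h
  refine (h2.rpow_const (p := α⁻¹) fun q _ => Or.inr (inv_nonneg.mpr hα.le)).congr ?_
  rintro ⟨t, ζ⟩ ⟨ht, -⟩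
  exact (Real.rpow_rpow_inv (hX.curv_pos hn hα ht ζ).le hα.ne').symm

theorem IsGaussCurvatureFlow.supportFunction_antitone (hn : 1 ≤ n) (hα : 0 < α)
    (hX : IsGaussCurvatureFlow α T X ν) {ζ : Euc (n + 1)} (hζ : ‖ζ‖ = 1) :
    AntitoneOn (fun t => supportFunction (X t) ζ) (Ico 0 T) := by
  have hd : ∀ t ∈ Ico 0 T, HasDerivWithinAt (fun s => supportFunction (X s) ζ)
      (-speed α X ν t (contact (X t) ζ)) (Ico 0 T) t := fun t ht =>
    hX.hasDerivWithinAt_supportFunction hn ht (hX.strictlyConvex hn hα ht) hζ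
  refine antitoneOn_of_hasDerivWithinAt_nonpos (convex_Ico 0 T)
    (fun t ht => (hd t ht).continuousWithinAt)
    (fun t ht => (hd t (interior_subset ht)).mono interior_subset) fun t ht => ?_
  exact neg_nonpos.mpr (hX.speed_pos (interior_subset ht)
    (hX.strictlyConvex hn hα (interior_subset ht)) _).le

theorem IsGaussCurvatureFlow.body_antitone (hn : 1 ≤ n) (hα : 0 < α)
    (hX : IsGaussCurvatureFlow α T X ν) {s t : ℝ} (hs : s ∈ Ico 0 T) (ht : t ∈ Ico 0 T)
    (hst : s ≤ t) : body (X t) ⊆ body (X s) :=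
  body_mono (hX.continuous ht) (hX.continuous hs) fun _ hζ =>
    hX.supportFunction_antitone hn hα hζ hs ht hst

theorem IsGaussCurvatureFlow.enclosedVolume_antitone (hn : 1 ≤ n) (hα : 0 < α)
    (hX : IsGaussCurvatureFlow α T X ν) :
    AntitoneOn (fun t => enclosedVolume (X t)) (Ico 0 T) := fun _ hs _ ht hst =>
  measureReal_mono (hX.body_antitone hn hα hs ht hst)
    (isCompact_body (hX.continuous hs)).measure_lt_top.ne

/-- A point of the body lying on the supporting hyperplane with normal `ζ` is the point with
normal `ζ`. -/
theorem IsGaussCurvatureFlow.eq_normalPoint (hn : 1 ≤ n) (hα : 0 < α)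
    (hX : IsGaussCurvatureFlow α T X ν) {t : ℝ} (ht : t ∈ Ico 0 T) {p ζ : Euc (n + 1)}
    (hp : ∀ η, ‖η‖ = 1 → ⟪η, p⟫ ≤ supportFunction (X t) η) (hζ : ‖ζ‖ = 1)
    (hpζ : supportFunction (X t) ζ ≤ ⟪ζ, p⟫) : p = normalPoint X t ζ := by
  have hconv := hX.strictlyConvex hn hα ht
  obtain ⟨δ, hδ, hsc⟩ := hX.stronglyConvex ht hconv
  have hνc := hX.normal_contact hn hα ht hζ
  refine eq_of_supporting (hX.embedding t ht) (hX.normal t ht) (hX.continuous_normal ht)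
    hconv.supporting (x₀ := contact (X t) ζ) (Eventually.of_forall fun y hy => ?_) (fun x => ?_) ?_
  · refine (hsc _ y).trans_lt ?_
    have : 0 < ‖X t y - X t (contact (X t) ζ)‖ := norm_pos_iff.mpr
      (sub_ne_zero.mpr fun h => hy ((hX.embedding t ht).isEmbedding.injective h))
    nlinarith [mul_pos hδ (pow_pos this 2)]
  · have h1 := hp (ν t x) (hX.normal t ht x).1
    rw [supportFunction_normal hconv x] at h1
    rw [inner_sub_left, real_inner_comm, real_inner_comm (ν t x) (X t x)]
    linarith
  · have h1 := hp ζ hζ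
    rw [supportFunction_eq_contact (hX.continuous ht)] at h1 hpζ
    rw [hνc, inner_sub_left, real_inner_comm, real_inner_comm ζ (X t _)]
    linarith

/-- Points that leave the body in the time interval `[a, b]` are swept by the hypersurface. -/
theorem IsGaussCurvatureFlow.body_sdiff_subset (hn : 1 ≤ n) (hα : 0 < α)
    (hX : IsGaussCurvatureFlow α T X ν) {a b : ℝ} (ha : 0 < a) (hab : a ≤ b) (hb : b < T) :
    body (X a) \ body (X b) ⊆ (fun y : Euc (n + 1) => normalPoint X ‖y‖ (‖y‖⁻¹ • y)) ''
      {y | ‖y‖ ∈ Icc a b} := by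
  rintro p ⟨hpa, hpb⟩
  have hI : Icc a b ⊆ Ico 0 T := fun t ht => ⟨ha.le.trans ht.1, ht.2.trans_lt hb⟩
  have hSc : ContinuousOn (fun q : ℝ × Euc (n + 1) => supportFunction (X q.1) q.2 - ⟪q.2, p⟫)
      (Icc a b ×ˢ Metric.sphere 0 1) :=
    (hX.continuousOn_supportFunction hn hI fun t ht => hX.strictlyConvex hn hα (hI ht)).sub
      (by fun_prop)
  -- Take the earliest time `t` at which some supporting half-space, with normal `ζ`, no longer
  -- contains `p` in its interior. By continuity `p` still satisfies every support inequality at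
  -- time `t`, so it is the boundary point with normal `ζ`.
  set Z := (Icc a b ×ˢ Metric.sphere (0 : Euc (n + 1)) 1) ∩
    (fun q : ℝ × Euc (n + 1) => supportFunction (X q.1) q.2 - ⟪q.2, p⟫) ⁻¹' Iic 0 with hZ
  have hcpt : IsCompact (Icc a b ×ˢ Metric.sphere (0 : Euc (n + 1)) 1) :=
    isCompact_Icc.prod (isCompact_sphere _ _)
  have hZc : IsCompact Z :=
    hcpt.of_isClosed_subset (hSc.preimage_isClosed_of_isClosed hcpt.isClosed isClosed_Iic)
      inter_subset_left
  have hZne : Z.Nonempty := by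
    rw [mem_body_iff (hX.continuous (hI (right_mem_Icc.mpr hab)))] at hpb
    push Not at hpb
    obtain ⟨ζ, hζ, h⟩ := hpb
    exact ⟨(b, ζ), ⟨right_mem_Icc.mpr hab, mem_sphere_zero_iff_norm.mpr hζ⟩, (sub_neg.mpr h).le⟩
  obtain ⟨⟨t, ζ⟩, ⟨⟨ht, hζ⟩, htζ⟩, hmin⟩ := hZc.exists_isMinOn hZne continuous_fst.continuousOn
  change t ∈ Icc a b at ht
  have hζ1 : ‖ζ‖ = 1 := mem_sphere_zero_iff_norm.mp hζ
  have htpos : 0 < t := ha.trans_le ht.1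
  have hin : ∀ η, ‖η‖ = 1 → ⟪η, p⟫ ≤ supportFunction (X t) η := fun η hη => by
    rcases eq_or_lt_of_le ht.1 with h | h
    · rw [← h]; exact inner_le_of_mem_body (hX.continuous (hI (left_mem_Icc.mpr hab))) hpa η
    · have hc : ContinuousOn (fun s => supportFunction (X s) η - ⟪η, p⟫) (Icc a t) :=
        hSc.comp (f := fun s => (s, η)) (by fun_prop) fun s hs =>
          ⟨⟨hs.1, hs.2.trans ht.2⟩, mem_sphere_zero_iff_norm.mpr hη⟩
      have hlt : ∀ s ∈ Ico a t, 0 ≤ supportFunction (X s) η - ⟪η, p⟫ := fun s hs => by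
        by_contra hneg
        have := isMinOn_iff.mp hmin (s, η) ⟨⟨⟨hs.1, hs.2.le.trans ht.2⟩,
          mem_sphere_zero_iff_norm.mpr hη⟩, (not_le.mp hneg).le⟩
        exact absurd hs.2 (not_lt.mpr this)
      have h1 : t ∈ closure (Ico a t) := by
        rw [closure_Ico h.ne]; exact right_mem_Icc.mpr h.le
      have h2 := ContinuousWithinAt.closure_le h1 continuousWithinAt_const
        ((hc t (right_mem_Icc.mpr h.le)).mono Ico_subset_Icc_self) hlt
      linarith
  refine ⟨t • ζ, ?_, ?_⟩
  · rw [mem_ofPred_eq, norm_smul, hζ1, mul_one, Real.norm_eq_abs, abs_of_pos htpos]; exact ht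
  · simp only [norm_smul, hζ1, mul_one, Real.norm_eq_abs, abs_of_pos htpos, smul_smul]
    rw [inv_mul_cancel₀ htpos.ne', one_smul]
    refine (hX.eq_normalPoint hn hα (hI ht) hin hζ1 ?_).symm
    have : supportFunction (X t) ζ - ⟪ζ, p⟫ ≤ 0 := htζ
    linarith

/-- The integral of the speed over the hypersurface at time `t`, as an integral over normals. -/
def sweepRate (α : ℝ) (X ν : ℝ → M → Euc (n + 1)) (t : ℝ) : ℝ :=
  ∫ ζ : Metric.sphere (0 : Euc (n + 1)) 1, curv X ν t ζ ^ (α - 1) ∂(sphMeasure n)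

theorem IsGaussCurvatureFlow.continuousOn_curv_rpow (hn : 1 ≤ n) (hα : 0 < α)
    (hX : IsGaussCurvatureFlow α T X ν) (β : ℝ) :
    ContinuousOn (fun q : ℝ × Euc (n + 1) => curv X ν q.1 q.2 ^ β)
      (Ico 0 T ×ˢ Metric.sphere 0 1) :=
  (hX.continuousOn_curv hn hα).rpow_const fun q hq =>
    Or.inl (hX.curv_pos hn hα hq.1 q.2).ne'

/-- The points lost between `a` and `b` are covered by the image of a shell under the swept map, and
the volume of an image is at most the integral of the absolute Jacobian, with no injectivity
required. The upper bound is all that the entropy argument uses. -/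
theorem IsGaussCurvatureFlow.enclosedVolume_sub_le (hn : 1 ≤ n) (hα : 0 < α)
    (hX : IsGaussCurvatureFlow α T X ν) {a b : ℝ} (ha : 0 < a) (hab : a ≤ b) (hb : b < T) :
    enclosedVolume (X a) - enclosedVolume (X b) ≤ ∫ t in a..b, sweepRate α X ν t := by
  have hI : Icc a b ⊆ Ico 0 T := fun t ht => ⟨ha.le.trans ht.1, ht.2.trans_lt hb⟩
  set Sh : Set (Euc (n + 1)) := {y | ‖y‖ ∈ Icc a b} with hSh
  have hShm : MeasurableSet Sh := (isClosed_Icc.preimage continuous_norm).measurableSet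
  set Ψ : Euc (n + 1) → Euc (n + 1) := fun y => normalPoint X ‖y‖ (‖y‖⁻¹ • y) with hΨ
  have hder : ∀ y ∈ Sh, ∃ L : Euc (n + 1) →L[ℝ] Euc (n + 1), HasFDerivAt Ψ L y ∧
      |L.det| = curv X ν ‖y‖ (‖y‖⁻¹ • y) ^ (α - 1) / ‖y‖ ^ n := fun y hy => by
    have hy0 : 0 < ‖y‖ := ha.trans_le hy.1
    have h := hX.exists_hasFDerivAt_swept hn hα (t := ‖y‖) ⟨hy0, hy.2.trans_lt hb⟩
      (ζ := ‖y‖⁻¹ • y) (by rw [norm_smul, norm_inv, norm_norm, inv_mul_cancel₀ hy0.ne'])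
    rwa [smul_smul, mul_inv_cancel₀ hy0.ne', one_smul] at h
  choose! L hL hdet using hder
  have hle := addHaar_image_le_lintegral_abs_det_fderiv volume hShm
    fun y hy => (hL y hy).hasFDerivWithinAt
  have hcongr : ∫⁻ y in Sh, ENNReal.ofReal |(L y).det| =
      ∫⁻ y in Sh, ENNReal.ofReal (curv X ν ‖y‖ (‖y‖⁻¹ • y) ^ (α - 1) / ‖y‖ ^ n) :=
    setLIntegral_congr_fun hShm fun y hy => by simp only [hdet y hy]
  have hcont := (hX.continuousOn_curv_rpow hn hα (α - 1)).mono
    (prod_mono_left hI : Icc a b ×ˢ Metric.sphere (0 : Euc (n + 1)) 1 ⊆ _)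
  have hshell := lintegral_shell ha hab hcont fun q hq =>
    Real.rpow_nonneg (hX.curv_pos hn hα (hI hq.1) q.2).le _
  rw [hcongr, hshell] at hle
  have hVa := isCompact_body (hX.continuous (hI (left_mem_Icc.mpr hab)))
  have hVb := isCompact_body (hX.continuous (hI (right_mem_Icc.mpr hab)))
  have h0 : 0 ≤ ∫ t in a..b, sweepRate α X ν t :=
    intervalIntegral.integral_nonneg hab fun t ht => integral_nonneg fun ζ =>
      Real.rpow_nonneg (hX.curv_pos hn hα (hI ht) ζ).le _
  have h1 : volume (body (X a) \ body (X b)) ≤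
      ENNReal.ofReal (∫ t in a..b, sweepRate α X ν t) :=
    (measure_mono (hX.body_sdiff_subset hn hα ha hab hb)).trans hle
  have h2 := (ENNReal.toReal_mono ENNReal.ofReal_ne_top h1)
  rw [ENNReal.toReal_ofReal h0] at h2
  have h3 : volume.real (body (X a) \ body (X b)) =
      volume.real (body (X a)) - volume.real (body (X b)) :=
    measureReal_sdiff (hX.body_antitone hn hα (hI (left_mem_Icc.mpr hab))
      (hI (right_mem_Icc.mpr hab)) hab) hVb.isClosed.measurableSet hVa.measure_lt_top.ne
  rw [enclosedVolume_eq, enclosedVolume_eq, ← h3]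
  exact h2

theorem IsGaussCurvatureFlow.normalPoint_injective (hn : 1 ≤ n) (hα : 0 < α)
    (hX : IsGaussCurvatureFlow α T X ν) {t : ℝ} (ht : t ∈ Ico 0 T) {ζ η : Euc (n + 1)}
    (hζ : ‖ζ‖ = 1) (hη : ‖η‖ = 1) (h : normalPoint X t ζ = normalPoint X t η) : ζ = η := by
  have h1 := (hX.embedding t ht).isEmbedding.injective h
  rw [← hX.normal_contact hn hα ht hζ, ← hX.normal_contact hn hα ht hη, h1]

/-- The cone map sends the punctured unit ball injectively into the body translated by `-p`, with
Jacobian depending only on the direction. Change of variables bounds the integral of the Jacobian by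
the volume, and the radial integration gives the factor `1 / (n + 1)`. -/
theorem IsGaussCurvatureFlow.integral_cone_le (hn : 1 ≤ n) (hα : 0 < α)
    (hX : IsGaussCurvatureFlow α T X ν) {t : ℝ} (ht : t ∈ Ioo 0 T) {p : Euc (n + 1)}
    (hp : ∀ ζ, ‖ζ‖ = 1 → ⟪ζ, p⟫ < supportFunction (X t) ζ) :
    ∫ ζ : Metric.sphere (0 : Euc (n + 1)) 1, (supportFunction (X t) ζ - ⟪(ζ : Euc (n + 1)), p⟫) /
      curv X ν t ζ ∂(sphMeasure n) ≤ (n + 1) * enclosedVolume (X t) := by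
  have htI := Ioo_subset_Ico_self ht
  have hXc := hX.continuous htI
  have hpb : p ∈ body (X t) := (mem_body_iff hXc).mpr fun ζ hζ => (hp ζ hζ).le
  set B : Set (Euc (n + 1)) := Metric.ball 0 1 \ {0} with hB
  have hBm : MeasurableSet B := Metric.isOpen_ball.measurableSet.diff (measurableSet_singleton 0)
  set Φ : Euc (n + 1) → Euc (n + 1) := fun y => ‖y‖ • (normalPoint X t (‖y‖⁻¹ • y) - p) with hΦ
  set q : Euc (n + 1) → ℝ :=
    fun ζ => (supportFunction (X t) ζ - ⟪ζ, p⟫) / curv X ν t ζ with hq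
  have hunit : ∀ y ∈ B, ‖‖y‖⁻¹ • y‖ = 1 := fun y hy => by
    rw [norm_smul, norm_inv, norm_norm, inv_mul_cancel₀ (norm_ne_zero_iff.mpr hy.2)]
  have hder : ∀ y ∈ B, ∃ L : Euc (n + 1) →L[ℝ] Euc (n + 1), HasFDerivAt Φ L y ∧
      L.det = q (‖y‖⁻¹ • y) := fun y hy => by
    have hy0 : 0 < ‖y‖ := norm_pos_iff.mpr hy.2
    have h := hX.exists_hasFDerivAt_cone hn hα ht (hunit y hy) hy0 p
    rwa [smul_smul, mul_inv_cancel₀ hy0.ne', one_smul] at h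
  choose! L hL hdet using hder
  have hinn : ∀ ζ η, ⟪ζ, normalPoint X t η - p⟫ ≤ supportFunction (X t) ζ - ⟪ζ, p⟫ := fun ζ η => by
    rw [inner_sub_right]
    exact sub_le_sub_right (inner_le_supportFunction hXc _ _) _
  have hinn' : ∀ ζ, ⟪ζ, normalPoint X t ζ - p⟫ = supportFunction (X t) ζ - ⟪ζ, p⟫ := fun ζ => by
    rw [inner_sub_right, supportFunction_eq_contact hXc]; rfl
  -- Pair with the direction of `y'`: at `Φ y'` the result is `‖y'‖` times the distance from `p` to
  -- that supporting hyperplane, at `Φ y` it is at most `‖y‖` times the same positive number.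
  have hnormle : ∀ y ∈ B, ∀ y' ∈ B, Φ y = Φ y' → ‖y'‖ ≤ ‖y‖ := fun y hy y' hy' h => by
    have h1 := congrArg (fun w => ⟪‖y'‖⁻¹ • y', w⟫) h
    simp only [hΦ, real_inner_smul_right] at h1
    rw [hinn'] at h1
    have h2 := hinn (‖y'‖⁻¹ • y') (‖y‖⁻¹ • y)
    have h3 := sub_pos.mpr (hp _ (hunit y' hy'))
    have h4 : ‖y'‖ * (supportFunction (X t) (‖y'‖⁻¹ • y') - ⟪‖y'‖⁻¹ • y', p⟫) ≤
        ‖y‖ * (supportFunction (X t) (‖y'‖⁻¹ • y') - ⟪‖y'‖⁻¹ • y', p⟫) := by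
      rw [← h1]; exact mul_le_mul_of_nonneg_left h2 (norm_nonneg _)
    exact le_of_mul_le_mul_right h4 h3
  have hinj : InjOn Φ B := fun y hy y' hy' h => by
    have hr : ‖y‖ = ‖y'‖ := le_antisymm (hnormle y' hy' y hy h.symm) (hnormle y hy y' hy' h)
    have hy0 : ‖y‖ ≠ 0 := norm_ne_zero_iff.mpr hy.2
    have h1 : normalPoint X t (‖y‖⁻¹ • y) = normalPoint X t (‖y'‖⁻¹ • y') := by
      simp only [hΦ] at h
      rw [← hr] at h ⊢
      have h2 := (smul_right_injective (Euc (n + 1)) hy0) h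
      exact sub_left_injective h2
    have h2 := hX.normalPoint_injective hn hα htI (hunit y hy) (hunit y' hy') h1
    rw [← hr] at h2
    exact (smul_right_injective (Euc (n + 1)) (inv_ne_zero hy0)) h2
  have himg : Φ '' B ⊆ (fun w => w + -p) '' body (X t) := by
    rintro _ ⟨y, hy, rfl⟩
    refine ⟨(1 - ‖y‖) • p + ‖y‖ • normalPoint X t (‖y‖⁻¹ • y), ?_, ?_⟩
    · refine (convex_convexHull ℝ (range (X t))) hpb
        (subset_convexHull ℝ _ ⟨_, rfl⟩) ?_ (norm_nonneg _) (by ring)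
      have := mem_ball_zero_iff.mp hy.1
      linarith
    · simp only [hΦ, smul_sub, sub_smul, one_smul]; abel
  have hle := (lintegral_abs_det_fderiv_le_addHaar_image volume hBm
    (fun y hy => (hL y hy).hasFDerivWithinAt) hinj).trans (measure_mono himg)
  rw [image_add_right, neg_neg, measure_preimage_add_right, volume_body hXc] at hle
  have hqpos : ∀ ζ, ‖ζ‖ = 1 → 0 < q ζ := fun ζ hζ =>
    div_pos (sub_pos.mpr (hp ζ hζ)) (hX.curv_pos hn hα htI ζ)
  have hcongr : ∫⁻ y in B, ENNReal.ofReal |(L y).det| =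
      ∫⁻ y in B, ENNReal.ofReal (q (‖y‖⁻¹ • y)) :=
    setLIntegral_congr_fun hBm fun y hy => by
      simp only [hdet y hy, abs_of_pos (hqpos _ (hunit y hy))]
  have hBae : (B : Set (Euc (n + 1))) =ᵐ[volume] Metric.ball 0 1 :=
    sdiff_null_ae_eq_self (measure_singleton _)
  have hqc : Continuous fun ζ : Metric.sphere (0 : Euc (n + 1)) 1 => q ζ := by
    have h1 : ContinuousOn (fun r : ℝ × Euc (n + 1) =>
        (supportFunction (X r.1) r.2 - ⟪r.2, p⟫) / curv X ν r.1 r.2)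
        (Ico 0 T ×ˢ Metric.sphere 0 1) :=
      ((hX.continuousOn_supportFunction hn subset_rfl fun t ht =>
        hX.strictlyConvex hn hα ht).sub (by fun_prop)).div (hX.continuousOn_curv hn hα)
        fun r hr => (hX.curv_pos hn hα hr.1 r.2).ne'
    exact continuous_slice_sphere h1 htI
  rw [hcongr, setLIntegral_congr hBae, lintegral_ball_radial (F := fun ζ => ENNReal.ofReal (q ζ))
    (ENNReal.continuous_ofReal.comp hqc).measurable, ← ofReal_integral_eq_lintegral_ofReal
    (hqc.integrable_of_hasCompactSupport (HasCompactSupport.of_compactSpace _))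
    (ae_of_all _ fun ζ => (hqpos _ (by simp)).le), ← ENNReal.ofReal_mul' (by positivity)] at hle
  have hV0 : 0 ≤ enclosedVolume (X t) := measureReal_nonneg
  have h1 := (ENNReal.ofReal_le_ofReal_iff hV0).mp hle
  have hn1 : (0 : ℝ) < n + 1 := by positivity
  rw [mul_one_div, div_le_iff₀ hn1] at h1
  linarith

/-- The contact points of two opposite directions are distinct, and their midpoint is interior: a
supporting hyperplane through it would contain both, contradicting uniqueness of the contact point.
Compactness of the sphere makes the distance to supporting hyperplanes uniform. -/
theorem IsGaussCurvatureFlow.exists_center (hn : 1 ≤ n) (hα : 0 < α)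
    (hX : IsGaussCurvatureFlow α T X ν) {t : ℝ} (ht : t ∈ Ico 0 T) :
    ∃ p : Euc (n + 1), ∃ c > 0, ∀ ζ, ‖ζ‖ = 1 → c ≤ supportFunction (X t) ζ - ⟪ζ, p⟫ := by
  have hXc := hX.continuous ht
  have hne : (Metric.sphere (0 : Euc (n + 1)) 1).Nonempty :=
    ⟨EuclideanSpace.single 0 1, by simp⟩
  obtain ⟨e, he⟩ := hne
  have he1 : ‖e‖ = 1 := mem_sphere_zero_iff_norm.mp he
  set x := contact (X t) e
  set y := contact (X t) (-e)
  have hxy : x ≠ y := fun h => by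
    have h1 := hX.normal_contact hn hα ht he1
    have h2 := hX.normal_contact hn hα ht (ζ := -e) (by rwa [norm_neg])
    change ν t x = e at h1
    change ν t y = -e at h2
    rw [← h, h1] at h2
    have h3 := congrArg (fun w => ⟪e, w⟫) h2
    simp only [inner_neg_right, real_inner_self_eq_norm_sq, he1] at h3
    norm_num at h3
  set p := (1 / 2 : ℝ) • (X t x + X t y) with hp
  have hpos : ∀ ζ, ‖ζ‖ = 1 → 0 < supportFunction (X t) ζ - ⟪ζ, p⟫ := fun ζ hζ => by
    have h1 := inner_le_supportFunction hXc ζ x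
    have h2 := inner_le_supportFunction hXc ζ y
    have h3 : ⟪ζ, p⟫ = (⟪ζ, X t x⟫ + ⟪ζ, X t y⟫) / 2 := by
      rw [hp, real_inner_smul_right, inner_add_right]; ring
    by_contra hneg
    have hconv := hX.strictlyConvex hn hα ht
    have h4 : x = contact (X t) ζ := hX.eq_contact hn ht hconv hζ fun z =>
      (inner_le_supportFunction hXc ζ z).trans (by linarith)
    have h5 : y = contact (X t) ζ := hX.eq_contact hn ht hconv hζ fun z =>
      (inner_le_supportFunction hXc ζ z).trans (by linarith)
    exact hxy (h4.trans h5.symm)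
  have hc : ContinuousOn (fun ζ => supportFunction (X t) ζ - ⟪ζ, p⟫)
      (Metric.sphere (0 : Euc (n + 1)) 1) := by
    refine ContinuousOn.sub ?_ (by fun_prop)
    exact (hX.continuousOn_supportFunction hn subset_rfl fun t ht =>
      hX.strictlyConvex hn hα ht).comp (f := fun ζ => (t, ζ)) (by fun_prop) fun ζ hζ => ⟨ht, hζ⟩
  obtain ⟨ζ₀, hζ₀, hmin⟩ := (isCompact_sphere (0 : Euc (n + 1)) 1).exists_isMinOn ⟨e, he⟩ hc
  exact ⟨p, _, hpos ζ₀ (mem_sphere_zero_iff_norm.mp hζ₀), fun ζ hζ =>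
    hmin (mem_sphere_zero_iff_norm.mpr hζ)⟩

theorem IsGaussCurvatureFlow.enclosedVolume_pos (hn : 1 ≤ n) (hα : 0 < α)
    (hX : IsGaussCurvatureFlow α T X ν) {t : ℝ} (ht : t ∈ Ico 0 T) :
    0 < enclosedVolume (X t) := by
  obtain ⟨p, c, hc, h⟩ := hX.exists_center hn hα ht
  have hXc := hX.continuous ht
  rw [enclosedVolume_eq, measureReal_def, ENNReal.toReal_pos_iff]
  exact ⟨(Metric.measure_ball_pos volume p hc).trans_le (measure_mono (ball_subset_body hXc h)),
    (isCompact_body hXc).measure_lt_top⟩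

end Area

/-! ### Parametric integrals over the sphere and Chebyshev's inequality -/

section ParametricIntegral

theorem hasDerivAt_integral_sphere {n : ℕ} {a b : ℝ} {H H' : ℝ × Euc (n + 1) → ℝ}
    (hH : ContinuousOn H (Icc a b ×ˢ Metric.sphere 0 1))
    (hH' : ContinuousOn H' (Icc a b ×ˢ Metric.sphere 0 1))
    (hd : ∀ ζ, ‖ζ‖ = 1 → ∀ t ∈ Ioo a b, HasDerivAt (fun s => H (s, ζ)) (H' (t, ζ)) t)
    {t : ℝ} (ht : t ∈ Ioo a b) :
    HasDerivAt (fun s => ∫ ζ : Metric.sphere (0 : Euc (n + 1)) 1, H (s, ζ) ∂(sphMeasure n))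
      (∫ ζ : Metric.sphere (0 : Euc (n + 1)) 1, H' (t, ζ) ∂(sphMeasure n)) t := by
  obtain ⟨C, hC⟩ := (isCompact_Icc.prod
    (isCompact_sphere (0 : Euc (n + 1)) 1)).exists_bound_of_continuousOn hH'
  have hnhds : Ioo a b ∈ 𝓝 t := Ioo_mem_nhds ht.1 ht.2
  refine (hasDerivAt_integral_of_dominated_loc_of_deriv_le (s := Ioo a b) (bound := fun _ => C)
    (F := fun s (ζ : Metric.sphere (0 : Euc (n + 1)) 1) => H (s, ζ))
    (F' := fun s (ζ : Metric.sphere (0 : Euc (n + 1)) 1) => H' (s, ζ))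
    hnhds ?_ ?_ ?_ ?_ (integrable_const _) ?_).2
  · filter_upwards [hnhds] with s hs
    exact (continuous_slice_sphere hH (Ioo_subset_Icc_self hs)).aestronglyMeasurable
  · exact (continuous_slice_sphere hH (Ioo_subset_Icc_self ht)).integrable_of_hasCompactSupport
      (HasCompactSupport.of_compactSpace _)
  · exact (continuous_slice_sphere hH' (Ioo_subset_Icc_self ht)).aestronglyMeasurable
  · exact ae_of_all _ fun ζ s hs => hC _ ⟨Ioo_subset_Icc_self hs, ζ.2⟩
  · exact ae_of_all _ fun ζ s hs => hd ζ (by simp) s hs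

theorem Continuous.integrable_sphere {n : ℕ} {f : Metric.sphere (0 : Euc (n + 1)) 1 → ℝ}
    (hf : Continuous f) : Integrable f (sphMeasure n) :=
  hf.integrable_of_hasCompactSupport (HasCompactSupport.of_compactSpace _)

theorem integral_sphere_pos {n : ℕ} {w : Metric.sphere (0 : Euc (n + 1)) 1 → ℝ}
    (hw : Continuous w) (hw0 : ∀ ζ, 0 < w ζ) : 0 < ∫ ζ, w ζ ∂(sphMeasure n) := by
  rw [integral_pos_iff_support_of_nonneg (fun ζ => (hw0 ζ).le) (Continuous.integrable_sphere hw)]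
  have : Function.support w = univ := eq_univ_of_forall fun ζ => (hw0 ζ).ne'
  rw [this]
  exact Measure.measure_univ_pos.mpr (Measure.toSphere_ne_zero _)

/-- A weighted Chebyshev inequality. -/
theorem chebyshev_integral {n : ℕ} {w q : Metric.sphere (0 : Euc (n + 1)) 1 → ℝ} {β : ℝ}
    (hβ : 0 ≤ β) (hw : Continuous w) (hq : Continuous q) (hw0 : ∀ ζ, 0 < w ζ)
    (hq0 : ∀ ζ, 0 < q ζ) :
    (∫ ζ, w ζ * q ζ ∂(sphMeasure n)) * ∫ ζ, w ζ * q ζ ^ β ∂(sphMeasure n) ≤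
      (∫ ζ, w ζ ∂(sphMeasure n)) * ∫ ζ, w ζ * q ζ ^ (β + 1) ∂(sphMeasure n) := by
  have hqβ : ∀ β : ℝ, Continuous fun ζ => q ζ ^ β := fun β =>
    hq.rpow_const fun ζ => Or.inl (hq0 ζ).ne'
  have hW : 0 < ∫ ζ, w ζ ∂(sphMeasure n) := integral_sphere_pos hw hw0
  have hA0 : 0 ≤ ∫ ζ, w ζ * q ζ ∂(sphMeasure n) :=
    integral_nonneg fun ζ => (mul_pos (hw0 ζ) (hq0 ζ)).le
  set W := ∫ ζ, w ζ ∂(sphMeasure n)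
  set A := ∫ ζ, w ζ * q ζ ∂(sphMeasure n)
  -- `r` is the `w`-mean of `q`. Integrating `w (q - r) (q^β - r^β) ≥ 0`, the terms with the
  -- constant `r^β` cancel since `w (q - r)` has integral zero.
  set r := A / W with hr
  have hr0 : 0 ≤ r := div_nonneg hA0 hW.le
  have hpt : ∀ ζ, 0 ≤ w ζ * q ζ ^ (β + 1) - r * (w ζ * q ζ ^ β) - r ^ β * (w ζ * q ζ) +
      r ^ β * r * w ζ := fun ζ => by
    have h1 : w ζ * q ζ ^ (β + 1) - r * (w ζ * q ζ ^ β) - r ^ β * (w ζ * q ζ) +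
        r ^ β * r * w ζ = w ζ * ((q ζ - r) * (q ζ ^ β - r ^ β)) := by
      rw [Real.rpow_add_one (hq0 ζ).ne']; ring
    rw [h1]
    refine mul_nonneg (hw0 ζ).le ?_
    rcases le_total r (q ζ) with h | h
    · exact mul_nonneg (sub_nonneg.mpr h)
        (sub_nonneg.mpr (Real.rpow_le_rpow hr0 h hβ))
    · exact mul_nonneg_of_nonpos_of_nonpos (sub_nonpos.mpr h)
        (sub_nonpos.mpr (Real.rpow_le_rpow (hq0 ζ).le h hβ))
  have i1 : Integrable (fun ζ => w ζ * q ζ ^ (β + 1)) (sphMeasure n) :=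
    Continuous.integrable_sphere (hw.mul (hqβ (β + 1)))
  have i2 : Integrable (fun ζ => r * (w ζ * q ζ ^ β)) (sphMeasure n) :=
    (Continuous.integrable_sphere (hw.mul (hqβ β))).const_mul r
  have i3 : Integrable (fun ζ => r ^ β * (w ζ * q ζ)) (sphMeasure n) :=
    (Continuous.integrable_sphere (hw.mul hq)).const_mul (r ^ β)
  have i4 := (Continuous.integrable_sphere hw).const_mul (r ^ β * r)
  have h2 : 0 ≤ ∫ ζ, (w ζ * q ζ ^ (β + 1) - r * (w ζ * q ζ ^ β) - r ^ β * (w ζ * q ζ) +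
      r ^ β * r * w ζ) ∂(sphMeasure n) := integral_nonneg hpt
  rw [integral_add (f := fun ζ => w ζ * q ζ ^ (β + 1) - r * (w ζ * q ζ ^ β) -
      r ^ β * (w ζ * q ζ)) ((i1.sub i2).sub i3) i4, integral_sub (f := fun ζ => w ζ * q ζ ^ (β + 1) -
      r * (w ζ * q ζ ^ β)) (i1.sub i2) i3, integral_sub i1 i2,
    integral_const_mul, integral_const_mul, integral_const_mul] at h2
  have h3 : r ^ β * r * W = r ^ β * A := by rw [hr]; field_simp
  change 0 ≤ _ - r ^ β * A + r ^ β * r * W at h2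
  rw [h3, sub_add_cancel, hr, sub_nonneg, div_mul_eq_mul_div, div_le_iff₀ hW] at h2
  linarith

end ParametricIntegral

/-! ### Monotonicity of the entropy -/

section Entropy

attribute [local instance 2000] chartedSpaceSelf

variable {n : ℕ} {M : Type*} [TopologicalSpace M] [CompactSpace M]
  [ChartedSpace (EuclideanSpace ℝ (Fin n)) M] [IsManifold (𝓡 n) ∞ M]
  [T2Space M] [Nonempty M] {α T : ℝ} {X ν : ℝ → M → Euc (n + 1)}

theorem IsGaussCurvatureFlow.continuousOn_sweepRate (hn : 1 ≤ n) (hα : 0 < α)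
    (hX : IsGaussCurvatureFlow α T X ν) {a b : ℝ} (hI : Icc a b ⊆ Ico 0 T) :
    ContinuousOn (sweepRate α X ν) (Icc a b) :=
  continuousOn_integral_sphere ((hX.continuousOn_curv_rpow hn hα (α - 1)).mono (prod_mono_left hI))

/-- The volume is Lipschitz, because its loss is bounded by the integral of the sweep rate, which is
bounded on the compact interval. -/
theorem IsGaussCurvatureFlow.continuousOn_enclosedVolume (hn : 1 ≤ n) (hα : 0 < α)
    (hX : IsGaussCurvatureFlow α T X ν) {a b : ℝ} (ha : 0 < a) (hb : b < T) :
    ContinuousOn (fun t => enclosedVolume (X t)) (Icc a b) := by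
  have hI : Icc a b ⊆ Ico 0 T := fun t ht => ⟨ha.le.trans ht.1, ht.2.trans_lt hb⟩
  obtain ⟨C, hC⟩ := isCompact_Icc.exists_bound_of_continuousOn (hX.continuousOn_sweepRate hn hα hI)
  have hle : ∀ s ∈ Icc a b, ∀ t ∈ Icc a b, s ≤ t →
      |enclosedVolume (X s) - enclosedVolume (X t)| ≤ |C| * |s - t| := fun s hs t ht hst => by
    have h1 := hX.enclosedVolume_sub_le hn hα (ha.trans_le hs.1) hst (ht.2.trans_lt hb)
    have h2 := hX.enclosedVolume_antitone hn hα (hI hs) (hI ht) hst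
    have h3 : ‖∫ r in s..t, sweepRate α X ν r‖ ≤ |C| * |t - s| :=
      intervalIntegral.norm_integral_le_of_norm_le_const fun r hr => by
        rw [uIoc_of_le hst] at hr
        exact (hC r ⟨hs.1.trans hr.1.le, hr.2.trans ht.2⟩).trans (le_abs_self C)
    rw [abs_of_nonneg (sub_nonneg.mpr h2), abs_sub_comm s t]
    exact (h1.trans (le_abs_self _)).trans h3
  have hlip : LipschitzOnWith (Real.toNNReal |C|) (fun t => enclosedVolume (X t)) (Icc a b) := by
    refine LipschitzOnWith.of_dist_le_mul fun s hs t ht => ?_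
    rw [Real.coe_toNNReal _ (abs_nonneg C), Real.dist_eq, Real.dist_eq]
    rcases le_total s t with h | h
    · exact hle s hs t ht h
    · rw [abs_sub_comm, abs_sub_comm s t]; exact hle t ht s hs h
  exact hlip.continuousOn

/-- A quantity growing at least at the rate `c A / V` controls the decay of the volume. -/
theorem IsGaussCurvatureFlow.log_enclosedVolume_sub_le (hn : 1 ≤ n) (hα : 0 < α)
    (hX : IsGaussCurvatureFlow α T X ν) {a b : ℝ} (ha : 0 < a) (hab : a ≤ b) (hb : b < T)
    {c : ℝ} (hc : 0 ≤ c) {B B' : ℝ → ℝ} (hB : ContinuousOn B (Icc a b))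
    (hB' : ∀ t ∈ Ico a b, HasDerivAt B (B' t) t)
    (hbound : ∀ t ∈ Ico a b, c * (sweepRate α X ν t / enclosedVolume (X t)) ≤ B' t) :
    c * (Real.log (enclosedVolume (X a)) - Real.log (enclosedVolume (X b))) ≤ B b - B a := by
  have hI : Icc a b ⊆ Ico 0 T := fun t ht => ⟨ha.le.trans ht.1, ht.2.trans_lt hb⟩
  set V : ℝ → ℝ := fun t => enclosedVolume (X t) with hV
  have hVpos : ∀ t ∈ Icc a b, 0 < V t := fun t ht => hX.enclosedVolume_pos hn hα (hI ht)
  have hVc : ContinuousOn V (Icc a b) := hX.continuousOn_enclosedVolume hn hα ha hb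
  have hf : ContinuousOn (fun t => c * (Real.log (V a) - Real.log (V t))) (Icc a b) :=
    continuousOn_const.mul (continuousOn_const.sub (hVc.log fun t ht => (hVpos t ht).ne'))
  -- Differentiability of the volume is not available, but the comparison principle needs only upper
  -- bounds for the right slopes of the logarithmic loss. They follow from the swept volume estimate
  -- and `log x ≤ x - 1`.
  have key := image_le_of_liminf_slope_right_le_deriv_boundary
    (f := fun t => c * (Real.log (V a) - Real.log (V t)))
    (B := fun t => B t - B a) (B' := B') hf ?_
    (hB.sub continuousOn_const) (fun t ht => ((hB' t ht).sub_const _).hasDerivWithinAt) ?_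
  · exact key (right_mem_Icc.mpr hab)
  · simp
  · intro t ht r hr
    replace hr := (hbound t ht).trans_lt hr
    refine Eventually.frequently ?_
    have htI := Ico_subset_Icc_self ht
    have hAc := (hX.continuousOn_sweepRate hn hα hI)
    have hnhds : Icc a b ∈ 𝓝[>] t :=
      mem_of_superset (Ioo_mem_nhdsGT ht.2) fun s hs => ⟨ht.1.trans hs.1.le, hs.2.le⟩
    have hFTC : HasDerivWithinAt (fun z => ∫ s in t..z, sweepRate α X ν s) (sweepRate α X ν t)
        (Ioi t) t := by
      refine (intervalIntegral.integral_hasDerivWithinAt_right (s := Ici t) (t := Ioi t)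
        IntervalIntegrable.refl ?_ ?_).mono Ioi_subset_Ici_self
      · refine ⟨Icc a b, hnhds, ?_⟩
        exact hAc.aestronglyMeasurable measurableSet_Icc
      · exact (hAc t htI).mono_of_mem_nhdsWithin hnhds
    have hslope := hasDerivWithinAt_iff_tendsto_slope.mp hFTC
    have hVt : Tendsto V (𝓝[>] t) (𝓝 (V t)) :=
      (hVc t htI).mono_of_mem_nhdsWithin hnhds
    have hdiff : Ioi t \ {t} = Ioi t := by
      ext s; simp only [Set.mem_sdiff, mem_Ioi, mem_singleton_iff, and_iff_left_iff_imp]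
      exact fun h => ne_of_gt h
    rw [hdiff] at hslope
    have hlim : Tendsto (fun z => c * (slope (fun z => ∫ s in t..z, sweepRate α X ν s) t z / V z))
        (𝓝[>] t) (𝓝 (c * (sweepRate α X ν t / V t))) :=
      (hslope.div hVt (hVpos t htI).ne').const_mul c
    filter_upwards [hlim.eventually_lt_const hr, hnhds, self_mem_nhdsWithin] with z hz hzI hzt
    refine lt_of_le_of_lt ?_ hz
    have hzt' : 0 < z - t := sub_pos.mpr hzt
    rw [slope_def_field, slope_def_field, intervalIntegral.integral_same, sub_zero]
    have h1 := hX.enclosedVolume_sub_le hn hα (ha.trans_le ht.1) (le_of_lt hzt) (hzI.2.trans_lt hb)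
    have h2 : Real.log (V t) - Real.log (V z) ≤ (V t - V z) / V z := by
      rw [← Real.log_div (hVpos t htI).ne' (hVpos z hzI).ne', sub_div, div_self (hVpos z hzI).ne']
      exact Real.log_le_sub_one_of_pos (div_pos (hVpos t htI) (hVpos z hzI))
    have h3 : (V t - V z) / V z ≤ (∫ s in t..z, sweepRate α X ν s) / V z :=
      div_le_div_of_nonneg_right h1 (hVpos z hzI).le
    have h4 : (c * (Real.log (V a) - Real.log (V z)) - c * (Real.log (V a) - Real.log (V t))) /
        (z - t) = c * ((Real.log (V t) - Real.log (V z)) / (z - t)) := by ring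
    rw [h4, div_right_comm]
    exact mul_le_mul_of_nonneg_left (div_le_div_of_nonneg_right (h2.trans h3) hzt'.le) hc

/-- The distance from `p` to the supporting hyperplane with normal `ζ`. -/
def supportFrom (X : ℝ → M → Euc (n + 1)) (p : Euc (n + 1)) (t : ℝ) (ζ : Euc (n + 1)) : ℝ :=
  supportFunction (X t) ζ - ⟪ζ, p⟫

theorem IsGaussCurvatureFlow.continuousOn_supportFrom (hn : 1 ≤ n) (hα : 0 < α)
    (hX : IsGaussCurvatureFlow α T X ν) (p : Euc (n + 1)) :
    ContinuousOn (fun q : ℝ × Euc (n + 1) => supportFrom X p q.1 q.2)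
      (Ico 0 T ×ˢ Metric.sphere 0 1) :=
  (hX.continuousOn_supportFunction hn subset_rfl fun t ht =>
    hX.strictlyConvex hn hα ht).sub (by fun_prop)

theorem IsGaussCurvatureFlow.hasDerivAt_supportFrom (hn : 1 ≤ n) (hα : 0 < α)
    (hX : IsGaussCurvatureFlow α T X ν) (p : Euc (n + 1)) {t : ℝ} (ht : t ∈ Ioo 0 T)
    {ζ : Euc (n + 1)} (hζ : ‖ζ‖ = 1) :
    HasDerivAt (fun s => supportFrom X p s ζ) (-(curv X ν t ζ ^ α)) t :=
  ((hX.hasDerivWithinAt_supportFunction hn (Ioo_subset_Ico_self ht)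
    (hX.strictlyConvex hn hα (Ioo_subset_Ico_self ht)) hζ).hasDerivAt
      (Ico_mem_nhds ht.1 ht.2)).sub_const _

theorem IsGaussCurvatureFlow.supportFrom_pos (hn : 1 ≤ n) (hα : 0 < α)
    (hX : IsGaussCurvatureFlow α T X ν) {p : Euc (n + 1)} {s t : ℝ} (hs : s ∈ Ico 0 T)
    (ht : t ∈ Ico 0 T) (hst : s ≤ t) (hp : ∀ ζ, ‖ζ‖ = 1 → 0 < supportFrom X p t ζ)
    {ζ : Euc (n + 1)} (hζ : ‖ζ‖ = 1) : 0 < supportFrom X p s ζ :=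
  (hp ζ hζ).trans_le (sub_le_sub_right (hX.supportFunction_antitone hn hα hζ hs ht hst) _)

/-- Chebyshev's inequality with weight `w = u / K`, function `q = K^α / u` and exponent `β = 1 / α`.
Then `w q = K^(α-1)`, `w q^β = u^(1-1/α)` and `w q^(β+1) = u^(-1/α) K^α`, while the cone estimate
bounds the integral of `w` by `(n + 1) V`. -/
theorem IsGaussCurvatureFlow.entropy_production (hn : 1 ≤ n) (hα : 0 < α)
    (hX : IsGaussCurvatureFlow α T X ν) {t : ℝ} (ht : t ∈ Ioo 0 T) {p : Euc (n + 1)}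
    (hp : ∀ ζ, ‖ζ‖ = 1 → 0 < supportFrom X p t ζ) :
    sweepRate α X ν t / ((n + 1) * enclosedVolume (X t)) *
      ∫ ζ : Metric.sphere (0 : Euc (n + 1)) 1, supportFrom X p t ζ ^ (1 - 1 / α) ∂(sphMeasure n) ≤
      ∫ ζ : Metric.sphere (0 : Euc (n + 1)) 1,
        supportFrom X p t ζ ^ (-(1 / α)) * curv X ν t ζ ^ α ∂(sphMeasure n) := by
  have htI := Ioo_subset_Ico_self ht
  have hu : Continuous fun ζ : Metric.sphere (0 : Euc (n + 1)) 1 => supportFrom X p t ζ :=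
    continuous_slice_sphere (hX.continuousOn_supportFrom hn hα p) htI
  have hK : Continuous fun ζ : Metric.sphere (0 : Euc (n + 1)) 1 => curv X ν t ζ :=
    continuous_slice_sphere (hX.continuousOn_curv hn hα) htI
  have hu0 : ∀ ζ : Metric.sphere (0 : Euc (n + 1)) 1, 0 < supportFrom X p t ζ :=
    fun ζ => hp ζ (by simp)
  have hK0 : ∀ ζ : Metric.sphere (0 : Euc (n + 1)) 1, 0 < curv X ν t ζ :=
    fun ζ => hX.curv_pos hn hα htI ζ
  have hKα : Continuous fun ζ : Metric.sphere (0 : Euc (n + 1)) 1 => curv X ν t ζ ^ α :=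
    hK.rpow_const fun ζ => Or.inr hα.le
  have h := chebyshev_integral (β := 1 / α)
    (w := fun ζ : Metric.sphere (0 : Euc (n + 1)) 1 => supportFrom X p t ζ / curv X ν t ζ)
    (q := fun ζ : Metric.sphere (0 : Euc (n + 1)) 1 => curv X ν t ζ ^ α / supportFrom X p t ζ)
    (by positivity) (hu.div hK fun ζ => (hK0 ζ).ne') (hKα.div hu fun ζ => (hu0 ζ).ne')
    (fun ζ => div_pos (hu0 ζ) (hK0 ζ))
    (fun ζ => div_pos (Real.rpow_pos_of_pos (hK0 ζ) α) (hu0 ζ))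
  have e1 : ∀ ζ : Metric.sphere (0 : Euc (n + 1)) 1, supportFrom X p t ζ / curv X ν t ζ *
      (curv X ν t ζ ^ α / supportFrom X p t ζ) = curv X ν t ζ ^ (α - 1) := fun ζ => by
    rw [Real.rpow_sub_one (hK0 ζ).ne']
    field_simp [(hu0 ζ).ne']
  have e0 : ∀ ζ : Metric.sphere (0 : Euc (n + 1)) 1,
      (curv X ν t ζ ^ α / supportFrom X p t ζ) ^ (1 / α) =
      curv X ν t ζ * supportFrom X p t ζ ^ (-(1 / α)) := fun ζ => by
    rw [Real.div_rpow (Real.rpow_nonneg (hK0 ζ).le _) (hu0 ζ).le, ← Real.rpow_mul (hK0 ζ).le,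
      mul_one_div_cancel hα.ne', Real.rpow_one, Real.rpow_neg (hu0 ζ).le, div_eq_mul_inv]
  have e2 : ∀ ζ : Metric.sphere (0 : Euc (n + 1)) 1, supportFrom X p t ζ / curv X ν t ζ *
      (curv X ν t ζ ^ α / supportFrom X p t ζ) ^ (1 / α) =
      supportFrom X p t ζ ^ (1 - 1 / α) := fun ζ => by
    rw [e0, sub_eq_add_neg, Real.rpow_add (hu0 ζ), Real.rpow_one]
    field_simp [(hK0 ζ).ne']
  have e3 : ∀ ζ : Metric.sphere (0 : Euc (n + 1)) 1, supportFrom X p t ζ / curv X ν t ζ *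
      (curv X ν t ζ ^ α / supportFrom X p t ζ) ^ (1 / α + 1) =
      supportFrom X p t ζ ^ (-(1 / α)) * curv X ν t ζ ^ α := fun ζ => by
    rw [Real.rpow_add_one (div_pos (Real.rpow_pos_of_pos (hK0 ζ) α) (hu0 ζ)).ne', e0]
    field_simp [(hK0 ζ).ne', (hu0 ζ).ne']
  simp only [e1, e2, e3] at h
  have hcone := hX.integral_cone_le hn hα ht (p := p) fun ζ hζ => sub_pos.mp (hp ζ hζ)
  change (∫ ζ : Metric.sphere (0 : Euc (n + 1)) 1, supportFrom X p t ζ / curv X ν t ζ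
    ∂(sphMeasure n)) ≤ _ at hcone
  have hV := hX.enclosedVolume_pos hn hα htI
  rw [div_mul_eq_mul_div, div_le_iff₀ (by positivity), mul_comm (integral _ _) ((n + 1 : ℝ) * _)]
  refine h.trans (mul_le_mul_of_nonneg_right hcone (integral_nonneg fun ζ => ?_))
  exact mul_nonneg (Real.rpow_nonneg (hu0 ζ).le _) (Real.rpow_nonneg (hK0 ζ).le _)

/-- The entropy estimate for `α < 1`. -/
theorem IsGaussCurvatureFlow.entropy_of_lt_one (hn : 1 ≤ n) (hα : 0 < α) (hα1 : α < 1)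
    (hX : IsGaussCurvatureFlow α T X ν) {a b : ℝ} (ha : 0 < a) (hab : a ≤ b) (hb : b < T)
    {p : Euc (n + 1)} (hp : ∀ ζ, ‖ζ‖ = 1 → 0 < supportFrom X p b ζ) :
    (1 / α - 1) / (n + 1) * (Real.log (enclosedVolume (X a)) - Real.log (enclosedVolume (X b))) ≤
      Real.log (∫ ζ : Metric.sphere (0 : Euc (n + 1)) 1,
        supportFrom X p b ζ ^ (1 - 1 / α) ∂(sphMeasure n)) -
      Real.log (∫ ζ : Metric.sphere (0 : Euc (n + 1)) 1,
        supportFrom X p a ζ ^ (1 - 1 / α) ∂(sphMeasure n)) := by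
  have hI : Icc 0 b ⊆ Ico 0 T := fun t ht => ⟨ht.1, ht.2.trans_lt hb⟩
  have hb0 : 0 < b := ha.trans_le hab
  have hbI : b ∈ Icc 0 b := right_mem_Icc.mpr hb0.le
  have hβ : 0 < 1 / α - 1 := by rw [sub_pos, lt_div_iff₀ hα]; linarith
  have hpos : ∀ t ∈ Icc 0 b, ∀ ζ, ‖ζ‖ = 1 → 0 < supportFrom X p t ζ := fun t ht ζ hζ =>
    hX.supportFrom_pos hn hα (hI ht) (hI hbI) ht.2 hp hζ
  have hu := (hX.continuousOn_supportFrom hn hα p).mono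
    (prod_mono_left hI : Icc 0 b ×ˢ Metric.sphere (0 : Euc (n + 1)) 1 ⊆ _)
  have huβ : ∀ β : ℝ, ContinuousOn (fun q : ℝ × Euc (n + 1) => supportFrom X p q.1 q.2 ^ β)
      (Icc 0 b ×ˢ Metric.sphere 0 1) := fun β =>
    hu.rpow_const fun q hq => Or.inl (hpos _ hq.1 _ (mem_sphere_zero_iff_norm.mp hq.2)).ne'
  have hKα := (hX.continuousOn_curv_rpow hn hα α).mono
    (prod_mono_left hI : Icc 0 b ×ˢ Metric.sphere (0 : Euc (n + 1)) 1 ⊆ _)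
  set Q : ℝ → ℝ := fun t => ∫ ζ : Metric.sphere (0 : Euc (n + 1)) 1,
    supportFrom X p t ζ ^ (1 - 1 / α) ∂(sphMeasure n) with hQ
  set P : ℝ → ℝ := fun t => ∫ ζ : Metric.sphere (0 : Euc (n + 1)) 1,
    supportFrom X p t ζ ^ (-(1 / α)) * curv X ν t ζ ^ α ∂(sphMeasure n) with hP
  have hQc : ContinuousOn Q (Icc 0 b) := continuousOn_integral_sphere (huβ _)
  have hQpos : ∀ t ∈ Icc 0 b, 0 < Q t := fun t ht => by
    have hc : Continuous fun ζ : Metric.sphere (0 : Euc (n + 1)) 1 =>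
        supportFrom X p t ζ ^ (1 - 1 / α) := continuous_slice_sphere (huβ _) ht
    have hp0 : ∀ ζ : Metric.sphere (0 : Euc (n + 1)) 1, 0 < supportFrom X p t ζ ^ (1 - 1 / α) :=
      fun ζ => Real.rpow_pos_of_pos (hpos t ht ζ (by simp)) _
    exact integral_sphere_pos hc hp0
  have hQ' : ∀ t ∈ Ioo 0 b, HasDerivAt Q ((1 / α - 1) * P t) t := fun t ht => by
    have h := hasDerivAt_integral_sphere (huβ (1 - 1 / α))
      (H' := fun q => (1 / α - 1) * (supportFrom X p q.1 q.2 ^ (-(1 / α)) * curv X ν q.1 q.2 ^ α))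
      (continuousOn_const.mul ((huβ _).mul hKα)) (fun ζ hζ t ht => by
        have h1 := hX.hasDerivAt_supportFrom hn hα p ⟨ht.1, ht.2.trans hb⟩ hζ
        have h2 := h1.rpow_const (p := 1 - 1 / α)
          (Or.inl (hpos t (Ioo_subset_Icc_self ht) ζ hζ).ne')
        refine h2.congr_deriv ?_
        rw [show 1 - 1 / α - 1 = -(1 / α) by ring]; ring) ht
    simp only [integral_const_mul] at h
    exact h
  -- Divided by `Q`, the entropy production inequality says that `log Q` grows at least at the rate
  -- `(1/α - 1)/(n + 1)` times `sweepRate / V`.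
  have key := hX.log_enclosedVolume_sub_le hn hα ha hab hb
    (c := (1 / α - 1) / (n + 1)) (by positivity) (B := fun t => Real.log (Q t))
    (B' := fun t => (1 / α - 1) * P t / Q t)
    ((hQc.mono (Icc_subset_Icc_left ha.le)).log fun t ht => (hQpos t ⟨ha.le.trans ht.1, ht.2⟩).ne')
    (fun t ht => (hQ' t ⟨ha.trans_le ht.1, ht.2⟩).log
      (hQpos t ⟨ha.le.trans ht.1, ht.2.le⟩).ne')
    (fun t ht => by
      have ht0 : t ∈ Icc 0 b := ⟨ha.le.trans ht.1, ht.2.le⟩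
      have h := hX.entropy_production hn hα ⟨ha.trans_le ht.1, ht.2.trans hb⟩ (hpos t ht0)
      rw [le_div_iff₀ (hQpos t ht0)]
      change _ * Q t ≤ P t at h
      have h2 := mul_le_mul_of_nonneg_left h hβ.le
      refine le_trans (le_of_eq ?_) h2
      have := hX.enclosedVolume_pos hn hα (hI ht0)
      field_simp)
  exact key

/-- The entropy estimate for `α = 1`. -/
theorem IsGaussCurvatureFlow.entropy_of_eq_one (hn : 1 ≤ n)
    (hX : IsGaussCurvatureFlow 1 T X ν) {a b : ℝ} (ha : 0 < a) (hab : a ≤ b) (hb : b < T)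
    {p : Euc (n + 1)} (hp : ∀ ζ, ‖ζ‖ = 1 → 0 < supportFrom X p b ζ) :
    (sphMeasure n).real univ / (n + 1) *
      (Real.log (enclosedVolume (X a)) - Real.log (enclosedVolume (X b))) ≤
      (∫ ζ : Metric.sphere (0 : Euc (n + 1)) 1,
        Real.log (supportFrom X p a ζ) ∂(sphMeasure n)) -
      ∫ ζ : Metric.sphere (0 : Euc (n + 1)) 1,
        Real.log (supportFrom X p b ζ) ∂(sphMeasure n) := by
  have hα : (0 : ℝ) < 1 := one_pos
  have hI : Icc 0 b ⊆ Ico 0 T := fun t ht => ⟨ht.1, ht.2.trans_lt hb⟩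
  have hb0 : 0 < b := ha.trans_le hab
  have hbI : b ∈ Icc 0 b := right_mem_Icc.mpr hb0.le
  have hpos : ∀ t ∈ Icc 0 b, ∀ ζ, ‖ζ‖ = 1 → 0 < supportFrom X p t ζ := fun t ht ζ hζ =>
    hX.supportFrom_pos hn hα (hI ht) (hI hbI) ht.2 hp hζ
  have hu := (hX.continuousOn_supportFrom hn hα p).mono
    (prod_mono_left hI : Icc 0 b ×ˢ Metric.sphere (0 : Euc (n + 1)) 1 ⊆ _)
  have hu0 : ∀ q ∈ Icc 0 b ×ˢ Metric.sphere (0 : Euc (n + 1)) 1,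
      supportFrom X p q.1 q.2 ≠ 0 := fun q hq =>
    (hpos _ hq.1 _ (mem_sphere_zero_iff_norm.mp hq.2)).ne'
  have hK := (hX.continuousOn_curv hn hα).mono
    (prod_mono_left hI : Icc 0 b ×ˢ Metric.sphere (0 : Euc (n + 1)) 1 ⊆ _)
  set J : ℝ → ℝ := fun t => ∫ ζ : Metric.sphere (0 : Euc (n + 1)) 1,
    Real.log (supportFrom X p t ζ) ∂(sphMeasure n) with hJ
  set P : ℝ → ℝ := fun t => ∫ ζ : Metric.sphere (0 : Euc (n + 1)) 1,
    supportFrom X p t ζ ^ (-(1 / (1 : ℝ))) * curv X ν t ζ ^ (1 : ℝ) ∂(sphMeasure n) with hP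
  have hJc : ContinuousOn J (Icc 0 b) := continuousOn_integral_sphere (hu.log hu0)
  have hJ' : ∀ t ∈ Ioo 0 b, HasDerivAt J (-P t) t := fun t ht => by
    have h := hasDerivAt_integral_sphere (hu.log hu0)
      (H' := fun q => -(supportFrom X p q.1 q.2 ^ (-(1 / (1 : ℝ))) * curv X ν q.1 q.2 ^ (1 : ℝ)))
      (((hu.rpow_const fun q hq => Or.inl (hu0 q hq)).mul
        (hK.rpow_const fun q hq => Or.inr zero_le_one)).neg) (fun ζ hζ t ht => by
        have h1 := hX.hasDerivAt_supportFrom hn hα p ⟨ht.1, ht.2.trans hb⟩ hζ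
        refine (h1.log (hpos t (Ioo_subset_Icc_self ht) ζ hζ).ne').congr_deriv ?_
        rw [one_div_one, Real.rpow_neg_one, Real.rpow_one]; ring) ht
    simp only [integral_neg] at h
    exact h
  -- For `α = 1` the exponent `1 - 1 / α` is zero, and the integral in the entropy production
  -- inequality becomes the total measure of the sphere.
  have key := hX.log_enclosedVolume_sub_le hn hα ha hab hb
    (c := (sphMeasure n).real univ / (n + 1)) (by positivity) (B := fun t => -J t)
    (B' := fun t => P t) (hJc.mono (Icc_subset_Icc_left ha.le)).neg
    (fun t ht => by
      have := (hJ' t ⟨ha.trans_le ht.1, ht.2⟩).neg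
      rwa [neg_neg] at this)
    (fun t ht => by
      have ht0 : t ∈ Icc 0 b := ⟨ha.le.trans ht.1, ht.2.le⟩
      have h := hX.entropy_production hn hα ⟨ha.trans_le ht.1, ht.2.trans hb⟩ (hpos t ht0)
      refine le_trans (le_of_eq ?_) h
      have := hX.enclosedVolume_pos hn hα (hI ht0)
      simp only [one_div_one, sub_self, Real.rpow_zero, integral_const, smul_eq_mul, mul_one]
      field_simp)
  linarith

theorem exists_supportFunction_sub_le {X : M → Euc (n + 1)} (hX : Continuous X) :
    ∃ D > 0, ∀ p ∈ body X, ∀ ζ, ‖ζ‖ = 1 → supportFunction X ζ - ⟪ζ, p⟫ ≤ D := by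
  obtain ⟨R, hR, hsub⟩ := (isCompact_body hX).isBounded.subset_closedBall_lt 0 0
  refine ⟨2 * R, by positivity, fun p hp ζ hζ => ?_⟩
  have h1 := mem_closedBall_zero_iff.mp (hsub hp)
  have h2 := mem_closedBall_zero_iff.mp (hsub (subset_convexHull ℝ _ ⟨contact X ζ, rfl⟩))
  rw [supportFunction_eq_contact hX, ← inner_sub_right]
  refine (real_inner_le_norm _ _).trans ?_
  rw [hζ, one_mul]
  linarith [norm_sub_le (X (contact X ζ)) p]

/-- The entropy inequality is integrated from the fixed time `a`. A point inside the body at time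
`b` was inside at time `a`, so its distances to the supporting hyperplanes at time `a` are at most
`D`, and the initial entropy is bounded independently of `b` and `p`. The exponent is `1 / α - 1`
for `α < 1` and `1 / 2` for `α = 1`. -/
theorem IsGaussCurvatureFlow.exists_entropy_bound (hn : 1 ≤ n) (hα : 1 / (n : ℝ) < α)
    (hα1 : α ≤ 1) (hX : IsGaussCurvatureFlow α T X ν) {a : ℝ} (ha : a ∈ Ioo 0 T) :
    ∃ q : ℝ, 0 < q ∧ q < n ∧ ∃ c > 0, ∀ b ∈ Ico a T, ∀ p,
      (∀ ζ, ‖ζ‖ = 1 → 0 < supportFrom X p b ζ) →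
      c ≤ enclosedVolume (X b) ^ (q / (n + 1)) *
        ∫ ζ : Metric.sphere (0 : Euc (n + 1)) 1, supportFrom X p b ζ ^ (-q) ∂(sphMeasure n) := by
  have hn0 : (0 : ℝ) < n := by exact_mod_cast hn
  have hα0 : 0 < α := (by positivity : 0 < 1 / (n : ℝ)).trans hα
  have haI := Ioo_subset_Ico_self ha
  obtain ⟨D, hD, hDle⟩ := exists_supportFunction_sub_le (hX.continuous haI)
  have hVa := hX.enclosedVolume_pos hn hα0 haI
  have hS : 0 < (sphMeasure n).real univ := by
    rw [measureReal_def]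
    exact ENNReal.toReal_pos (Measure.measure_univ_ne_zero.mpr (Measure.toSphere_ne_zero _))
      (measure_ne_top _ _)
  have hle : ∀ b ∈ Ico a T, ∀ p, (∀ ζ, ‖ζ‖ = 1 → 0 < supportFrom X p b ζ) → ∀ ζ, ‖ζ‖ = 1 →
      0 < supportFrom X p a ζ ∧ supportFrom X p a ζ ≤ D := fun b hb p hp => by
    have h1 : ∀ ζ, ‖ζ‖ = 1 → 0 < supportFrom X p a ζ := fun ζ hζ =>
      hX.supportFrom_pos hn hα0 haI ⟨ha.1.le.trans hb.1, hb.2⟩ hb.1 hp hζ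
    exact fun ζ hζ => ⟨h1 ζ hζ, hDle p ((mem_body_iff (hX.continuous haI)).mpr fun η hη =>
      (sub_pos.mp (h1 η hη)).le) ζ hζ⟩
  rcases hα1.lt_or_eq with h | rfl
  · have hβ : 0 < 1 / α - 1 := by rw [sub_pos, lt_div_iff₀ hα0]; linarith
    refine ⟨1 / α - 1, hβ, ?_, Real.exp (Real.log ((sphMeasure n).real univ * D ^ (1 - 1 / α)) +
      (1 / α - 1) / (n + 1) * Real.log (enclosedVolume (X a))), Real.exp_pos _, fun b hb p hp => ?_⟩
    · have : 1 / α < n := by rwa [one_div_lt hα0 hn0]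
      linarith
    have hbI : b ∈ Ico 0 T := ⟨ha.1.le.trans hb.1, hb.2⟩
    have hVb := hX.enclosedVolume_pos hn hα0 hbI
    have key := hX.entropy_of_lt_one hn hα0 h ha.1 hb.1 hb.2 hp
    have hcont : ∀ t ∈ Ico 0 T, (∀ ζ, ‖ζ‖ = 1 → 0 < supportFrom X p t ζ) →
        Continuous fun ζ : Metric.sphere (0 : Euc (n + 1)) 1 =>
          supportFrom X p t ζ ^ (1 - 1 / α) := fun t ht htp =>
      (continuous_slice_sphere (hX.continuousOn_supportFrom hn hα0 p) ht).rpow_const fun ζ =>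
        Or.inl (htp ζ (by simp)).ne'
    have hQb := integral_sphere_pos (hcont b hbI hp)
      fun ζ => Real.rpow_pos_of_pos (hp ζ (by simp)) _
    have hQa : (sphMeasure n).real univ * D ^ (1 - 1 / α) ≤
        ∫ ζ : Metric.sphere (0 : Euc (n + 1)) 1,
          supportFrom X p a ζ ^ (1 - 1 / α) ∂(sphMeasure n) := by
      rw [← smul_eq_mul, ← integral_const]
      refine integral_mono (integrable_const _) (Continuous.integrable_sphere
        (hcont a haI fun ζ hζ => (hle b hb p hp ζ hζ).1)) fun ζ => ?_
      obtain ⟨h1, h2⟩ := hle b hb p hp ζ (by simp)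
      exact Real.rpow_le_rpow_of_nonpos h1 h2 (by linarith)
    have hQa' := Real.log_le_log (by positivity) hQa
    rw [neg_sub, ← Real.exp_log (mul_pos (Real.rpow_pos_of_pos hVb _) hQb),
      Real.log_mul (Real.rpow_pos_of_pos hVb _).ne' hQb.ne', Real.log_rpow hVb, Real.exp_le_exp]
    linarith
  · have hn1 : (1 : ℝ) < n := by rwa [div_lt_one hn0] at hα
    -- `m` is the lower bound that the logarithmic entropy gives for the mean over the sphere of
    -- `log V / (2 (n + 1)) - (log u) / 2`. The tangent line of the exponential at `m`, namely `exp
    -- y ≥ exp m * (1 + y - m)`, turns it into a bound for the mean of the exponential.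
    set m : ℝ := -(1 / 2) * (Real.log D - Real.log (enclosedVolume (X a)) / (n + 1)) with hm
    refine ⟨1 / 2, by norm_num, by linarith, Real.exp m * (sphMeasure n).real univ,
      mul_pos (Real.exp_pos _) hS, fun b hb p hp => ?_⟩
    have hbI : b ∈ Ico 0 T := ⟨ha.1.le.trans hb.1, hb.2⟩
    have hVb := hX.enclosedVolume_pos hn hα0 hbI
    have key := hX.entropy_of_eq_one hn ha.1 hb.1 hb.2 hp
    have hcont : ∀ t ∈ Ico 0 T, (∀ ζ, ‖ζ‖ = 1 → 0 < supportFrom X p t ζ) →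
        Continuous fun ζ : Metric.sphere (0 : Euc (n + 1)) 1 =>
          Real.log (supportFrom X p t ζ) := fun t ht htp =>
      (continuous_slice_sphere (hX.continuousOn_supportFrom hn hα0 p) ht).log fun ζ =>
        (htp ζ (by simp)).ne'
    have hJa : (∫ ζ : Metric.sphere (0 : Euc (n + 1)) 1,
        Real.log (supportFrom X p a ζ) ∂(sphMeasure n)) ≤
        (sphMeasure n).real univ * Real.log D := by
      rw [← smul_eq_mul, ← integral_const]
      refine integral_mono (Continuous.integrable_sphere
        (hcont a haI fun ζ hζ => (hle b hb p hp ζ hζ).1)) (integrable_const _) fun ζ => ?_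
      obtain ⟨h1, h2⟩ := hle b hb p hp ζ (by simp)
      exact Real.log_le_log h1 h2
    have hpt : ∀ ζ : Metric.sphere (0 : Euc (n + 1)) 1, Real.exp m * (1 - m +
        1 / 2 / (n + 1) * Real.log (enclosedVolume (X b)) -
        1 / 2 * Real.log (supportFrom X p b ζ)) ≤
        enclosedVolume (X b) ^ (1 / 2 / ((n : ℝ) + 1)) * supportFrom X p b ζ ^ (-(1 / 2 : ℝ)) :=
      fun ζ => by
        have hu := hp ζ (by simp)
        rw [Real.rpow_def_of_pos hVb, Real.rpow_def_of_pos hu, ← Real.exp_add]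
        have h1 := Real.add_one_le_exp (Real.log (enclosedVolume (X b)) * (1 / 2 / (n + 1)) +
          Real.log (supportFrom X p b ζ) * (-(1 / 2)) - m)
        rw [Real.exp_sub, le_div_iff₀ (Real.exp_pos m)] at h1
        refine le_trans (le_of_eq ?_) h1
        ring
    have hi := Continuous.integrable_sphere (hcont b hbI hp)
    have hi2 : Integrable (fun ζ : Metric.sphere (0 : Euc (n + 1)) 1 =>
        supportFrom X p b ζ ^ (-(1 / 2 : ℝ))) (sphMeasure n) :=
      Continuous.integrable_sphere
        ((continuous_slice_sphere (hX.continuousOn_supportFrom hn hα0 p) hbI).rpow_const fun ζ =>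
          Or.inl (hp ζ (by simp)).ne')
    have h1 := integral_mono (((integrable_const _).sub (hi.const_mul _)).const_mul _)
      (hi2.const_mul _) hpt
    rw [integral_const_mul, integral_const_mul, integral_sub' (integrable_const _)
      (hi.const_mul _), integral_const_mul, integral_const, smul_eq_mul] at h1
    refine le_trans ?_ h1
    refine mul_le_mul_of_nonneg_left ?_ (Real.exp_pos m).le
    have h2 : (sphMeasure n).real univ / (n + 1) *
      (Real.log (enclosedVolume (X a)) - Real.log (enclosedVolume (X b))) =
      (sphMeasure n).real univ * (Real.log (enclosedVolume (X a)) / (n + 1)) -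
      (sphMeasure n).real univ * (Real.log (enclosedVolume (X b)) / (n + 1)) := by ring
    have h3 : (sphMeasure n).real univ * (1 - m +
        1 / 2 / (n + 1) * Real.log (enclosedVolume (X b))) = (sphMeasure n).real univ +
        1 / 2 * ((sphMeasure n).real univ * Real.log D -
          (sphMeasure n).real univ * (Real.log (enclosedVolume (X a)) / (n + 1)) +
          (sphMeasure n).real univ * (Real.log (enclosedVolume (X b)) / (n + 1))) := by
      rw [hm]; ring
    rw [h3]
    linarith

end Entropy

/-! ### Volumes of slabs, strips, dual bodies and maximal parallelepipeds -/

section Volumes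

open scoped ENNReal

variable {n : ℕ}

theorem volume_pi_cube {ι : Type*} [Fintype ι] (r : ι → ℝ) :
    volume (univ.pi fun i => Icc (-r i) (r i)) = ∏ i, ENNReal.ofReal (2 * r i) := by
  rw [volume_pi_pi]
  refine Finset.prod_congr rfl fun i _ => ?_
  rw [Real.volume_Icc]
  congr 1; ring

theorem volume_preimage_ofLp {ι : Type*} [Fintype ι] {s : Set (ι → ℝ)} (hs : MeasurableSet s) :
    volume ((fun y : EuclideanSpace ℝ ι => (y : ι → ℝ)) ⁻¹' s) = volume s :=
  (PiLp.volume_preserving_ofLp ι).measure_preimage hs.nullMeasurableSet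

theorem volume_slab_le {e : Euc (n + 1)} (he : ‖e‖ = 1) {ε R : ℝ} (hε : 0 ≤ ε) (hR : 0 ≤ R) :
    volume {y : Euc (n + 1) | |⟪e, y⟫| ≤ ε ∧ ‖y‖ ≤ R} ≤
      ENNReal.ofReal (2 * ε * (2 * R) ^ n) := by
  have horth : Orthonormal ℝ (({0} : Set (Fin (n + 1))).domRestrict fun _ => e) := by
    rw [orthonormal_iff_ite]
    rintro ⟨i, hi⟩ ⟨j, hj⟩
    rw [mem_singleton_iff] at hi hj
    subst hi; subst hj
    simp [he]
  obtain ⟨b, hb⟩ := horth.exists_orthonormalBasis_extension_of_card_eq (by simp)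
  have hb0 : b 0 = e := hb 0 rfl
  set c : Fin (n + 1) → ℝ := Fin.cons ε fun _ => R with hc
  set box : Set (Fin (n + 1) → ℝ) := univ.pi fun i => Icc (-c i) (c i) with hbox
  have hbm : MeasurableSet box := MeasurableSet.univ_pi fun i => measurableSet_Icc
  have hsub : {y : Euc (n + 1) | |⟪e, y⟫| ≤ ε ∧ ‖y‖ ≤ R} ⊆
      b.repr ⁻¹' ((fun y : Euc (n + 1) => (y : Fin (n + 1) → ℝ)) ⁻¹' box) := by
    rintro y ⟨h1, h2⟩ i -
    rw [mem_Icc, ← abs_le]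
    change |b.repr y i| ≤ c i
    refine Fin.cases ?_ (fun j => ?_) i
    · rw [hc, Fin.cons_zero, b.repr_apply_apply, hb0]; exact h1
    · rw [hc, Fin.cons_succ, b.repr_apply_apply]
      refine (abs_real_inner_le_norm _ _).trans ?_
      rw [b.orthonormal.1, one_mul]; exact h2
  refine (measure_mono hsub).trans ?_
  rw [b.measurePreserving_repr.measure_preimage
    ((PiLp.volume_preserving_ofLp _).measurable hbm).nullMeasurableSet, volume_preimage_ofLp hbm,
    volume_pi_cube, ← ENNReal.ofReal_prod_of_nonneg]
  · rw [Fin.prod_univ_succ]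
    simp [hc]
  · intro i _
    refine Fin.cases ?_ (fun j => ?_) i
    · simp [hc, hε]
    · simp [hc, hR]

/-- The cone over the strip inside the unit ball lies in the slab `|⟪e, y⟫| ≤ ε`, and the measure of
the strip is `n + 1` times the volume of that cone. -/
theorem sphMeasure_strip_le {e : Euc (n + 1)} (he : ‖e‖ = 1) {ε : ℝ} (hε : 0 ≤ ε) :
    sphMeasure n {ζ | |⟪e, (ζ : Euc (n + 1))⟫| < ε} ≤ ENNReal.ofReal ((n + 1) * 2 ^ (n + 1) * ε) := by
  set F : Euc (n + 1) → ℝ≥0∞ := {y | |⟪e, y⟫| < ε}.indicator 1 with hF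
  have hopen : IsOpen {y : Euc (n + 1) | |⟪e, y⟫| < ε} :=
    isOpen_lt (by fun_prop) continuous_const
  have hFm : Measurable fun ζ : Metric.sphere (0 : Euc (n + 1)) 1 => F ζ :=
    (measurable_one.indicator hopen.measurableSet).comp measurable_subtype_coe
  have h := lintegral_ball_radial hFm
  have h1 : ∫⁻ ζ : Metric.sphere (0 : Euc (n + 1)) 1, F ζ ∂(sphMeasure n) =
      sphMeasure n {ζ | |⟪e, (ζ : Euc (n + 1))⟫| < ε} := by
    have hm : MeasurableSet {ζ : Metric.sphere (0 : Euc (n + 1)) 1 | |⟪e, (ζ : Euc (n + 1))⟫| < ε} :=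
      (hopen.preimage continuous_subtype_val).measurableSet
    rw [← lintegral_indicator_one hm]
    rfl
  have h2 : ∫⁻ y in Metric.ball (0 : Euc (n + 1)) 1, F (‖y‖⁻¹ • y) ≤
      ENNReal.ofReal (2 * ε * (2 * 1) ^ n) := by
    refine le_trans ?_ (volume_slab_le he hε zero_le_one)
    rw [← lintegral_indicator Metric.isOpen_ball.measurableSet]
    have hm : MeasurableSet {y : Euc (n + 1) | |⟪e, y⟫| ≤ ε ∧ ‖y‖ ≤ 1} :=
      ((isClosed_le (f := fun y : Euc (n + 1) => |⟪e, y⟫|) (by fun_prop) continuous_const).inter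
        (isClosed_le continuous_norm continuous_const)).measurableSet
    rw [← lintegral_indicator_one hm]
    refine lintegral_mono fun y => ?_
    by_cases hy : y ∈ Metric.ball (0 : Euc (n + 1)) 1
    · rw [indicator_of_mem hy]
      by_cases hy2 : ‖y‖⁻¹ • y ∈ {y : Euc (n + 1) | |⟪e, y⟫| < ε}
      · have hmem : y ∈ {y : Euc (n + 1) | |⟪e, y⟫| ≤ ε ∧ ‖y‖ ≤ 1} := ?_
        · rw [hF, indicator_of_mem hy2, indicator_of_mem hmem]; exact le_rfl
        rw [mem_ball_zero_iff] at hy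
        refine ⟨?_, hy.le⟩
        have hy3 : ‖y‖⁻¹ * |⟪e, y⟫| < ε := by
          have : |⟪e, ‖y‖⁻¹ • y⟫| < ε := hy2
          rwa [real_inner_smul_right, abs_mul, abs_of_nonneg (inv_nonneg.mpr (norm_nonneg y))]
            at this
        rcases eq_or_ne y 0 with rfl | h0
        · simp [hε]
        · have hpos := norm_pos_iff.mpr h0
          rw [inv_mul_lt_iff₀ hpos] at hy3
          have h4 : ‖y‖ * ε ≤ 1 * ε := mul_le_mul_of_nonneg_right hy.le hε
          linarith
      · rw [hF, indicator_of_notMem hy2]; exact zero_le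
    · rw [indicator_of_notMem hy]; exact zero_le
  rw [h, h1] at h2
  have hn : (0 : ℝ) < n + 1 := by positivity
  have h3 := mul_le_mul_left h2 (ENNReal.ofReal (n + 1))
  rw [mul_assoc, ← ENNReal.ofReal_mul (by positivity), one_div_mul_cancel hn.ne',
    ENNReal.ofReal_one, mul_one, ← ENNReal.ofReal_mul (by positivity)] at h3
  refine h3.trans (ENNReal.ofReal_le_ofReal (le_of_eq ?_))
  ring

/-- In polar coordinates `{N < 1}` is star-shaped with radius `1 / N ζ` in direction `ζ`. -/
theorem lintegral_sphere_rpow_le {N : Euc (n + 1) → ℝ} (hN : Continuous N)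
    (hhom : ∀ (r : ℝ) (y : Euc (n + 1)), 0 < r → N (r • y) = r * N y)
    (hpos : ∀ ζ, ‖ζ‖ = 1 → 0 < N ζ) :
    ∫⁻ ζ : Metric.sphere (0 : Euc (n + 1)) 1, ENNReal.ofReal ((N ζ ^ (n + 1))⁻¹) ∂(sphMeasure n) ≤
      ENNReal.ofReal (n + 1) * volume {y | N y < 1} := by
  have hopen : IsOpen {y : Euc (n + 1) | N y < 1} := isOpen_lt hN continuous_const
  have hm : MeasurableSet {p : Metric.sphere (0 : Euc (n + 1)) 1 × Ioi (0 : ℝ) |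
      N ((p.2 : ℝ) • (p.1 : Euc (n + 1))) < 1} :=
    (isOpen_lt (f := fun p : Metric.sphere (0 : Euc (n + 1)) 1 × Ioi (0 : ℝ) =>
      N ((p.2 : ℝ) • (p.1 : Euc (n + 1)))) (by fun_prop) continuous_const).measurableSet
  have hn : (0 : ℝ) < n + 1 := by positivity
  rw [← lintegral_indicator_one hopen.measurableSet, polar_lintegral, lintegral_prod]
  swap
  · exact (measurable_one.indicator hm).aemeasurable
  rw [← lintegral_const_mul']
  swap
  · exact ENNReal.ofReal_ne_top
  refine le_of_eq (lintegral_congr fun ζ => ?_)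
  have hNζ := hpos ζ (by simp)
  have h1 : ∀ r : Ioi (0 : ℝ), ({y : Euc (n + 1) | N y < 1}.indicator 1
      ((r : ℝ) • (ζ : Euc (n + 1))) : ℝ≥0∞) =
      (Iio (⟨(N ζ)⁻¹, mem_Ioi.mpr (inv_pos.mpr hNζ)⟩ : Ioi (0 : ℝ))).indicator 1 r := fun r => by
    have h2 : N ((r : ℝ) • (ζ : Euc (n + 1))) < 1 ↔ (r : ℝ) < (N ζ)⁻¹ := by
      rw [hhom _ _ r.2, lt_inv_comm₀ r.2 hNζ, ← one_div, lt_div_iff₀ r.2, mul_comm]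
    by_cases h3 : (r : ℝ) < (N ζ)⁻¹
    · rw [indicator_of_mem, indicator_of_mem]
      · rfl
      · exact h3
      · exact h2.mpr h3
    · rw [indicator_of_notMem, indicator_of_notMem]
      · exact h3
      · exact fun h => h3 (h2.mp h)
  rw [lintegral_congr h1, lintegral_indicator_one measurableSet_Iio,
    Measure.volumeIoiPow_apply_Iio, ← ENNReal.ofReal_mul hn.le, mul_div_cancel₀ _ hn.ne', inv_pow]

/-- The matrix whose rows are the given vectors. -/
def rowMatrix (x : Fin (n + 1) → Euc (n + 1)) : Matrix (Fin (n + 1)) (Fin (n + 1)) ℝ :=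
  Matrix.of fun i j => x i j

theorem rowMatrix_mulVec (x : Fin (n + 1) → Euc (n + 1)) (y : Euc (n + 1)) (i : Fin (n + 1)) :
    (rowMatrix x).mulVec y i = ⟪x i, y⟫ := by
  simp [rowMatrix, Matrix.mulVec, dotProduct, PiLp.inner_apply, mul_comm]

theorem volume_dual_parallelepiped_le {x : Fin (n + 1) → Euc (n + 1)}
    (hx : (rowMatrix x).det ≠ 0) :
    volume {y : Euc (n + 1) | ∑ i, |⟪x i, y⟫| < 1} ≤
      ENNReal.ofReal (2 ^ (n + 1) / |(rowMatrix x).det|) := by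
  set box : Set (Fin (n + 1) → ℝ) := univ.pi fun i => Icc (-1) 1 with hbox
  have hbm : MeasurableSet box := MeasurableSet.univ_pi fun i => measurableSet_Icc
  have hdet : LinearMap.det (Matrix.toLin' (rowMatrix x)) ≠ 0 := by rwa [LinearMap.det_toLin']
  have hsub : {y : Euc (n + 1) | ∑ i, |⟪x i, y⟫| < 1} ⊆
      (fun y : Euc (n + 1) => (y : Fin (n + 1) → ℝ)) ⁻¹'
        ((Matrix.toLin' (rowMatrix x)) ⁻¹' box) := by
    intro y hy i _
    rw [Matrix.toLin'_apply, rowMatrix_mulVec, mem_Icc, ← abs_le]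
    have h1 : |⟪x i, y⟫| ≤ ∑ i, |⟪x i, y⟫| :=
      Finset.single_le_sum (f := fun i => |⟪x i, y⟫|) (fun j _ => abs_nonneg _) (Finset.mem_univ i)
    exact h1.trans (le_of_lt hy)
  refine (measure_mono hsub).trans ?_
  rw [volume_preimage_ofLp ((LinearMap.continuous_of_finiteDimensional _).measurable hbm),
    Measure.addHaar_preimage_linearMap _ hdet, LinearMap.det_toLin', hbox,
    volume_pi_cube (fun _ => (1 : ℝ)), ← ENNReal.ofReal_prod_of_nonneg (by simp),
    ← ENNReal.ofReal_mul (abs_nonneg _)]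
  refine ENNReal.ofReal_le_ofReal (le_of_eq ?_)
  rw [abs_inv]
  simp
  ring

/-- A compact set with interior contains vectors `pᵢ - qᵢ` whose determinant controls its volume. -/
theorem exists_maximal_det {K : Set (Euc (n + 1))} (hK : IsCompact K) {z : Euc (n + 1)} {r : ℝ}
    (hr : 0 < r) (hball : Metric.closedBall z r ⊆ K) :
    ∃ p q : Fin (n + 1) → Euc (n + 1), (∀ i, p i ∈ K) ∧ (∀ i, q i ∈ K) ∧
      (rowMatrix fun i => p i - q i).det ≠ 0 ∧
      volume K ≤ ENNReal.ofReal (2 ^ (n + 1) * |(rowMatrix fun i => p i - q i).det|) := by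
  have hzK : z ∈ K := hball (Metric.mem_closedBall_self hr.le)
  set F : (Fin (n + 1) → Euc (n + 1)) × (Fin (n + 1) → Euc (n + 1)) → ℝ :=
    fun s => |(rowMatrix fun i => s.1 i - s.2 i).det| with hF
  have hFc : Continuous F := by
    refine continuous_abs.comp (Continuous.matrix_det ?_)
    refine continuous_matrix fun i j => ?_
    simp only [rowMatrix, Matrix.of_apply]
    fun_prop
  have hKK : IsCompact ((univ.pi fun _ : Fin (n + 1) => K) ×ˢ (univ.pi fun _ : Fin (n + 1) => K)) :=
    (isCompact_univ_pi fun _ => hK).prod (isCompact_univ_pi fun _ => hK)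
  obtain ⟨⟨p, q⟩, ⟨hp, hq⟩, hmax⟩ := hKK.exists_isMaxOn ⟨(fun _ => z, fun _ => z),
    fun _ _ => hzK, fun _ _ => hzK⟩ hFc.continuousOn
  have hmax' : ∀ p' q' : Fin (n + 1) → Euc (n + 1), (∀ i, p' i ∈ K) → (∀ i, q' i ∈ K) →
      F (p', q') ≤ F (p, q) := fun p' q' h1 h2 => hmax ⟨fun i _ => h1 i, fun i _ => h2 i⟩
  -- The ball supplies a competitor with nonzero determinant, the vectors `r e_i`.
  have hdet : (rowMatrix fun i => p i - q i).det ≠ 0 := by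
    have h1 := hmax' (fun i => z + r • EuclideanSpace.single i 1) (fun _ => z)
      (fun i => hball (by simp [norm_smul, abs_of_pos hr])) (fun _ => hzK)
    have h2 : (rowMatrix fun i : Fin (n + 1) => z + r • EuclideanSpace.single i (1 : ℝ) - z) =
        r • (1 : Matrix (Fin (n + 1)) (Fin (n + 1)) ℝ) := by
      ext i j
      simp [rowMatrix, Matrix.one_apply, eq_comm]
    simp only [hF, h2, Matrix.det_smul, Matrix.det_one, mul_one] at h1
    intro h0
    rw [h0, abs_zero] at h1
    have : 0 < |r ^ Fintype.card (Fin (n + 1))| := abs_pos.mpr (pow_ne_zero _ hr.ne')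
    linarith
  refine ⟨p, q, fun i => hp i (mem_univ i), fun i => hq i (mem_univ i), hdet, ?_⟩
  set D := rowMatrix fun i => p i - q i with hD
  set box : Set (Fin (n + 1) → ℝ) := univ.pi fun i => Icc (-1) 1 with hbox
  have hbc : IsCompact box := isCompact_univ_pi fun _ => isCompact_Icc
  have himg : MeasurableSet (Matrix.toLin' D.transpose '' box) :=
    (hbc.image (LinearMap.continuous_of_finiteDimensional _)).isClosed.measurableSet
  -- By Cramer's rule the `i`-th coordinate of `y - z` in the rows of `D` is the quotient of two
  -- determinants. The numerator arises by replacing the pair `(p i, q i)` with `(y, z)`, so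
  -- maximality bounds the quotient by one, and `K` lies in a translate of the image of the cube
  -- under `Dᵀ`.
  have hsub : K ⊆ (fun y => y + -z) ⁻¹' ((fun y : Euc (n + 1) => (y : Fin (n + 1) → ℝ)) ⁻¹'
      (Matrix.toLin' D.transpose '' box)) := by
    intro y hy
    refine ⟨D.det⁻¹ • Matrix.cramer D.transpose (y + -z : Euc (n + 1)), fun i _ => ?_, ?_⟩
    · rw [mem_Icc, ← abs_le, Pi.smul_apply, Matrix.cramer_transpose_apply, smul_eq_mul, abs_mul,
        abs_inv, inv_mul_le_iff₀ (abs_pos.mpr hdet), mul_one]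
      have h1 := hmax' (Function.update p i y) (Function.update q i z)
        (fun j => by
          rcases eq_or_ne j i with rfl | h
          · rw [Function.update_self]; exact hy
          · rw [Function.update_of_ne h]; exact hp j (mem_univ j))
        (fun j => by
          rcases eq_or_ne j i with rfl | h
          · rw [Function.update_self]; exact hzK
          · rw [Function.update_of_ne h]; exact hq j (mem_univ j))
      refine le_trans (le_of_eq ?_) h1
      simp only [hF]
      congr 2
      ext j k
      rcases eq_or_ne j i with rfl | h
      · simp [rowMatrix, sub_eq_add_neg]
      · simp [rowMatrix, hD, Matrix.updateRow_ne h, Function.update_of_ne h]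
    · rw [map_smul, Matrix.toLin'_apply, Matrix.mulVec_cramer, Matrix.det_transpose, smul_smul,
        inv_mul_cancel₀ hdet, one_smul]
  refine (measure_mono hsub).trans ?_
  rw [measure_preimage_add_right, volume_preimage_ofLp himg, Measure.addHaar_image_linearMap,
    LinearMap.det_toLin', Matrix.det_transpose, hbox, volume_pi_cube (fun _ => (1 : ℝ)),
    ← ENNReal.ofReal_prod_of_nonneg (by simp), ← ENNReal.ofReal_mul (abs_nonneg _)]
  refine ENNReal.ofReal_le_ofReal (le_of_eq ?_)
  simp
  ring

end Volumes

/-! ### From negative moments of the support function to the diameter -/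

section Diameter

variable {n : ℕ} {M : Type*} [TopologicalSpace M] [CompactSpace M] [Nonempty M]

/-- The centre `z` is the average of the `2 (n + 2)` points `p i`, `q i`, `a`, `b`. For two points
of the body, `|⟪y - w, ζ⟫|` is at most the sum of their distances to the supporting hyperplane, and
these distances average to that of `z`. -/
theorem exists_center_inner_le {X : M → Euc (n + 1)} (hX : Continuous X) {z₀ : Euc (n + 1)} {r : ℝ}
    (hr : 0 < r) (hball : Metric.closedBall z₀ r ⊆ body X) {a b : Euc (n + 1)} (ha : a ∈ body X)
    (hb : b ∈ body X) :
    ∃ (x : Fin (n + 1) → Euc (n + 1)) (z : Euc (n + 1)), (rowMatrix x).det ≠ 0 ∧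
      enclosedVolume X ≤ 2 ^ (n + 1) * |(rowMatrix x).det| ∧
      ∀ ζ, ∑ i, |⟪x i, ζ⟫| + |⟪a - b, ζ⟫| ≤ 2 * (n + 2) * (supportFunction X ζ - ⟪ζ, z⟫) := by
  obtain ⟨p, q, hp, hq, hdet, hvol⟩ := exists_maximal_det (isCompact_body hX) hr hball
  refine ⟨fun i => p i - q i, (1 / (2 * (n + 2)) : ℝ) • (∑ i, (p i + q i) + (a + b)), hdet, ?_,
    fun ζ => ?_⟩
  · rw [volume_body hX] at hvol
    exact (ENNReal.ofReal_le_ofReal_iff (by positivity)).mp hvol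
  · have h : ∀ y ∈ body X, ∀ w ∈ body X, |⟪y - w, ζ⟫| ≤
        (supportFunction X ζ - ⟪ζ, y⟫) + (supportFunction X ζ - ⟪ζ, w⟫) := fun y hy w hw => by
      have h1 := inner_le_of_mem_body hX hy ζ
      have h2 := inner_le_of_mem_body hX hw ζ
      rw [inner_sub_left, real_inner_comm, real_inner_comm ζ w, abs_le]
      constructor <;> linarith
    have h1 : ∑ i, |⟪p i - q i, ζ⟫| ≤ ∑ i, ((supportFunction X ζ - ⟪ζ, p i⟫) +
        (supportFunction X ζ - ⟪ζ, q i⟫)) :=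
      Finset.sum_le_sum fun i _ => h _ (hp i) _ (hq i)
    have h2 := h a ha b hb
    have hn : (0 : ℝ) < 2 * (n + 2) := by positivity
    have h3 : 2 * ((n : ℝ) + 2) * (supportFunction X ζ -
        ⟪ζ, (1 / (2 * (n + 2)) : ℝ) • (∑ i, (p i + q i) + (a + b))⟫) =
        (∑ i, ((supportFunction X ζ - ⟪ζ, p i⟫) + (supportFunction X ζ - ⟪ζ, q i⟫))) +
        ((supportFunction X ζ - ⟪ζ, a⟫) + (supportFunction X ζ - ⟪ζ, b⟫)) := by
      rw [real_inner_smul_right, mul_sub, ← mul_assoc, mul_one_div_cancel hn.ne', one_mul,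
        inner_add_right, inner_sum, inner_add_right]
      simp only [inner_add_right, Finset.sum_add_distrib, Finset.sum_sub_distrib, Finset.sum_const,
        Finset.card_univ, Fintype.card_fin, nsmul_eq_mul]
      push_cast
      ring
    rw [h3]
    exact add_le_add h1 h2

/-- Three regimes: `g ≥ δ`; `g < δ` with `N ≥ r`; and `N < r`, where `N^(-q) ≤ r^(m-q) N^(-m)`. The
last trade is made because for `m = n + 1` the integral of `N^(-m)` over the sphere is a volume. -/
theorem rpow_neg_add_le {N g δ r q : ℝ} {m : ℕ} (hN : 0 < N) (hg : 0 ≤ g) (hδ : 0 < δ)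
    (hr : 0 < r) (hq : 0 < q) (hqm : q < m) :
    (N + g) ^ (-q) ≤ δ ^ (-q) + (if g < δ then r ^ (-q) else 0) + r ^ (m - q) * (N ^ m)⁻¹ := by
  have h1 : 0 < r ^ ((m : ℝ) - q) * (N ^ m)⁻¹ :=
    mul_pos (Real.rpow_pos_of_pos hr _) (inv_pos.mpr (pow_pos hN m))
  have h2 : 0 < δ ^ (-q) := Real.rpow_pos_of_pos hδ _
  have h3 : 0 < r ^ (-q) := Real.rpow_pos_of_pos hr _
  split_ifs with hgd
  · rcases le_total r N with h | h
    · have h4 : (N + g) ^ (-q) ≤ r ^ (-q) :=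
        Real.rpow_le_rpow_of_nonpos hr (by linarith) (by linarith)
      linarith
    · have h4 : (N + g) ^ (-q) ≤ N ^ (-q) :=
        Real.rpow_le_rpow_of_nonpos hN (by linarith) (by linarith)
      have h5 : N ^ (-q) = N ^ ((m : ℝ) - q) * (N ^ m)⁻¹ := by
        rw [← Real.rpow_natCast N m, ← Real.rpow_neg hN.le, ← Real.rpow_add hN]
        congr 1; ring
      have h6 : N ^ ((m : ℝ) - q) * (N ^ m)⁻¹ ≤ r ^ ((m : ℝ) - q) * (N ^ m)⁻¹ :=
        mul_le_mul_of_nonneg_right (Real.rpow_le_rpow hN.le h (by linarith))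
          (inv_pos.mpr (pow_pos hN m)).le
      linarith
  · have h4 : (N + g) ^ (-q) ≤ δ ^ (-q) :=
      Real.rpow_le_rpow_of_nonpos hδ (by linarith [not_lt.mp hgd]) (by linarith)
    linarith

theorem integral_sphere_dual_le {x : Fin (n + 1) → Euc (n + 1)} (hx : (rowMatrix x).det ≠ 0)
    (hpos : ∀ ζ : Euc (n + 1), ‖ζ‖ = 1 → 0 < ∑ i, |⟪x i, ζ⟫|) :
    ∫ ζ : Metric.sphere (0 : Euc (n + 1)) 1, ((∑ i, |⟪x i, (ζ : Euc (n + 1))⟫|) ^ (n + 1))⁻¹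
      ∂(sphMeasure n) ≤ (n + 1) * (2 ^ (n + 1) / |(rowMatrix x).det|) := by
  have hc : Continuous fun y : Euc (n + 1) => ∑ i, |⟪x i, y⟫| := by fun_prop
  have h := lintegral_sphere_rpow_le hc (fun r y hr => by
    rw [Finset.mul_sum]
    refine Finset.sum_congr rfl fun i _ => ?_
    rw [real_inner_smul_right, abs_mul, abs_of_pos hr]) hpos
  have hcont : Continuous fun ζ : Metric.sphere (0 : Euc (n + 1)) 1 =>
      ((∑ i, |⟪x i, (ζ : Euc (n + 1))⟫|) ^ (n + 1))⁻¹ :=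
    ((hc.comp continuous_subtype_val).pow (n + 1)).inv₀ fun ζ =>
      (pow_pos (hpos ζ (by simp)) _).ne'
  rw [← ofReal_integral_eq_lintegral_ofReal (Continuous.integrable_sphere hcont)
    (ae_of_all _ fun ζ => (inv_pos.mpr (pow_pos (hpos ζ (by simp)) _)).le)] at h
  have h2 := h.trans (mul_le_mul_right (volume_dual_parallelepiped_le hx) _)
  rw [← ENNReal.ofReal_mul (by positivity)] at h2
  exact (ENNReal.ofReal_le_ofReal_iff (by positivity)).mp h2

/-- Here `N` is the parallelepiped part of the lower bound and `|⟪a - b, ζ⟫|` the long part, which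
is at least `ε * ‖a - b‖` off a strip of measure of order `ε`. The factor `4 ^ (n + 1)` combines the
bound on the dual parallelepiped with the lower bound on the determinant in terms of the volume. -/
theorem integral_rpow_neg_le {q : ℝ} (hq : 0 < q) (hqn : q < n + 1)
    {X : M → Euc (n + 1)} (hX : Continuous X) {z₀ : Euc (n + 1)} {s : ℝ} (hs : 0 < s)
    (hball : Metric.closedBall z₀ s ⊆ body X) (hV : 0 < enclosedVolume X)
    {a b : Euc (n + 1)} (ha : a ∈ body X) (hb : b ∈ body X) (hab : a ≠ b) :
    ∃ z : Euc (n + 1), (∀ ζ, ‖ζ‖ = 1 → 0 < supportFunction X ζ - ⟪ζ, z⟫) ∧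
      ∀ r > 0, ∀ ε > 0,
        ∫ ζ : Metric.sphere (0 : Euc (n + 1)) 1,
          (supportFunction X ζ - ⟪(ζ : Euc (n + 1)), z⟫) ^ (-q) ∂(sphMeasure n) ≤
        (2 * (n + 2)) ^ q * ((sphMeasure n).real univ * (ε * ‖a - b‖) ^ (-q) +
          (n + 1) * 2 ^ (n + 1) * ε * r ^ (-q) +
          r ^ (n + 1 - q) * ((n + 1) * 4 ^ (n + 1) / enclosedVolume X)) := by
  obtain ⟨x, z, hdet, hvol, hle⟩ := exists_center_inner_le hX hs hball ha hb
  set L := ‖a - b‖ with hL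
  have hLpos : 0 < L := norm_pos_iff.mpr (sub_ne_zero.mpr hab)
  set e := L⁻¹ • (a - b) with he
  have he1 : ‖e‖ = 1 := by rw [he, norm_smul, norm_inv, Real.norm_eq_abs, abs_of_pos hLpos,
    inv_mul_cancel₀ hLpos.ne']
  have hge : ∀ ζ : Euc (n + 1), |⟪a - b, ζ⟫| = L * |⟪e, ζ⟫| := fun ζ => by
    rw [he, real_inner_smul_left, abs_mul, abs_inv, abs_of_pos hLpos, ← mul_assoc,
      mul_inv_cancel₀ hLpos.ne', one_mul]
  set N : Euc (n + 1) → ℝ := fun ζ => ∑ i, |⟪x i, ζ⟫| with hN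
  have hNpos : ∀ ζ : Euc (n + 1), ‖ζ‖ = 1 → 0 < N ζ := fun ζ hζ => by
    refine lt_of_le_of_ne (Finset.sum_nonneg fun i _ => abs_nonneg _) fun h0 => ?_
    have h1 := (Finset.sum_eq_zero_iff_of_nonneg fun i _ => abs_nonneg _).mp h0.symm
    have h2 : (rowMatrix x).mulVec ζ = 0 := by
      funext i
      rw [rowMatrix_mulVec]
      exact abs_eq_zero.mp (h1 i (Finset.mem_univ i))
    have h3 := Matrix.eq_zero_of_mulVec_eq_zero hdet h2
    have h4 : ζ = 0 := by ext i; exact congrFun h3 i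
    rw [h4, norm_zero] at hζ
    exact zero_ne_one hζ
  have hk : (0 : ℝ) < 2 * (n + 2) := by positivity
  set u : Euc (n + 1) → ℝ := fun ζ => supportFunction X ζ - ⟪ζ, z⟫ with hu
  have hle' : ∀ ζ, (N ζ + |⟪a - b, ζ⟫|) / (2 * (n + 2)) ≤ u ζ := fun ζ => by
    rw [div_le_iff₀ hk, mul_comm]; exact hle ζ
  have hupos : ∀ ζ : Euc (n + 1), ‖ζ‖ = 1 → 0 < u ζ := fun ζ hζ =>
    lt_of_lt_of_le (div_pos (add_pos_of_pos_of_nonneg (hNpos ζ hζ) (abs_nonneg _)) hk) (hle' ζ)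
  refine ⟨z, hupos, fun r hr ε hε => ?_⟩
  set St : Set (Metric.sphere (0 : Euc (n + 1)) 1) := {ζ | |⟪e, (ζ : Euc (n + 1))⟫| < ε} with hSt
  have hStm : MeasurableSet St :=
    (isOpen_lt (f := fun ζ : Metric.sphere (0 : Euc (n + 1)) 1 => |⟪e, (ζ : Euc (n + 1))⟫|)
      (by fun_prop) continuous_const).measurableSet
  have hNc : Continuous N := by fun_prop
  have i1 : Integrable (fun _ : Metric.sphere (0 : Euc (n + 1)) 1 => (ε * L) ^ (-q))
    (sphMeasure n) := integrable_const _
  have i2 : Integrable (St.indicator fun _ => r ^ (-q)) (sphMeasure n) :=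
    (integrable_const _).indicator hStm
  have i3 : Integrable (fun ζ : Metric.sphere (0 : Euc (n + 1)) 1 =>
      r ^ ((n : ℝ) + 1 - q) * (N ζ ^ (n + 1))⁻¹) (sphMeasure n) :=
    (Continuous.integrable_sphere (((hNc.comp continuous_subtype_val).pow (n + 1)).inv₀ fun ζ =>
      (pow_pos (hNpos ζ (by simp)) _).ne')).const_mul _
  have hpt : ∀ ζ : Metric.sphere (0 : Euc (n + 1)) 1, u ζ ^ (-q) ≤ (2 * ((n : ℝ) + 2)) ^ q *
      ((ε * L) ^ (-q) + St.indicator (fun _ => r ^ (-q)) ζ +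
        r ^ ((n : ℝ) + 1 - q) * (N ζ ^ (n + 1))⁻¹) := fun ζ => by
    have hζ : ‖(ζ : Euc (n + 1))‖ = 1 := by simp
    have hsum : 0 < N ζ + |⟪a - b, (ζ : Euc (n + 1))⟫| :=
      add_pos_of_pos_of_nonneg (hNpos ζ hζ) (abs_nonneg _)
    have h1 : u ζ ^ (-q) ≤ ((N ζ + |⟪a - b, (ζ : Euc (n + 1))⟫|) / (2 * (n + 2))) ^ (-q) :=
      Real.rpow_le_rpow_of_nonpos (div_pos hsum hk) (hle' ζ) (by linarith)
    have h2 : ((N ζ + |⟪a - b, (ζ : Euc (n + 1))⟫|) / (2 * ((n : ℝ) + 2))) ^ (-q) =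
        (2 * ((n : ℝ) + 2)) ^ q * (N ζ + |⟪a - b, (ζ : Euc (n + 1))⟫|) ^ (-q) := by
      rw [Real.div_rpow hsum.le hk.le, Real.rpow_neg hk.le, div_inv_eq_mul, mul_comm]
    rw [h2] at h1
    refine h1.trans (mul_le_mul_of_nonneg_left ?_ (Real.rpow_nonneg hk.le _))
    have h3 := rpow_neg_add_le (m := n + 1) (hNpos ζ hζ)
      (abs_nonneg ⟪a - b, (ζ : Euc (n + 1))⟫) (mul_pos hε hLpos) hr hq (by push_cast; exact hqn)
    push_cast at h3
    refine h3.trans (le_of_eq ?_)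
    congr 2
    rw [indicator_apply]
    refine if_congr ?_ rfl rfl
    rw [hge, mul_comm ε L, mul_lt_mul_iff_right₀ hLpos]
    rfl
  have hint : ∫ ζ : Metric.sphere (0 : Euc (n + 1)) 1, u ζ ^ (-q) ∂(sphMeasure n) ≤
      ∫ ζ : Metric.sphere (0 : Euc (n + 1)) 1, (2 * ((n : ℝ) + 2)) ^ q *
      ((ε * L) ^ (-q) + St.indicator (fun _ => r ^ (-q)) ζ +
        r ^ ((n : ℝ) + 1 - q) * (N ζ ^ (n + 1))⁻¹) ∂(sphMeasure n) :=
    integral_mono_of_nonneg (ae_of_all _ fun ζ => Real.rpow_nonneg (hupos ζ (by simp)).le _)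
      (((i1.add i2).add i3).const_mul _) (ae_of_all _ hpt)
  refine hint.trans ?_
  rw [integral_const_mul, integral_add (f := fun ζ => (ε * L) ^ (-q) +
    St.indicator (fun _ => r ^ (-q)) ζ) (i1.add i2) i3, integral_add i1 i2, integral_const,
    integral_indicator_const _ hStm, integral_const_mul, smul_eq_mul, smul_eq_mul]
  refine mul_le_mul_of_nonneg_left ?_ (Real.rpow_nonneg hk.le _)
  refine add_le_add (add_le_add le_rfl ?_) ?_
  · refine mul_le_mul_of_nonneg_right ?_ (Real.rpow_nonneg hr.le _)
    exact ENNReal.toReal_le_of_le_ofReal (by positivity) (sphMeasure_strip_le he1 hε.le)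
  · refine mul_le_mul_of_nonneg_left ((integral_sphere_dual_le hdet hNpos).trans ?_)
      (Real.rpow_nonneg hr.le _)
    rw [mul_div_assoc]
    refine mul_le_mul_of_nonneg_left ?_ (by positivity)
    rw [div_le_div_iff₀ (abs_pos.mpr hdet) hV]
    have : (4 : ℝ) ^ (n + 1) = 2 ^ (n + 1) * 2 ^ (n + 1) := by rw [← mul_pow]; norm_num
    rw [this, mul_assoc]
    exact mul_le_mul_of_nonneg_left hvol (by positivity)

/-- A lower bound on negative moments of the support function bounds the diameter by the volume. -/
theorem exists_diameter_bound {q c : ℝ} (hq : 0 < q) (hqn : q < n + 1) (hc : 0 < c) :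
    ∃ C > 0, ∀ X : M → Euc (n + 1), Continuous X → 0 < enclosedVolume X →
      (∃ z₀, ∃ s > 0, Metric.closedBall z₀ s ⊆ body X) →
      (∀ p, (∀ ζ, ‖ζ‖ = 1 → 0 < supportFunction X ζ - ⟪ζ, p⟫) →
        c ≤ enclosedVolume X ^ (q / (n + 1)) * ∫ ζ : Metric.sphere (0 : Euc (n + 1)) 1,
          (supportFunction X ζ - ⟪(ζ : Euc (n + 1)), p⟫) ^ (-q) ∂(sphMeasure n)) →
      ∀ x y, ‖X x - X y‖ ≤ C * enclosedVolume X ^ (1 / ((n : ℝ) + 1)) := by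
  have hn : (0 : ℝ) < n + 1 := by positivity
  set k : ℝ := (2 * ((n : ℝ) + 2)) ^ q with hk
  have hkpos : 0 < k := by positivity
  set σ : ℝ := (sphMeasure n).real univ with hσ
  have hσ0 : 0 ≤ σ := measureReal_nonneg
  set c₂ : ℝ := (n + 1) * 4 ^ (n + 1) with hc₂
  set c₁ : ℝ := (n + 1) * 2 ^ (n + 1) with hc₁
  have hc₂0 : 0 < c₂ := by positivity
  have hc₁0 : 0 < c₁ := by positivity
  -- `ρ` and then `ε` are chosen so that, with `r = ρ V^(1/(n+1))`, the contribution of small `N`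
  -- and that of the strip each equal `c / 3`. The long part must supply the remaining third, which
  -- bounds the length; `σ + 1` replaces `σ` to keep `C` visibly positive.
  set ρ : ℝ := (c / (3 * k * c₂)) ^ (1 / ((n : ℝ) + 1 - q)) with hρ
  have hρ0 : 0 < ρ := by positivity
  have hρ1 : k * (ρ ^ ((n : ℝ) + 1 - q) * c₂) = c / 3 := by
    rw [hρ, ← Real.rpow_mul (by positivity), one_div_mul_cancel (by linarith), Real.rpow_one]
    field_simp
  set ε : ℝ := c * ρ ^ q / (3 * k * c₁) with hε
  have hε0 : 0 < ε := by positivity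
  have hε1 : k * (c₁ * ε * ρ ^ (-q)) = c / 3 := by
    rw [hε, Real.rpow_neg hρ0.le]
    have := (Real.rpow_pos_of_pos hρ0 q).ne'
    field_simp
  set C : ℝ := (3 * k * (σ + 1) / c) ^ (1 / q) / ε with hC
  have hC0 : 0 < C := by positivity
  refine ⟨C, hC0, fun X hX hV ⟨z₀, s, hs, hball⟩ hent x y => ?_⟩
  set V := enclosedVolume X
  set W : ℝ := V ^ (1 / ((n : ℝ) + 1)) with hW
  have hW0 : 0 < W := Real.rpow_pos_of_pos hV _
  have hVW : V = W ^ ((n : ℝ) + 1) := by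
    rw [hW, ← Real.rpow_mul hV.le, one_div_mul_cancel hn.ne', Real.rpow_one]
  have hVq : V ^ (q / ((n : ℝ) + 1)) = W ^ q := by
    rw [hW, ← Real.rpow_mul hV.le]; congr 1; ring
  rcases eq_or_ne (X x) (X y) with hxy | hxy
  · rw [hxy, sub_self, norm_zero]; positivity
  obtain ⟨z, hz, hzle⟩ := integral_rpow_neg_le hq hqn hX hs hball hV
    (subset_convexHull ℝ _ ⟨x, rfl⟩) (subset_convexHull ℝ _ ⟨y, rfl⟩) hxy
  set L := ‖X x - X y‖ with hL
  have hL0 : 0 < L := norm_pos_iff.mpr (sub_ne_zero.mpr hxy)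
  have h1 := hent z hz
  have h2 := h1.trans (mul_le_mul_of_nonneg_left (hzle (ρ * W) (by positivity) ε hε0)
    (Real.rpow_nonneg hV.le _))
  rw [hVq] at h2
  have e1 : W ^ q * (ρ * W) ^ (-q) = ρ ^ (-q) := by
    rw [Real.mul_rpow hρ0.le hW0.le, Real.rpow_neg hW0.le]
    have := (Real.rpow_pos_of_pos hW0 q).ne'
    field_simp
  have e2 : W ^ q * ((ρ * W) ^ ((n : ℝ) + 1 - q) * (c₂ / V)) = ρ ^ ((n : ℝ) + 1 - q) * c₂ := by
    rw [hVW, Real.mul_rpow hρ0.le hW0.le, Real.rpow_sub hW0]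
    have := (Real.rpow_pos_of_pos hW0 q).ne'
    have := (Real.rpow_pos_of_pos hW0 ((n : ℝ) + 1)).ne'
    field_simp
  have e3 : W ^ q * (ε * L) ^ (-q) = (ε * L / W) ^ (-q) := by
    rw [Real.div_rpow (by positivity) hW0.le, Real.rpow_neg hW0.le, div_inv_eq_mul, mul_comm]
  have h3 : c ≤ k * σ * (ε * L / W) ^ (-q) + c / 3 + c / 3 := by
    have h4 : W ^ q * (k * (σ * (ε * L) ^ (-q) + c₁ * ε * (ρ * W) ^ (-q) +
        (ρ * W) ^ ((n : ℝ) + 1 - q) * (c₂ / V))) = k * σ * (ε * L / W) ^ (-q) +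
        k * (c₁ * ε * ρ ^ (-q)) + k * (ρ ^ ((n : ℝ) + 1 - q) * c₂) := by
      rw [← e1, ← e2, ← e3]; ring
    rw [hε1, hρ1] at h4
    exact h2.trans h4.le
  have hy0 : 0 < ε * L / W := by positivity
  have h4 : (ε * L / W) ^ q ≤ 3 * k * (σ + 1) / c := by
    rw [Real.rpow_neg hy0.le] at h3
    have h5 := Real.rpow_pos_of_pos hy0 q
    rw [le_div_iff₀ hc]
    have h6 : c / 3 ≤ k * σ / (ε * L / W) ^ q := by
      rw [div_eq_mul_inv (k * σ)]; linarith
    rw [le_div_iff₀ h5] at h6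
    nlinarith
  have h5 : ε * L / W ≤ (3 * k * (σ + 1) / c) ^ (1 / q) := by
    rw [one_div]
    exact (Real.le_rpow_inv_iff_of_pos hy0.le (by positivity) hq).mpr h4
  rw [hC, div_mul_eq_mul_div, le_div_iff₀ hε0, mul_comm L ε]
  rwa [div_le_iff₀ hW0] at h5

/-- The volume is bounded by the width in a direction and the diameter. -/
theorem enclosedVolume_le_width {X : M → Euc (n + 1)} (hX : Continuous X) {L : ℝ}
    (hL : ∀ x y, ‖X x - X y‖ ≤ L) {ζ : Euc (n + 1)} (hζ : ‖ζ‖ = 1) :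
    enclosedVolume X ≤ 2 * width X ζ * (2 * L) ^ n := by
  obtain ⟨x₀⟩ := ‹Nonempty M›
  have hL0 : 0 ≤ L := (norm_nonneg _).trans (hL x₀ x₀)
  have h1 : ∀ x, ⟪ζ, X x⟫ ≤ supportFunction X ζ := fun x => inner_le_supportFunction hX ζ x
  have h2 : ∀ x, -supportFunction X (-ζ) ≤ ⟪ζ, X x⟫ := fun x => by
    have := inner_le_supportFunction hX (-ζ) x
    rw [inner_neg_left] at this
    linarith
  have hw : 0 ≤ width X ζ := by
    have := (h2 x₀).trans (h1 x₀)
    rw [width]; linarith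
  have hsub : body X ⊆ (fun y => y + -X x₀) ⁻¹' {y | |⟪ζ, y⟫| ≤ width X ζ ∧ ‖y‖ ≤ L} := by
    refine convexHull_min ?_ ?_
    · rintro _ ⟨x, rfl⟩
      change |⟪ζ, X x + -X x₀⟫| ≤ _ ∧ ‖X x + -X x₀‖ ≤ L
      rw [← sub_eq_add_neg]
      refine ⟨?_, hL x x₀⟩
      rw [inner_sub_right, abs_le, width]
      constructor <;> linarith [h1 x, h1 x₀, h2 x, h2 x₀]
    · refine Convex.translate_preimage_left ?_ _
      have e : {y : Euc (n + 1) | |⟪ζ, y⟫| ≤ width X ζ ∧ ‖y‖ ≤ L} =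
          (innerₛₗ ℝ ζ) ⁻¹' (Icc (-width X ζ) (width X ζ)) ∩ Metric.closedBall 0 L := by
        ext y
        simp [abs_le]
      rw [e]
      exact ((convex_Icc _ _).linear_preimage _).inter (convex_closedBall _ _)
  have h3 := measure_mono (μ := volume) hsub
  rw [measure_preimage_add_right, volume_body hX] at h3
  exact (ENNReal.ofReal_le_ofReal_iff (by positivity)).mp (h3.trans (volume_slab_le hζ hw hL0))

theorem width_le {X : M → Euc (n + 1)} (hX : Continuous X) {L : ℝ}
    (hL : ∀ x y, ‖X x - X y‖ ≤ L) {ζ : Euc (n + 1)} (hζ : ‖ζ‖ = 1) : width X ζ ≤ L := by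
  rw [width, supportFunction_eq_contact hX, supportFunction_eq_contact hX, inner_neg_left,
    ← sub_eq_add_neg, ← inner_sub_right]
  refine (real_inner_le_norm _ _).trans ?_
  rw [hζ, one_mul]
  exact hL _ _

end Diameter

/-! ### Behaviour of the widths under scaling -/

section Rescaled

variable {n : ℕ} {M : Type*}

theorem supportFunction_smul {a : ℝ} (ha : 0 ≤ a) (X : M → Euc (n + 1)) (ζ : Euc (n + 1)) :
    supportFunction (fun x => a • X x) ζ = a * supportFunction X ζ := by
  simp only [supportFunction, real_inner_smul_right, Real.mul_iSup_of_nonneg ha]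

theorem width_smul {a : ℝ} (ha : 0 ≤ a) (X : M → Euc (n + 1)) (ζ : Euc (n + 1)) :
    width (fun x => a • X x) ζ = a * width X ζ := by
  rw [width, supportFunction_smul ha, supportFunction_smul ha, width, mul_add]

theorem width_bounds {c C : ℝ} {X : M → Euc (n + 1)}
    (h : ∀ ζ, ‖ζ‖ = 1 → c ≤ width X ζ ∧ width X ζ ≤ C) :
    c ≤ widthMin X ∧ widthMin X ≤ widthMax X ∧ widthMax X ≤ C := by
  have hne : Nonempty (Metric.sphere (0 : Euc (n + 1)) 1) :=
    (NormedSpace.sphere_nonempty.mpr zero_le_one).to_subtype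
  have h' : ∀ ζ : Metric.sphere (0 : Euc (n + 1)) 1, c ≤ width X ζ ∧ width X ζ ≤ C :=
    fun ζ => h ζ (by simp)
  have z : Metric.sphere (0 : Euc (n + 1)) 1 := Classical.arbitrary _
  exact ⟨le_ciInf fun ζ => (h' ζ).1,
    (ciInf_le ⟨c, by rintro _ ⟨ζ, rfl⟩; exact (h' ζ).1⟩ z).trans
      (le_ciSup (f := fun ζ : Metric.sphere (0 : Euc (n + 1)) 1 => width X ζ)
        ⟨C, by rintro _ ⟨ζ, rfl⟩; exact (h' ζ).2⟩ z),
    ciSup_le fun ζ => (h' ζ).2⟩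

end Rescaled

/-! ### Scale invariant width bounds along the flow -/

section Flow

attribute [local instance 2000] chartedSpaceSelf

variable {n : ℕ} {M : Type*} [TopologicalSpace M] [CompactSpace M]
  [ChartedSpace (EuclideanSpace ℝ (Fin n)) M] [IsManifold (𝓡 n) ∞ M]
  [T2Space M] [Nonempty M] {α T : ℝ} {X ν : ℝ → M → Euc (n + 1)}

/-- The swept volume estimate starts at positive times, so the initial time is treated separately.
For `r < 1` the homothetic copy of the initial body about an interior point stays inside the body
for small times, whence `V(t) ≥ r^(n+1) V(0)`. -/
theorem IsGaussCurvatureFlow.continuousWithinAt_enclosedVolume_zero (hn : 1 ≤ n) (hα : 0 < α)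
    (hT : 0 < T) (hX : IsGaussCurvatureFlow α T X ν) :
    ContinuousWithinAt (fun t => enclosedVolume (X t)) (Ico 0 T) 0 := by
  have h0 : (0 : ℝ) ∈ Ico 0 T := ⟨le_rfl, hT⟩
  refine tendsto_order.mpr ⟨fun l hl => ?_, fun l hl => ?_⟩
  swap
  · filter_upwards [self_mem_nhdsWithin] with t ht
    exact (hX.enclosedVolume_antitone hn hα h0 ht ht.1).trans_lt hl
  obtain ⟨p, c, hc, hp⟩ := hX.exists_center hn hα h0
  obtain ⟨r, hlr, hr0, hr1⟩ : ∃ r : ℝ, l < r ^ (n + 1) * enclosedVolume (X 0) ∧ 0 < r ∧ r < 1 := by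
    have hcont : Tendsto (fun r : ℝ => r ^ (n + 1) * enclosedVolume (X 0)) (𝓝[<] 1)
        (𝓝 (1 ^ (n + 1) * enclosedVolume (X 0))) :=
      (Continuous.tendsto (by fun_prop) 1).mono_left nhdsWithin_le_nhds
    rw [one_pow, one_mul] at hcont
    exact ((hcont.eventually (lt_mem_nhds hl)).and (Ioo_mem_nhdsLT zero_lt_one)).exists
  have hf : ContinuousOn (fun z : ℝ × Euc (n + 1) =>
      (supportFunction (X z.1) z.2 - ⟪z.2, p⟫) - r * (supportFunction (X 0) z.2 - ⟪z.2, p⟫))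
      (Ico 0 T ×ˢ Metric.sphere 0 1) := by
    have h1 := hX.continuousOn_supportFunction hn subset_rfl fun t ht =>
        hX.strictlyConvex hn hα ht
    have h2 : ContinuousOn (fun z : ℝ × Euc (n + 1) => supportFunction (X 0) z.2)
        (Ico 0 T ×ˢ Metric.sphere 0 1) :=
      h1.comp (f := fun z : ℝ × Euc (n + 1) => ((0 : ℝ), z.2)) (by fun_prop)
        fun z hz => ⟨h0, hz.2⟩
    exact (h1.sub (by fun_prop)).sub (continuousOn_const.mul (h2.sub (by fun_prop)))
  have hev : ∀ᶠ t in 𝓝 (0 : ℝ), ∀ ζ ∈ Metric.sphere (0 : Euc (n + 1)) 1,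
      t ∈ Ico 0 T → ζ ∈ Metric.sphere (0 : Euc (n + 1)) 1 →
      0 < (supportFunction (X t) ζ - ⟪ζ, p⟫) - r * (supportFunction (X 0) ζ - ⟪ζ, p⟫) := by
    refine (isCompact_sphere _ _).eventually_forall_of_forall_eventually fun ζ hζ => ?_
    have h1 := hp ζ (mem_sphere_zero_iff_norm.mp hζ)
    have h2 := (hf (0, ζ) ⟨h0, hζ⟩).eventually (lt_mem_nhds (a := 0) (by nlinarith))
    rw [eventually_nhdsWithin_iff] at h2
    filter_upwards [h2] with z hz hz1 hz2 using hz ⟨hz1, hz2⟩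
  filter_upwards [hev.filter_mono nhdsWithin_le_nhds, self_mem_nhdsWithin] with t ht htI
  refine hlr.trans_le ?_
  have hsub : AffineMap.homothety p r '' body (X 0) ⊆ body (X t) := by
    rintro _ ⟨y, hy, rfl⟩
    refine (mem_body_iff (hX.continuous htI)).mpr fun ζ hζ => ?_
    have h1 := ht ζ (mem_sphere_zero_iff_norm.mpr hζ) htI (mem_sphere_zero_iff_norm.mpr hζ)
    have h2 := inner_le_of_mem_body (hX.continuous h0) hy ζ
    rw [AffineMap.homothety_apply, vsub_eq_sub, vadd_eq_add, inner_add_right,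
      real_inner_smul_right, inner_sub_right]
    nlinarith
  have h3 := measure_mono (μ := volume) hsub
  rw [Measure.addHaar_image_homothety, volume_body (hX.continuous htI),
    volume_body (hX.continuous h0), finrank_euclideanSpace, Fintype.card_fin,
    abs_of_pos (pow_pos hr0 _), ← ENNReal.ofReal_mul (pow_pos hr0 _).le] at h3
  exact (ENNReal.ofReal_le_ofReal_iff (hX.enclosedVolume_pos hn hα htI).le).mp h3

theorem IsGaussCurvatureFlow.continuousOn_enclosedVolume_Ico (hn : 1 ≤ n) (hα : 0 < α)
    (hX : IsGaussCurvatureFlow α T X ν) :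
    ContinuousOn (fun t => enclosedVolume (X t)) (Ico 0 T) := fun t ht => by
  rcases ht.1.eq_or_lt with rfl | h
  · exact hX.continuousWithinAt_enclosedVolume_zero hn hα ht.2
  · exact ((hX.continuousOn_enclosedVolume hn hα (half_pos h)
      (add_div_two_lt_right.mpr ht.2)).continuousAt
      (Icc_mem_nhds (half_lt_self h) (left_lt_add_div_two.mpr ht.2))).continuousWithinAt

/-- The volume is continuous and tends to zero, so the intermediate value theorem yields a time with
`V = V(0) exp (-τ)`. Injectivity of the time change does not matter, as the width bounds are uniform
over `[0, T)`. -/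
theorem IsGaussCurvatureFlow.originalTime_mem (hn : 1 ≤ n) (hα : 0 < α) (hT : 0 < T)
    (hX : IsGaussCurvatureFlow α T X ν)
    (hV : Tendsto (fun t => enclosedVolume (X t)) (𝓝[<] T) (𝓝 0)) {τ : ℝ} (hτ : 0 ≤ τ) :
    originalTime T X τ ∈ Ico 0 T := by
  have h0 : (0 : ℝ) ∈ Ico 0 T := ⟨le_rfl, hT⟩
  have hV0 := hX.enclosedVolume_pos hn hα h0
  refine Function.invFunOn_mem ?_
  have hpos : 0 < enclosedVolume (X 0) * Real.exp (-τ) := mul_pos hV0 (Real.exp_pos _)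
  obtain ⟨s, hs1, hs2⟩ := ((hV.eventually (gt_mem_nhds hpos)).and (Ioo_mem_nhdsLT hT)).exists
  obtain ⟨t, ht, hVt⟩ := intermediate_value_Icc' hs2.1.le
    ((hX.continuousOn_enclosedVolume_Ico hn hα).mono (Icc_subset_Ico_right hs2.2))
    ⟨hs1.le, mul_le_of_le_one_right hV0.le (Real.exp_le_one_iff.mpr (by linarith))⟩
  refine ⟨t, ⟨ht.1, ht.2.trans_lt hs2.2⟩, ?_⟩
  simp only at hVt
  rw [rescaledTime, hVt, mul_div_cancel_left₀ _ hV0.ne', Real.log_exp, neg_neg]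

/-- The diameter is bounded by the power of the volume with the same scaling. -/
theorem IsGaussCurvatureFlow.exists_norm_sub_le (hn : 1 ≤ n) (hα : 1 / (n : ℝ) < α) (hα1 : α ≤ 1)
    (hT : 0 < T) (hX : IsGaussCurvatureFlow α T X ν) :
    ∃ C > 0, ∀ t ∈ Ico 0 T, ∀ x y,
      ‖X t x - X t y‖ ≤ C * enclosedVolume (X t) ^ (1 / ((n : ℝ) + 1)) := by
  have hα0 : 0 < α := lt_trans (one_div_pos.mpr (by exact_mod_cast hn)) hα
  have h0 : (0 : ℝ) ∈ Ico 0 T := ⟨le_rfl, hT⟩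
  have hmid : T / 2 ∈ Ico 0 T := ⟨by linarith, by linarith⟩
  obtain ⟨q, hq, hqn, c, hc, hent⟩ :=
    hX.exists_entropy_bound hn hα hα1 (a := T / 2) ⟨by linarith, by linarith⟩
  obtain ⟨C₁, hC₁, hdiam⟩ := exists_diameter_bound (M := M) hq (by linarith : q < n + 1) hc
  have hVm := hX.enclosedVolume_pos hn hα0 hmid
  set W := enclosedVolume (X (T / 2)) ^ (1 / ((n : ℝ) + 1)) with hW
  have hW0 : 0 < W := Real.rpow_pos_of_pos hVm _
  obtain ⟨L, hL⟩ := (isCompact_body (hX.continuous h0)).isBounded.exists_norm_le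
  have hL0 : 0 ≤ L := (norm_nonneg _).trans (hL (X 0 (Classical.arbitrary M))
    (subset_convexHull ℝ _ ⟨_, rfl⟩))
  refine ⟨max C₁ (2 * L / W), lt_max_of_lt_left hC₁, fun t ht x y => ?_⟩
  have hVt := hX.enclosedVolume_pos hn hα0 ht
  have hVt' : 0 ≤ enclosedVolume (X t) ^ (1 / ((n : ℝ) + 1)) := Real.rpow_nonneg hVt.le _
  -- Late times use the entropy. At early times the diameter is at most that of a ball containing
  -- the initial body, and the volume is at least its value at `T / 2`.
  rcases le_total (T / 2) t with h | h
  · refine (hdiam (X t) (hX.continuous ht) hVt ?_ (hent t ⟨h, ht.2⟩) x y).trans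
      (mul_le_mul_of_nonneg_right (le_max_left _ _) hVt')
    obtain ⟨p, r, hr, hp⟩ := hX.exists_center hn hα0 ht
    exact ⟨p, r / 2, half_pos hr, (Metric.closedBall_subset_ball (half_lt_self hr)).trans
      (ball_subset_body (hX.continuous ht) hp)⟩
  · have hb : ∀ x, ‖X t x‖ ≤ L := fun x =>
      hL _ (hX.body_antitone hn hα0 h0 ht ht.1 (subset_convexHull ℝ _ ⟨x, rfl⟩))
    have h1 : ‖X t x - X t y‖ ≤ 2 * L := (norm_sub_le _ _).trans (by linarith [hb x, hb y])
    have h2 : W ≤ enclosedVolume (X t) ^ (1 / ((n : ℝ) + 1)) :=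
      Real.rpow_le_rpow hVm.le (hX.enclosedVolume_antitone hn hα0 ht hmid h) (by positivity)
    calc ‖X t x - X t y‖ ≤ 2 * L / W * W := by rwa [div_mul_cancel₀ _ hW0.ne']
      _ ≤ _ := mul_le_mul (le_max_right _ _) h2 hW0.le (hC₁.le.trans (le_max_left _ _))

/-- The width is comparable to the power of the volume with the same scaling. -/
theorem IsGaussCurvatureFlow.exists_width_bounds (hn : 1 ≤ n) (hα : 1 / (n : ℝ) < α) (hα1 : α ≤ 1)
    (hT : 0 < T) (hX : IsGaussCurvatureFlow α T X ν) :
    ∃ c > 0, ∃ C, ∀ t ∈ Ico 0 T, ∀ ζ, ‖ζ‖ = 1 →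
      c * enclosedVolume (X t) ^ (1 / ((n : ℝ) + 1)) ≤ width (X t) ζ ∧
      width (X t) ζ ≤ C * enclosedVolume (X t) ^ (1 / ((n : ℝ) + 1)) := by
  have hα0 : 0 < α := lt_trans (one_div_pos.mpr (by exact_mod_cast hn)) hα
  obtain ⟨C, hC, hdiam⟩ := hX.exists_norm_sub_le hn hα hα1 hT
  -- With `W = V^(1/(n+1))` and diameter at most `C W`, the bound `W^(n+1) ≤ 2 w (2 C W)^n` for the
  -- width `w` gives the lower constant.
  refine ⟨1 / (2 * (2 * C) ^ n), by positivity, C, fun t ht ζ hζ =>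
    ⟨?_, width_le (hX.continuous ht) (hdiam t ht) hζ⟩⟩
  have hVt := hX.enclosedVolume_pos hn hα0 ht
  have h := enclosedVolume_le_width (hX.continuous ht) (hdiam t ht) hζ
  set W := enclosedVolume (X t) ^ (1 / ((n : ℝ) + 1)) with hW
  have hW0 : 0 < W := Real.rpow_pos_of_pos hVt _
  have hVW : enclosedVolume (X t) = W ^ n * W := by
    rw [← pow_succ, hW, ← Real.rpow_natCast, ← Real.rpow_mul hVt.le]
    push_cast
    rw [one_div_mul_cancel (by positivity), Real.rpow_one]
  rw [hVW, ← mul_assoc 2 C W, mul_pow (2 * C) W n] at h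
  have h2 : W ≤ 2 * width (X t) ζ * (2 * C) ^ n :=
    le_of_mul_le_mul_left (h.trans (le_of_eq (by ring))) (pow_pos hW0 n)
  rw [one_div_mul_eq_div, div_le_iff₀ (by positivity)]
  linarith

end Flow

end GaussFlow

end

theorem corollary4p8 (n : ℕ) (hn : 1 ≤ n) (α : ℝ) (hα : 1 / (n : ℝ) < α) (hα' : α ≤ 1)
    {M : Type*} [TopologicalSpace M] [ChartedSpace (EuclideanSpace ℝ (Fin n)) M]
    [IsManifold (𝓡 n) ∞ M] [CompactSpace M] [ConnectedSpace M]
    (T : ℝ) (hT : 0 < T) (X ν : ℝ → M → EuclideanSpace ℝ (Fin (n + 1)))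
    (hX : GaussFlow.IsGaussCurvatureFlow α T X ν)
    (hV : Tendsto (fun t => GaussFlow.enclosedVolume (X t)) (𝓝[<] T) (𝓝 0)) :
    ∃ c C : ℝ, 0 < c ∧ c ≤ C ∧ ∀ τ : ℝ, 0 ≤ τ →
      c ≤ GaussFlow.widthMin (GaussFlow.rescaled T X τ) ∧
      GaussFlow.widthMin (GaussFlow.rescaled T X τ) ≤
        GaussFlow.widthMax (GaussFlow.rescaled T X τ) ∧
      GaussFlow.widthMax (GaussFlow.rescaled T X τ) ≤ C := by
  -- `M` embeds in a Euclidean space, hence is Hausdorff.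
  have : T2Space M := (hX.embedding 0 ⟨le_rfl, hT⟩).isEmbedding.t2Space
  have hα0 : 0 < α := lt_trans (one_div_pos.mpr (by exact_mod_cast hn)) hα
  obtain ⟨c, hc, C, hw⟩ := hX.exists_width_bounds hn hα hα' hT
  have key : ∀ τ : ℝ, 0 ≤ τ → ∀ ζ, ‖ζ‖ = 1 → c ≤ GaussFlow.width (GaussFlow.rescaled T X τ) ζ ∧
      GaussFlow.width (GaussFlow.rescaled T X τ) ζ ≤ C := fun τ hτ ζ hζ => by
    have ht := hX.originalTime_mem hn hα0 hT hV hτ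
    obtain ⟨h1, h2⟩ := hw _ ht ζ hζ
    have hW := Real.rpow_pos_of_pos (hX.enclosedVolume_pos hn hα0 ht) (1 / ((n : ℝ) + 1))
    have he : GaussFlow.width (GaussFlow.rescaled T X τ) ζ = _ :=
      GaussFlow.width_smul (inv_pos.mpr hW).le (X (GaussFlow.originalTime T X τ)) ζ
    rw [he, inv_mul_eq_div, le_div_iff₀ hW, div_le_iff₀ hW]
    exact ⟨h1, h2⟩
  have h := fun τ hτ => GaussFlow.width_bounds (key τ hτ)
  exact ⟨c, C, hc, (h 0 le_rfl).1.trans ((h 0 le_rfl).2.1.trans (h 0 le_rfl).2.2), h⟩
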